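/- Let $\mathfrak a,\mathfrak b\in\{0,1\}$ and let $g\ge 0$ be an integer, with $g\ge 1$ if $\mathfrak a=1$. Put $\mathcal S_{\mathfrak b}=\{\infty\}$ if $\mathfrak b=0$ and $\mathcal S_{\mathfrak b}=\{0,\infty\}$ if $\mathfrak b=1$, and $$d_a=2g+(1-\mathfrak a)(1-\mathfrak b),\qquad d_b=g+\mathfrak b+\mathfrak{ab},\qquad d_c=g+1+\mathfrak{ab}.$$ Fix one of the following reality conditions on triples of polynomials (only (R1) is allowed if $\mathfrak b=0$); $(a,b)$, respectively $c$, is called real if it is fixed by (R1) $a\mapsto\overline{a(\bar\lambda)}$, $b\mapsto\overline{b(\bar\lambda)}$, respectively $c\mapsto\overline{c(\bar\lambda)}$; (R2) $a\mapsto\lambda^{d_a}\overline{a(\bar\lambda^{-1})}$, $b\mapsto-\lambda^{d_b}\overline{b(\bar\lambda^{-1})}$, respectively $c\mapsto\lambda^{d_c}\overline{c(\bar\lambda^{-1})}$; (R3) $a\mapsto\lambda^{d_a}\overline{a(-\bar\lambda^{-1})}$, $b\mapsto(-1)^g\lambda^{d_b}\overline{b(-\bar\lambda^{-1})}$, respectively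 $c\mapsto(-1)^{\mathfrak a}\lambda^{d_c}\overline{c(-\bar\lambda^{-1})}$. Let $\mathcal P$ be the set of real pairs $(a,b)$ of complex polynomials of degrees $d_a$ and $d_b$ such that $a$ is normalised (monic for (R1); highest and lowest coefficient of absolute value $1$ for (R2), (R3)), $a$ and $b$ have no zero in $\mathbb C\cap\mathcal S_{\mathfrak b}$, and the differential $$\omega=\frac{b(\lambda)}{\lambda^{\mathfrak b+\mathfrak{ab}}\nu}\,d\lambda\quad\text{on the spectral curve }\Sigma:\ \nu^2=\lambda^{(1-\mathfrak a)\mathfrak b}a(\lambda)$$ has no residues at the points of $\Sigma$ over $\mathcal S_{\mathfrak b}$. Let $\mathcal R\subset\mathcal P$ be the set of pairs for which $b/a$ has at most first order poles on $\mathbb C\setminus\mathcal S_{\mathfrak b}$, and let $\mathcal T=\{(a,b)\in\mathcal R\mid\operatorname{res}(a,b)\neq0\}$; equivalently, $\mathcal T$ is the set of $(a,b)\in\mathcal P$ with $\operatorname{disc}(a)\ne0\ne\operatorname{res}(a,b)$. The periods of $(a,b)$ are the integrals of $\omega$ along the cycles in $H_1(\Sigma,\mathbb Z)$. Near a given $(a,b)\in\mathcal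 T$ each cycle of $\Sigma$ is carried along continuously to the spectral curves of nearby pairs, so that its period becomes a function of the pair. The isoperiodic set $\mathcal I(a,b)$ is the set of all $(\tilde a,\tilde b)$ in a neighbourhood $\mathcal U$ of $(a,b)$ in $\mathcal R$ all of whose periods are equal to the corresponding periods of $(a,b)$. Here $\mathcal U$ is given by any $r>0$ for which the closed discs of radius $r$ around the roots of $a$ are disjoint and contain no point of $\mathcal S_{\mathfrak b}$: it is the set of $(\tilde a,\tilde b)\in\mathcal R$ for which $\tilde a/a$ has positive real part at all points of $\mathbb P^1$ outside the open discs of radius $r$ around the roots of $a$, and the cycles are represented by closed paths whose $\lambda$-values stay outside these open discs and $\mathcal S_{\mathfrak b}$; they are carried along by keeping $\lambda$ and replacing $\nu$ by $\tilde\nu=\nu\sqrt{\tilde a/a}$ with the principal branch of the root. Then $\mathcal T$ is a smooth submanifold, of dimension $3g+2-2\mathfrak a+\mathfrak{ab}$, of the real vector space of pairs of polynomials of degree at most $d_a$ and $d_b$, and for every $(a,b)\in\mathcal T$ the following holds. 1. For each real polynomial $c$ of degree at most $d_c$ there is a unique tangent vector $(\dot a,\dot b)\in T_{(a,b)}\mathcal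 T$ such that $$\lambda^{1-\mathfrak b}\big(2a\dot b-\dot a b\big)=\lambda\big(2ac'-a'c\big)-\mathfrak b(1+\mathfrak a)\,a\,c,$$ that is, such that the derivative of $\frac{b}{\lambda^{\mathfrak b+\mathfrak{ab}}\nu}$ in direction $(\dot a,\dot b)$ equals $\frac{\partial}{\partial\lambda}\frac{c}{\lambda^{\mathfrak{ab}}\nu}$. 2. A tangent vector $(\dot a,\dot b)\in T_{(a,b)}\mathcal T$ is in the kernel of the derivatives of all periods if and only if it is of the form in 1 for some such $c$. 3. $\mathcal I(a,b)\cap\mathcal T$ is a smooth submanifold of $\mathcal T$ of dimension $g+2+\mathfrak{ab}$. -/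

import Mathlib

open Polynomial
open scoped ContDiff Topology

noncomputable section

namespace Whitham

/-- The three anti-holomorphic involutions of the `λ`-plane. -/
inductive Reality
  /-- the involution `λ ↦ conj λ` -/
  | line
  /-- the involution `λ ↦ 1 / conj λ` -/
  | circle
  /-- the involution `λ ↦ - 1 / conj λ` -/
  | antipodal

namespace Reality

/-- The action of the involution on a point `λ ≠ 0`. -/
def conj : Reality → ℂ → ℂ
  | line, z => (starRingEnd ℂ) z
  | circle, z => ((starRingEnd ℂ) z)⁻¹
  | antipodal, z => -((starRingEnd ℂ) z)⁻¹

/-- The factor `λ ^ n` which turns `conj (p (conj λ)⁻¹)` into a polynomial when `deg p ≤ n`. -/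
def factor : Reality → ℕ → ℂ → ℂ
  | line, _, _ => 1
  | circle, n, z => z ^ n
  | antipodal, n, z => z ^ n

/-- The sign with which the involution acts on the polynomial `b`. -/
def signB (g : ℕ) : Reality → ℂ
  | line => 1
  | circle => -1
  | antipodal => (-1) ^ g

/-- The sign with which the involution acts on the polynomial `c`. -/
def signC (α : ℕ) : Reality → ℂ
  | line => 1
  | circle => 1
  | antipodal => (-1) ^ α

/-- `p` is a fixed point of the anti-linear involution
`p ↦ s * conj (p (conj λ))`, respectively `p ↦ s * λ ^ n * conj (p (± (conj λ)⁻¹))`,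
of the space of polynomials of degree at most `n`. -/
def Fixes (ρ : Reality) (s : ℂ) (n : ℕ) (p : ℂ[X]) : Prop :=
  ∀ z : ℂ, z ≠ 0 → s * ρ.factor n z * (starRingEnd ℂ) (p.eval (ρ.conj z)) = p.eval z

end Reality

/-- The degree of `a`. -/
def degA (α β g : ℕ) : ℕ := 2 * g + (1 - α) * (1 - β)

/-- The degree of `b`. -/
def degB (α β g : ℕ) : ℕ := g + β + α * β

/-- The maximal degree of `c`. -/
def degC (α β g : ℕ) : ℕ := g + 1 + α * β

/-- The finite-dimensional real vector space of the coefficients of all pairs `(a, b)` of complex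
polynomials of degree at most `degA` and `degB`. -/
abbrev Coeffs (α β g : ℕ) : Type :=
  (Fin (degA α β g + 1) → ℂ) × (Fin (degB α β g + 1) → ℂ)

/-- The polynomial with given coefficients. -/
def toPoly {n : ℕ} (v : Fin n → ℂ) : ℂ[X] := ∑ i, C (v i) * X ^ (i : ℕ)

section Space

variable {α β g : ℕ}

/-- The polynomial `a` of a pair `(a, b)`. -/
def polyA (x : Coeffs α β g) : ℂ[X] := toPoly x.1

/-- The polynomial `b` of a pair `(a, b)`. -/
def polyB (x : Coeffs α β g) : ℂ[X] := toPoly x.2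

/-- The right hand side of the equation `ν ^ 2 = λ ^ ((1 - α) β) a(λ)` of the spectral curve. -/
def curveRHS (x : Coeffs α β g) (z : ℂ) : ℂ := z ^ ((1 - α) * β) * (polyA x).eval z

/-- The coefficient of `dλ` in the differential `ω = b(λ) / (λ ^ (β + α β) ν) dλ`, at the point
`(z, w)` of the spectral curve. -/
def omega (x : Coeffs α β g) (z w : ℂ) : ℂ := (polyB x).eval z / (z ^ (β + α * β) * w)

/-- The integral of `ω` over every closed lift to the spectral curve of the circle of radius `R`
around `0` vanishes. For small (large) `R` this says that the residues at the points of the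
spectral curve over `λ = 0` (over `λ = ∞`) vanish if there are two such points. If there is only
one such point (a branch point), then the circle has no closed lift, and the residue
vanishes since `ω` is anti-symmetric. -/
def CircleIntegralsVanish (x : Coeffs α β g) (R : ℝ) : Prop :=
  ∀ ν : ℂ → ℂ, ContinuousOn ν (Metric.sphere 0 R) →
    (∀ z ∈ Metric.sphere (0 : ℂ) R, ν z ^ 2 = curveRHS x z) →
    (∮ z in C(0, R), omega x z (ν z)) = 0

/-- The polynomial `a` is normalised. -/
def Normalised (ρ : Reality) (x : Coeffs α β g) : Prop :=
  match ρ with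
  | .line => x.1 (Fin.last _) = 1
  | .circle => ‖x.1 (Fin.last _)‖ = 1 ∧ ‖x.1 0‖ = 1
  | .antipodal => ‖x.1 (Fin.last _)‖ = 1 ∧ ‖x.1 0‖ = 1

end Space

/-- The space `P` of spectral data. -/
structure IsSpectralData {α β g : ℕ} (ρ : Reality) (x : Coeffs α β g) : Prop where
  normalised : Normalised ρ x
  /-- the degree of `b` is exactly `degB` -/
  lead_ne_zero : x.2 (Fin.last _) ≠ 0
  eval_zero_a : β = 1 → (polyA x).eval 0 ≠ 0
  eval_zero_b : β = 1 → (polyB x).eval 0 ≠ 0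
  real_a : ρ.Fixes 1 (degA α β g) (polyA x)
  real_b : ρ.Fixes (ρ.signB g) (degB α β g) (polyB x)
  /-- no residues over `λ = ∞` -/
  residue_infty : ∀ᶠ R : ℝ in Filter.atTop, CircleIntegralsVanish x R
  /-- no residues over `λ = 0`, if this is a marked point -/
  residue_zero : β = 1 → ∀ᶠ R : ℝ in 𝓝[>] 0, CircleIntegralsVanish x R

/-- The subset `R` of the pairs for which `b / a` has at most first order poles on the complement
of the marked points. -/
def spaceR (α β g : ℕ) (ρ : Reality) : Set (Coeffs α β g) :=
  {x | IsSpectralData ρ x ∧ ∀ z : ℂ, (β = 1 → z ≠ 0) →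
    (polyA x).rootMultiplicity z ≤ (polyB x).rootMultiplicity z + 1}

/-- The subset `T` of `R` of the pairs with non-vanishing resultant. -/
def spaceT (α β g : ℕ) (ρ : Reality) : Set (Coeffs α β g) :=
  {x | x ∈ spaceR α β g ρ ∧ resultant (polyA x) (polyB x) ≠ 0}

section Manifolds

variable {E : Type*} [NormedAddCommGroup E] [NormedSpace ℝ E]

/-- `M` is a (smooth, embedded) submanifold of dimension `d` of the finite-dimensional real vector
space `E`: locally `M` is the zero set of a smooth submersion to `ℝ ^ k` with
`d + k = dim E`. -/
def IsSmoothSubmanifold (d : ℕ) (M : Set E) : Prop :=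
  ∀ x ∈ M, ∃ (k : ℕ) (U : Set E) (f : E → (Fin k → ℝ)),
    IsOpen U ∧ x ∈ U ∧ ContDiffOn ℝ ∞ f U ∧
    (∀ y ∈ U, Function.Surjective (fderiv ℝ f y)) ∧
    M ∩ U = {y ∈ U | f y = 0} ∧ d + k = Module.finrank ℝ E

/-- The tangent vectors of `M` at `x`: the velocities of the smooth curves in `M` through `x`. -/
def tangentVectors (M : Set E) (x : E) : Set E :=
  {v | ∃ γ : ℝ → E, γ 0 = x ∧ ContDiffAt ℝ ∞ γ 0 ∧ HasDerivAt γ v 0 ∧ ∀ᶠ t in 𝓝 0, γ t ∈ M}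

end Manifolds

section Periods

variable {α β g : ℕ}

/-- A closed piecewise continuously differentiable path `t ↦ (γ t, ν t)`, `0 ≤ t ≤ 1`, in the
spectral curve of `x`, which avoids the points where `λ` is a marked point or a root of `a`. Every
class in the first homology group of the spectral curve is represented by such paths. -/
structure IsCycle (x : Coeffs α β g) (γ ν : ℝ → ℂ) : Prop where
  continuousOn_fst : ContinuousOn γ (Set.Icc 0 1)
  continuousOn_snd : ContinuousOn ν (Set.Icc 0 1)
  closed_fst : γ 0 = γ 1
  closed_snd : ν 0 = ν 1
  piecewise : ∃ (s : Finset ℝ) (K : ℝ), ∀ t ∈ Set.Icc (0 : ℝ) 1, t ∉ s →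
    ContDiffAt ℝ 1 γ t ∧ ‖deriv γ t‖ ≤ K
  ne_zero : β = 1 → ∀ t ∈ Set.Icc (0 : ℝ) 1, γ t ≠ 0
  not_root : ∀ t ∈ Set.Icc (0 : ℝ) 1, (polyA x).eval (γ t) ≠ 0
  on_curve : ∀ t ∈ Set.Icc (0 : ℝ) 1, ν t ^ 2 = curveRHS x (γ t)

/-- The integral of the differential `ω` of `x` over the path `t ↦ (γ t, ν t)`. -/
def integral (x : Coeffs α β g) (γ ν : ℝ → ℂ) : ℂ :=
  ∫ t in (0 : ℝ)..1, omega x (γ t) (ν t) * deriv γ t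

/-- The continuation `ν * sqrt (ã / a)` of a lift `ν` of the path `γ` from the spectral curve of
`x = (a, b)` to the spectral curve of `y = (ã, b̃)`. When `ã / a` has positive real part along
`γ`, this is the lift which is obtained from `ν` by continuous deformation. -/
def continuedLift (x y : Coeffs α β g) (γ ν : ℝ → ℂ) : ℝ → ℂ := fun t =>
  ν t * ((polyA y).eval (γ t) / (polyA x).eval (γ t)) ^ (1 / 2 : ℂ)

/-- The continued lift does lie on the spectral curve of `y`. -/
theorem continuedLift_sq (x y : Coeffs α β g) (γ ν : ℝ → ℂ) (h : IsCycle x γ ν) (t : ℝ)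
    (ht : t ∈ Set.Icc (0 : ℝ) 1) : continuedLift x y γ ν t ^ 2 = curveRHS y (γ t) := by
  have h1 := h.on_curve t ht
  have h2 := h.not_root t ht
  have h3 : ∀ w : ℂ, (w ^ (1 / 2 : ℂ)) ^ 2 = w := fun w => by
    simp
  rw [continuedLift, mul_pow, h3, h1, curveRHS, curveRHS]
  field_simp

/-- The period over a given cycle of the spectral curve of `x`, as a function of the data `y` in a
neighbourhood of `x`: the cycle is moved continuously to the spectral curve of `y`. -/
def period (x : Coeffs α β g) (γ ν : ℝ → ℂ) (y : Coeffs α β g) : ℂ :=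
  integral y γ (continuedLift x y γ ν)

/-- The vectors which belong to the kernels of the derivatives at `x` of all periods. -/
def periodKernel (x : Coeffs α β g) : Set (Coeffs α β g) :=
  {v | ∀ γ ν : ℝ → ℂ, IsCycle x γ ν →
    ∃ L : Coeffs α β g →L[ℝ] ℂ, HasFDerivAt (period x γ ν) L x ∧ L v = 0}

/-- The closed discs of radius `r` around the different roots of `a` are disjoint and do not
contain the marked points. -/
def IsAdmissibleRadius (x : Coeffs α β g) (r : ℝ) : Prop :=
  0 < r ∧
  (∀ z w : ℂ, (polyA x).IsRoot z → (polyA x).IsRoot w → z ≠ w →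
    Disjoint (Metric.closedBall z r) (Metric.closedBall w r)) ∧
  (β = 1 → ∀ z : ℂ, (polyA x).IsRoot z → (0 : ℂ) ∉ Metric.closedBall z r)

/-- The complement in `ℂ` of the open discs of radius `r` around the roots of `a`. -/
def outside (x : Coeffs α β g) (r : ℝ) : Set ℂ :=
  {z | ∀ w : ℂ, (polyA x).IsRoot w → z ∉ Metric.ball w r}

/-- The pairs `y = (ã, b̃)` for which `ã / a` has positive real part at all points of the Riemann
sphere outside of the discs of radius `r` around the roots of `a`. The roots of `ã` then stay in
these discs, each of which contains as many roots of `ã` as roots of `a`. -/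
def neighbourhood (x : Coeffs α β g) (r : ℝ) : Set (Coeffs α β g) :=
  {y | 0 < (y.1 (Fin.last _) / x.1 (Fin.last _)).re ∧
    ∀ z ∈ outside x r, 0 < ((polyA y).eval z / (polyA x).eval z).re}

/-- The isoperiodic set of `x` in the neighbourhood of `x` in `R` determined by the radius `r`:
all periods take the same values at `y` as at `x`. The cycles are represented by paths outside of
the discs of radius `r` around the roots of `a`. -/
def isoperiodicSet (ρ : Reality) (x : Coeffs α β g) (r : ℝ) : Set (Coeffs α β g) :=
  {y | y ∈ spaceR α β g ρ ∧ y ∈ neighbourhood x r ∧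
    ∀ γ ν : ℝ → ℂ, IsCycle x γ ν → (∀ t ∈ Set.Icc (0 : ℝ) 1, γ t ∈ outside x r) →
      period x γ ν y = integral x γ ν}

end Periods

section Flow

variable {α β g : ℕ}

/-- The admissible polynomials `c`. -/
def IsAdmissible (α β g : ℕ) (ρ : Reality) (c : ℂ[X]) : Prop :=
  c.natDegree ≤ degC α β g ∧ ρ.Fixes (ρ.signC α) (degC α β g) c

/-- The integrability equation: for `v = (ȧ, ḃ)` it says that the `λ`-derivative of
`c / (λ ^ (α β) ν)` is equal to the derivative of `b / (λ ^ (β + α β) ν)` in direction `v`. -/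
def Integrability (x v : Coeffs α β g) (c : ℂ[X]) : Prop :=
  X ^ (1 - β) * (2 * polyA x * polyB v - polyA v * polyB x) =
    X * (2 * polyA x * derivative c - derivative (polyA x) * c)
      - C ((β * (1 + α) : ℕ) : ℂ) * polyA x * c

end Flow

end Whitham

end

/-! Three linear-algebra facts and one exactness statement carry the theorem.

`T` is a manifold because, near one of its points and inside the real vector space `realPairs`, it
is the zero set of the quadratic map `constraint`: the squared modulus of the top coefficient of `a`
is `1`, and for `α = 1` the two residue numbers vanish. For `α = 0` the marked points are branch
points and have no residues; all remaining conditions are open (`spaceT_eventually_iff`). The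
derivative is onto its real target: the residues are moved by varying `b` alone (`exists_polar_eq`),
the normalisation by the weighted rescaling `(t ^ 2 a, t b)`.

The flow equation relates `v = (ȧ, ḃ)` and `c` bijectively. Since `a` and `b` are coprime, Bezout
solves it for `v`; the solution is unique up to multiples of the rescaling, which the normalisation
fixes, and the residue conditions on `v` can be read off from the extreme coefficients
(`existsUnique_integrability`). Since `a` has simple roots, `v` determines `c`: a homogeneous
solution would vanish at a root of `a` to an order `m` with `2 m = 1`
(`eq_zero_of_flowRHS_eq_zero`). So the flow vectors form a space of dimension `degC + 1`
(`finrank_flowSpace`).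

The derivative of a period along `v` is the integral of `(2 a ḃ - ȧ b) / (2 a λ ^ k ν) dλ` with `k =
β + α β` (`IsCycle.hasFDerivAt_period`). If `c` exists, this form is the differential of `c / (λ ^
(α β) ν)` and its integrals over cycles vanish. Conversely, suppose all these integrals vanish. Half
the integral from `(λ, -ν)` to `(λ, ν)`, times `ν`, is then a single-valued function `f` of `λ`
outside the discs (`exists_primitive_of_periods`). It solves a first order equation which also has a
holomorphic solution inside each disc; the two agree on the overlap, because their difference
squared is a constant multiple of a function without a continuous root there (`eq_local_solution`).
The marked points are regular singular points, so `f` grows polynomially and is a Laurent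
polynomial, from which `c` results (`exists_polynomial_of_periods`). Degree and reality of `c`
follow from the equation.

For the isoperiodic set, the derivatives of all periods vanish on the flow vectors at every nearby
point of `T`, and at points of the set these are their whole common kernel. Finitely many periods
with independent derivatives cut out a manifold of the right dimension; its tangent spaces are then
the flow spaces, so all other periods are constant on it (`exists_isLocalSubmersion_levelSet`). -/

namespace Whitham

set_option linter.unusedSectionVars false

/-! ### Submanifolds as zero sets of submersions. -/

section Manifold

variable {E : Type*} [NormedAddCommGroup E] [NormedSpace ℝ E] [FiniteDimensional ℝ E]
  {F : Type*} [NormedAddCommGroup F] [NormedSpace ℝ F] [FiniteDimensional ℝ F]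

/-- Near `x` the set `M` is the zero set of the submersion `f` which is smooth on `U`. -/
structure IsLocalSubmersion (M : Set E) (x : E) (f : E → F) (U : Set E) : Prop where
  isOpen : IsOpen U
  mem : x ∈ U
  contDiffOn : ContDiffOn ℝ ∞ f U
  surjective : Function.Surjective (fderiv ℝ f x)
  zero : f x = 0
  eventually_iff : ∀ᶠ y in 𝓝 x, y ∈ M ↔ f y = 0

/-- Surjectivity means that the rank is at least the dimension of the target, and the rank is lower
semicontinuous. -/
theorem isOpen_setOf_surjective : IsOpen {L : E →L[ℝ] F | Function.Surjective L} := by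
  have h := isOpen_setOfPred_nat_le_rank (𝕜 := ℝ) (E := E) (F := F) (Module.finrank ℝ F)
  convert h using 1
  ext L
  simp only [Set.mem_ofPred_eq]
  rw [LinearMap.rank, ← Module.finrank_eq_rank, Nat.cast_le]
  constructor
  · intro hL
    have : (L : E →ₗ[ℝ] F).range = ⊤ := LinearMap.range_eq_top.2 hL
    rw [this, finrank_top]
  · intro hL
    have : (L : E →ₗ[ℝ] F).range = ⊤ :=
      Submodule.eq_top_of_finrank_eq (le_antisymm (Submodule.finrank_le _) hL)
    exact LinearMap.range_eq_top.1 this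

namespace IsLocalSubmersion

variable {M : Set E} {x : E} {f : E → F} {U : Set E}

theorem contDiffAt (h : IsLocalSubmersion M x f U) : ContDiffAt ℝ ∞ f x :=
  h.contDiffOn.contDiffAt (h.isOpen.mem_nhds h.mem)

theorem eventually_surjective (h : IsLocalSubmersion M x f U) :
    ∀ᶠ y in 𝓝 x, Function.Surjective (fderiv ℝ f y) :=
  (h.contDiffAt.continuousAt_fderiv (by simp)).eventually
    (isOpen_setOf_surjective.mem_nhds h.surjective)

/-- Surjectivity is assumed only at `x`; it persists nearby, so shrinking `U` gives it everywhere.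
The target becomes `ℝ ^ k` through a linear isomorphism. -/
theorem exists_submersion (h : IsLocalSubmersion M x f U) {d : ℕ}
    (hd : d + Module.finrank ℝ F = Module.finrank ℝ E) :
    ∃ (k : ℕ) (U : Set E) (f : E → (Fin k → ℝ)),
      IsOpen U ∧ x ∈ U ∧ ContDiffOn ℝ ∞ f U ∧
      (∀ y ∈ U, Function.Surjective (fderiv ℝ f y)) ∧
      M ∩ U = {y ∈ U | f y = 0} ∧ d + k = Module.finrank ℝ E := by
  let e : F ≃L[ℝ] (Fin (Module.finrank ℝ F) → ℝ) :=
    ContinuousLinearEquiv.ofFinrankEq (by simp)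
  obtain ⟨V, hV, hVo, hxV⟩ := eventually_nhds_iff.1 (h.eventually_surjective.and h.eventually_iff)
  refine ⟨_, U ∩ V, e ∘ f, h.isOpen.inter hVo, ⟨h.mem, hxV⟩,
    e.contDiff.comp_contDiffOn (h.contDiffOn.mono Set.inter_subset_left), ?_, ?_, hd⟩
  · intro y hy
    rw [e.comp_fderiv]
    exact e.surjective.comp (hV y hy.2).1
  · ext y
    simp only [Set.mem_inter_iff, Set.mem_ofPred_eq, Function.comp_apply,
      EmbeddingLike.map_eq_zero_iff]
    constructor
    · rintro ⟨h1, h2⟩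
      exact ⟨h2, (hV y h2.2).2.1 h1⟩
    · rintro ⟨h1, h2⟩
      exact ⟨(hV y h1.2).2.2 h2, h1⟩

/-- A parametrisation of the level set of a submersion by the kernel of the derivative. -/
theorem _root_.Whitham.exists_chart {f : E → F} {x : E} (hf : ContDiffAt ℝ ∞ f x)
    (hs : Function.Surjective (fderiv ℝ f x)) :
    ∃ (g : (fderiv ℝ f x).ker → E) (π : E →L[ℝ] (fderiv ℝ f x).ker), g 0 = x ∧
      ContDiffAt ℝ ∞ g 0 ∧ HasFDerivAt g (fderiv ℝ f x).ker.subtypeL 0 ∧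
      (∀ᶠ u in 𝓝 0, f (g u) = f x) ∧ ∀ᶠ y in 𝓝 x, f y = f x → g (π (y - x)) = y := by
  have hst : HasStrictFDerivAt f (fderiv ℝ f x) x := hf.hasStrictFDerivAt (by simp)
  have hr : (fderiv ℝ f x).range = ⊤ := LinearMap.range_eq_top.2 hs
  have hc : (fderiv ℝ f x).ker.ClosedComplemented :=
    ContinuousLinearMap.ker_closedComplemented_of_finiteDimensional_range _
  -- The second component of the straightening map is a continuous linear projection onto the
  -- kernel, so the implicit function is as smooth as `f`.
  have hsm := ImplicitFunctionData.contDiffAt_implicitFunction (n := ∞)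
    (φ := HasStrictFDerivAt.implicitFunctionDataOfComplemented f (fderiv ℝ f x) hst hr hc)
    hf (by
      simp only [HasStrictFDerivAt.implicitFunctionDataOfComplemented]
      fun_prop) (by simp)
  have hpt : (HasStrictFDerivAt.implicitFunctionDataOfComplemented f (fderiv ℝ f x) hst hr hc).prodFun
      x = (f x, 0) := by
    simp [ImplicitFunctionData.prodFun]
  refine ⟨hst.implicitFunctionOfComplemented f _ hr hc (f x), Classical.choose hc, ?_, ?_, ?_, ?_, ?_⟩
  · simp
  · have h2 : ContDiffAt ℝ ∞ (fun u : (fderiv ℝ f x).ker => (f x, u)) 0 := by fun_prop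
    change ContDiffAt ℝ ∞ _ (ImplicitFunctionData.prodFun _ x) at hsm
    rw [hpt] at hsm
    exact hsm.comp (0 : (fderiv ℝ f x).ker) h2
  · exact (hst.to_implicitFunctionOfComplemented hr hc).hasFDerivAt
  · have h1 := hst.map_implicitFunctionOfComplemented_eq hr hc
    have h2 : Filter.Tendsto (fun u : (fderiv ℝ f x).ker => (f x, u)) (𝓝 0) (𝓝 (f x, 0)) :=
      (Continuous.prodMk_right (f x)).tendsto 0
    exact h2.eventually h1
  · filter_upwards [hst.eq_implicitFunctionOfComplemented hr hc] with y hy hfy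
    rw [hfy] at hy
    exact hy

/-- The chain rule puts velocities into the kernel. Conversely the chart of `exists_chart` maps the
line through a kernel vector to a curve in `M` with that velocity. -/
theorem tangentVectors_eq (h : IsLocalSubmersion M x f U) :
    tangentVectors M x = {v | fderiv ℝ f x v = 0} := by
  ext v
  constructor
  · rintro ⟨γ, h0, -, hγ, hM⟩
    have hd : HasFDerivAt f (fderiv ℝ f x) (γ 0) := by
      rw [h0]; exact (h.contDiffAt.differentiableAt (by simp)).hasFDerivAt
    have h1 := hd.comp_hasDerivAt 0 hγ
    have h2 : (f ∘ γ) =ᶠ[𝓝 0] fun _ => 0 := by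
      have := hγ.continuousAt.tendsto
      rw [h0] at this
      filter_upwards [hM, this.eventually h.eventually_iff] with t ht1 ht2
      exact ht2.1 ht1
    exact h1.unique ((hasDerivAt_const (0 : ℝ) (0 : F)).congr_of_eventuallyEq h2)
  · intro hv
    obtain ⟨g, π, g0, g1, g2, g3, -⟩ := exists_chart h.contDiffAt h.surjective
    let u : (fderiv ℝ f x).ker := ⟨v, hv⟩
    have hl : ContDiffAt ℝ ∞ (fun t : ℝ => t • u) 0 := by fun_prop
    have hl' : HasDerivAt (fun t : ℝ => t • u) u 0 := by
      simpa using (hasDerivAt_id (0 : ℝ)).smul_const u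
    have hg1 : ContDiffAt ℝ ∞ g ((fun t : ℝ => t • u) 0) := by simpa using g1
    have hg2 : HasFDerivAt g (fderiv ℝ f x).ker.subtypeL ((fun t : ℝ => t • u) 0) := by
      simpa using g2
    have ht : Filter.Tendsto (fun t : ℝ => t • u) (𝓝 0) (𝓝 0) := by
      simpa using hl'.continuousAt.tendsto
    have hg3 : HasDerivAt (g ∘ fun t : ℝ => t • u) ((fderiv ℝ f x).ker.subtypeL u) 0 :=
      hg2.comp_hasDerivAt (0 : ℝ) hl'
    refine ⟨fun t => g (t • u), by simp [g0], hg1.comp 0 hl, hg3, ?_⟩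
    have hgt : Filter.Tendsto (fun t : ℝ => g (t • u)) (𝓝 0) (𝓝 x) := by
      have := g1.continuousAt.tendsto.comp ht
      rwa [g0] at this
    filter_upwards [ht.eventually g3, hgt.eventually h.eventually_iff] with t h1 h2
    exact h2.2 (h1.trans h.zero)

end IsLocalSubmersion

/-- A set which is cut out of a linear subspace `V` by equations with values in a subspace `S`. -/
theorem exists_isLocalSubmersion {W : Type*} [NormedAddCommGroup W] [NormedSpace ℝ W]
    [FiniteDimensional ℝ W] {M : Set E} {x : E} (V : Submodule ℝ E) (S : Submodule ℝ W)
    {Φ : E → W} (hΦ : ContDiff ℝ ∞ Φ) (hx : x ∈ M)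
    (hM : ∀ᶠ y in 𝓝 x, y ∈ M ↔ y ∈ V ∧ Φ y = 0) (hS : ∀ y ∈ V, Φ y ∈ S)
    (hS' : ∀ v ∈ V, fderiv ℝ Φ x v ∈ S)
    (hsurj : ∀ s ∈ S, ∃ v ∈ V, fderiv ℝ Φ x v = s) :
    ∃ (V' : Submodule ℝ E) (f : E → V' × S), IsLocalSubmersion M x f Set.univ ∧
      Module.finrank ℝ V' + Module.finrank ℝ V = Module.finrank ℝ E ∧
      ∀ v, fderiv ℝ f x v = 0 ↔ v ∈ V ∧ fderiv ℝ Φ x v = 0 := by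
  obtain ⟨V', hV'⟩ := V.exists_isCompl
  obtain ⟨S', hSS'⟩ := S.exists_isCompl
  -- The defining map is the pair of the projection to a complement of `V`, which detects membership
  -- in `V`, and of `Φ` projected to `S`. On `V` the second projection loses nothing because `Φ`
  -- maps `V` into `S`.
  let q : E →L[ℝ] V' := (V'.projectionOnto V hV'.symm).toContinuousLinearMap
  let p : W →L[ℝ] S := (S.projectionOnto S' hSS').toContinuousLinearMap
  have hq : ∀ v, q v = 0 ↔ v ∈ V := fun v => by simp [q]
  have hp : ∀ s ∈ S, ((p s : S) : W) = s := fun s hs => by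
    simpa [p] using congrArg Subtype.val (Submodule.projectionOnto_apply_left hSS' ⟨s, hs⟩)
  have hp0 : ∀ s ∈ S, p s = 0 ↔ s = 0 := fun s hs => by
    constructor
    · intro h
      rw [← hp s hs, h]; rfl
    · rintro rfl; simp
  have hzero : ∀ y, (q y, p (Φ y)) = (0 : V' × S) ↔ y ∈ V ∧ Φ y = 0 := fun y => by
    rw [Prod.mk_eq_zero, hq]
    constructor
    · rintro ⟨h1, h2⟩; exact ⟨h1, (hp0 _ (hS y h1)).1 h2⟩
    · rintro ⟨h1, h2⟩; exact ⟨h1, (hp0 _ (hS y h1)).2 h2⟩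
  have hd : HasFDerivAt (fun y => (q y, p (Φ y))) (q.prod (p.comp (fderiv ℝ Φ x))) x :=
    q.hasFDerivAt.prodMk (p.hasFDerivAt.comp x (hΦ.differentiable (by simp) x).hasFDerivAt)
  refine ⟨V', fun y => (q y, p (Φ y)), ⟨isOpen_univ, Set.mem_univ _, ?_, ?_, ?_, ?_⟩, ?_, ?_⟩
  · exact (q.contDiff.prodMk (p.contDiff.comp hΦ)).contDiffOn
  · rw [hd.fderiv]
    rintro ⟨a, s⟩
    -- The vector `a` has the right first component; a vector of `V` corrects the second one without
    -- changing the first.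
    obtain ⟨v, hv, hvs⟩ := hsurj ((s - p (fderiv ℝ Φ x a) : S) : W) (Subtype.coe_prop _)
    refine ⟨a + v, ?_⟩
    have h1 : q (a : E) = a := by simp [q]
    have h2 : q v = 0 := (hq v).2 hv
    have h3 : p ((s - p (fderiv ℝ Φ x a) : S) : W) = s - p (fderiv ℝ Φ x a) :=
      Subtype.ext (hp _ (Subtype.coe_prop _))
    simp only [ContinuousLinearMap.prod_apply, ContinuousLinearMap.comp_apply, map_add, h1, h2, hvs,
      h3]
    simp
  · exact (hzero x).2 (hM.self_of_nhds.1 hx)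
  · filter_upwards [hM] with y hy
    rw [hy, hzero]
  · rw [add_comm]; exact Submodule.finrank_add_eq_of_isCompl hV'
  · intro v
    rw [hd.fderiv, ContinuousLinearMap.prod_apply, Prod.mk_eq_zero, hq]
    constructor
    · rintro ⟨h1, h2⟩; exact ⟨h1, (hp0 _ (hS' v h1)).1 h2⟩
    · rintro ⟨h1, h2⟩; exact ⟨h1, (hp0 _ (hS' v h1)).2 h2⟩

/-- From a family of linear functionals finitely many can be chosen which are independent and
have the same common kernel. -/
theorem exists_fin_surjective {ι W : Type*} [AddCommGroup W] [Module ℝ W] [FiniteDimensional ℝ W]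
    (l : ι → W →ₗ[ℝ] ℝ) :
    ∃ (m : ℕ) (s : Fin m → ι), Function.Surjective (LinearMap.pi fun j => l (s j)) ∧
      ∀ v, (∀ j, l (s j) v = 0) → ∀ i, l i v = 0 := by
  obtain ⟨f, hf, hspan, hli⟩ :=
    Submodule.exists_fun_fin_finrank_span_eq ℝ (Set.range l : Set (Module.Dual ℝ W))
  choose s hs using hf
  refine ⟨_, s, ?_, ?_⟩
  · have h : LinearIndependent ℝ (fun j => l (s j)) := by simpa only [hs] using hli
    rw [← LinearMap.range_eq_top]
    -- A nonzero functional which vanishes on the range would be a linear relation between the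
    -- chosen functionals, which are a basis of the span.
    by_contra hne
    obtain ⟨φ, hφ, hφr⟩ := Submodule.exists_le_ker_of_lt_top _ (lt_top_iff_ne_top.2 hne)
    have h1 : ∑ j, φ (Pi.single j 1) • l (s j) = 0 := by
      ext v
      have h2 : φ (LinearMap.pi (fun j => l (s j)) v) = 0 := hφr ⟨v, rfl⟩
      have h3 : ∀ i : Fin (Module.finrank ℝ (Submodule.span ℝ (Set.range l))),
          (fun j => if i = j then (1 : ℝ) else 0) = Pi.single i 1 := fun i => by
        ext j; simp [Pi.single_apply, eq_comm]
      rw [LinearMap.pi_apply_eq_sum_univ φ] at h2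
      simpa [h3, mul_comm] using h2
    have h3 := Fintype.linearIndependent_iff.1 h _ h1
    apply hφ
    ext j
    simpa using h3 j
  · intro v hv i
    have hi : l i ∈ Submodule.span ℝ (Set.range f) := by
      rw [hspan]; exact Submodule.subset_span ⟨i, rfl⟩
    have hle : Submodule.span ℝ (Set.range f) ≤
        (LinearMap.applyₗ v : (W →ₗ[ℝ] ℝ) →ₗ[ℝ] ℝ).ker := by
      rw [Submodule.span_le]
      rintro _ ⟨j, rfl⟩
      simpa [← hs] using hv j
    exact hle hi

/-- A common level set of a family of smooth functions on a manifold is a manifold if the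
derivatives of these functions vanish on a distribution of dimension `d`, which is at the given
point their common kernel. -/
theorem exists_isLocalSubmersion_levelSet {ι : Type*} {M : Set E} {x : E} {f : E → F} {U : Set E}
    (h : IsLocalSubmersion M x f U) {O : Set E} (hO : IsOpen O) (hx : x ∈ O) {P : ι → E → ℝ}
    (hP : ∀ i, ContDiffOn ℝ ∞ (P i) O) {d : ℕ} {N : Set E}
    (hN : ∀ᶠ y in 𝓝 x, y ∈ N ↔ y ∈ M ∧ ∀ i, P i y = P i x)
    (hK : ∀ᶠ y in 𝓝 x, y ∈ M → ∃ K : Submodule ℝ E, Module.finrank ℝ K = d ∧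
      ∀ v ∈ K, fderiv ℝ f y v = 0 ∧ ∀ i, fderiv ℝ (P i) y v = 0)
    (hKx : ∃ K : Submodule ℝ E, Module.finrank ℝ K = d ∧
      ∀ v, v ∈ K ↔ fderiv ℝ f x v = 0 ∧ ∀ i, fderiv ℝ (P i) x v = 0) :
    ∃ (m : ℕ) (f' : E → F × (Fin m → ℝ)), IsLocalSubmersion N x f' (U ∩ O) ∧
      d + Module.finrank ℝ (F × (Fin m → ℝ)) = Module.finrank ℝ E := by
  -- Finitely many of the `P i` are independent on the kernel of `fderiv ℝ f x`; added to `f` they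
  -- form the submersion `f'`. What remains is that the other `P i` are constant on its level set.
  obtain ⟨m, s, hs, hs'⟩ := exists_fin_surjective
    (fun i => (fderiv ℝ (P i) x : E →ₗ[ℝ] ℝ).domRestrict (fderiv ℝ f x : E →ₗ[ℝ] F).ker)
  have hPd : ∀ y ∈ O, ∀ i, HasFDerivAt (P i) (fderiv ℝ (P i) y) y := fun y hy i =>
    (((hP i).contDiffAt (hO.mem_nhds hy)).differentiableAt (by simp)).hasFDerivAt
  have hfd : ∀ y ∈ U, HasFDerivAt f (fderiv ℝ f y) y := fun y hy =>
    ((h.contDiffOn.contDiffAt (h.isOpen.mem_nhds hy)).differentiableAt (by simp)).hasFDerivAt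
  let f' : E → F × (Fin m → ℝ) := fun y => (f y, fun j => P (s j) y - P (s j) x)
  have hf'd : ∀ y ∈ U ∩ O, fderiv ℝ f' y =
      (fderiv ℝ f y).prod (ContinuousLinearMap.pi fun j => fderiv ℝ (P (s j)) y) := fun y hy =>
    ((hfd y hy.1).prodMk
      (hasFDerivAt_pi.2 fun j => ((hPd y hy.2 (s j)).sub_const (P (s j) x)))).fderiv
  have hxUO : x ∈ U ∩ O := ⟨h.mem, hx⟩
  have hUO : IsOpen (U ∩ O) := h.isOpen.inter hO
  have hf's : ContDiffOn ℝ ∞ f' (U ∩ O) :=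
    (h.contDiffOn.mono Set.inter_subset_left).prodMk
      (contDiffOn_pi.2 fun j => ((hP (s j)).mono Set.inter_subset_right).sub contDiffOn_const)
  have hsurj : Function.Surjective (fderiv ℝ f' x) := by
    rw [hf'd x hxUO]
    rintro ⟨a, b⟩
    obtain ⟨v, hv⟩ := h.surjective a
    obtain ⟨w, hw⟩ := hs (b - fun j => fderiv ℝ (P (s j)) x v)
    refine ⟨v + w, ?_⟩
    have hw0 : fderiv ℝ f x (w : E) = 0 := w.2
    have hwj : ∀ j, fderiv ℝ (P (s j)) x (w : E) = b j - fderiv ℝ (P (s j)) x v := fun j =>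
      congrFun hw j
    refine Prod.ext (by simp [hv, hw0]) ?_
    ext j
    simp [hwj]
  have hker : ∀ y ∈ U ∩ O, ∀ v, fderiv ℝ f' y v = 0 ↔
      fderiv ℝ f y v = 0 ∧ ∀ j, fderiv ℝ (P (s j)) y v = 0 := fun y hy v => by
    rw [hf'd y hy, ContinuousLinearMap.prod_apply, Prod.mk_eq_zero]
    refine and_congr Iff.rfl ?_
    rw [funext_iff]; rfl
  have hdim : d + Module.finrank ℝ (F × (Fin m → ℝ)) = Module.finrank ℝ E := by
    obtain ⟨K, hKd, hK'⟩ := hKx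
    have h1 := LinearMap.finrank_range_add_finrank_ker (fderiv ℝ f' x : E →ₗ[ℝ] F × (Fin m → ℝ))
    rw [LinearMap.range_eq_top.2 hsurj, finrank_top] at h1
    have h2 : (fderiv ℝ f' x : E →ₗ[ℝ] F × (Fin m → ℝ)).ker = K := by
      ext v
      rw [hK' v, LinearMap.mem_ker]
      refine (hker x hxUO v).trans (and_congr_right fun hv => ⟨fun hj i => ?_, fun hi j => hi _⟩)
      exact hs' ⟨v, hv⟩ (fun j => hj j) i
    rw [h2, hKd] at h1
    omega
  refine ⟨m, f', ⟨hUO, hxUO, hf's, hsurj, by simp [f', h.zero]; rfl, ?_⟩, hdim⟩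
  have hcd : ContDiffAt ℝ ∞ f' x := hf's.contDiffAt (hUO.mem_nhds hxUO)
  have hsurj' : ∀ᶠ y in 𝓝 x, Function.Surjective (fderiv ℝ f' y) :=
    (hcd.continuousAt_fderiv (by simp)).eventually (isOpen_setOf_surjective.mem_nhds hsurj)
  obtain ⟨g, π, g0, g1, g2, g3, g4⟩ := exists_chart hcd hsurj
  have hgt : Filter.Tendsto g (𝓝 0) (𝓝 x) := by
    have := g1.continuousAt.tendsto
    rwa [g0] at this
  have hgd : ∀ᶠ u in 𝓝 0, DifferentiableAt ℝ g u :=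
    ((g1.of_le (m := 1) (by simp)).eventually (by simp)).mono
      fun u hu => hu.differentiableAt (by simp)
  have hgood := hgd.and <| g3.and <| hgt.eventually <|
    (hUO.eventually_mem hxUO).and <| hsurj'.and <| hK.and h.eventually_iff
  -- A ball in the chart is star-shaped about `0`, so each nearby point of the level set is joined
  -- to `x` by the image of a radial segment.
  obtain ⟨ε, hε, hball⟩ := Metric.eventually_nhds_iff_ball.1 hgood
  have hπ : Filter.Tendsto (fun y => π (y - x)) (𝓝 x) (𝓝 0) := by
    have : ContinuousAt (fun y => π (y - x)) x := by fun_prop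
    simpa [ContinuousAt] using this
  filter_upwards [hN, g4, hπ.eventually (Metric.ball_mem_nhds 0 hε), h.eventually_iff]
    with y hyN hg4 hyε hyM
  rw [hyN]
  constructor
  · rintro ⟨h1, h2⟩
    simp only [f', Prod.mk_eq_zero]
    exact ⟨hyM.1 h1, by ext j; simp [h2]⟩
  · intro hy0
    have hx0 : f' x = 0 := by simp [f', h.zero]; rfl
    have hfy : f y = 0 := congrArg Prod.fst hy0
    refine ⟨hyM.2 hfy, fun i => ?_⟩
    set u := π (y - x) with hu
    have hgu : g u = y := hg4 (hy0.trans hx0.symm)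
    have hmem : ∀ t ∈ Set.Icc (0 : ℝ) 1, t • u ∈ Metric.ball (0 : (fderiv ℝ f' x).ker) ε := by
      intro t ht
      rw [dist_zero_right] at hyε
      rw [mem_ball_zero_iff]
      rw [norm_smul, Real.norm_of_nonneg ht.1]
      exact (mul_le_of_le_one_left (norm_nonneg _) ht.2).trans_lt hyε
    have hder : ∀ t ∈ Set.Icc (0 : ℝ) 1, HasDerivAt (fun t : ℝ => P i (g (t • u))) 0 t := by
      intro t ht
      obtain ⟨q1, -, q3, q4, q5, q6⟩ := hball _ (hmem t ht)
      have hl' : HasDerivAt (fun t : ℝ => t • u) u t := by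
        simpa using (hasDerivAt_id t).smul_const u
      have e1 := q1.hasFDerivAt.comp_hasDerivAt t hl'
      have e2 := (hPd _ q3.2 i).comp_hasDerivAt t e1
      set v := fderiv ℝ g (t • u) u with hv
      suffices fderiv ℝ (P i) (g (t • u)) v = 0 by rw [← this]; exact e2
      have e3 : HasFDerivAt f' (fderiv ℝ f' (g (t • u))) (g (t • u)) :=
        ((hf's.contDiffAt (hUO.mem_nhds q3)).differentiableAt (by simp)).hasFDerivAt
      have hball' : ∀ᶠ u' in 𝓝 (t • u), f' (g u') = f' x := by
        filter_upwards [Metric.isOpen_ball.mem_nhds (hmem t ht)] with u' hu'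
        exact (hball u' hu').2.1
      have e4 : fderiv ℝ f' (g (t • u)) v = 0 := by
        have e5 := e3.comp (t • u) q1.hasFDerivAt
        have e6 := e5.unique ((hasFDerivAt_const (f' x) (t • u)).congr_of_eventuallyEq hball')
        exact congrArg (fun L => L u) e6
      have hfz : f (g (t • u)) = 0 := by
        have := (hball _ (hmem t ht)).2.1
        rw [hx0] at this
        exact congrArg Prod.fst this
      obtain ⟨K, hKd, hKv⟩ := q5 (q6.2 hfz)
      -- The kernel of `f'` has dimension `d` at each point of the segment, as has `K`, so the
      -- inclusion is an equality. The velocity of the segment therefore lies in `K`, where all `P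
      -- i` have derivative zero.
      have hle : K ≤ (fderiv ℝ f' (g (t • u)) : E →ₗ[ℝ] F × (Fin m → ℝ)).ker := fun w hw =>
        (hker _ q3 w).2 ⟨(hKv w hw).1, fun j => (hKv w hw).2 _⟩
      have hrank := LinearMap.finrank_range_add_finrank_ker
        (fderiv ℝ f' (g (t • u)) : E →ₗ[ℝ] F × (Fin m → ℝ))
      rw [LinearMap.range_eq_top.2 q4, finrank_top] at hrank
      have hKe := Submodule.eq_of_le_of_finrank_eq hle (by omega)
      have hvK : v ∈ K := by rw [hKe]; exact e4
      exact (hKv v hvK).2 i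
    have hconst : (fun t : ℝ => P i (g (t • u))) 1 = (fun t : ℝ => P i (g (t • u))) 0 := by
      refine constant_of_has_deriv_right_zero
        (fun t ht => (hder t ht).continuousAt.continuousWithinAt)
        (fun t ht => (hder t ⟨ht.1, ht.2.le⟩).hasDerivWithinAt) 1 (by simp)
    simpa [hgu, g0] using hconst

end Manifold

end Whitham

namespace Whitham

/-! ### Polynomial growth at regular singular points, and square roots of holomorphic functions. -/

section Analysis

/-- An entire function of polynomial growth is a polynomial. -/
theorem exists_polynomial_of_growth (N : ℕ) {f : ℂ → ℂ} (hf : Differentiable ℂ f) {B R : ℝ}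
    (h : ∀ z, R ≤ ‖z‖ → ‖f z‖ ≤ B * ‖z‖ ^ N) : ∃ p : ℂ[X], ∀ z, f z = p.eval z := by
  induction N generalizing f B R with
  | zero =>
    obtain ⟨B', hB'⟩ := (isCompact_closedBall (0 : ℂ) R).exists_bound_of_continuousOn
      hf.continuous.continuousOn
    have hb : Bornology.IsBounded (Set.range f) := by
      refine isBounded_iff_forall_norm_le.2 ⟨max B B', ?_⟩
      rintro _ ⟨z, rfl⟩
      rcases le_total R ‖z‖ with hz | hz
      · exact le_max_of_le_left (by simpa using h z hz)
      · exact le_max_of_le_right (hB' z (by simpa using hz))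
    obtain ⟨c, hc⟩ := hf.exists_const_forall_eq_of_bounded hb
    exact ⟨C c, fun z => by simp [hc]⟩
  | succ N ih =>
    -- The entire function `(f - f 0) / z` has growth exponent smaller by one; this drives the
    -- induction, which starts with Liouville's theorem.
    have hd : Differentiable ℂ (dslope f 0) := by
      rw [← differentiableOn_univ] at hf ⊢
      exact (Complex.differentiableOn_dslope Filter.univ_mem).2 hf
    have hz : ∀ z, f z = f 0 + z * dslope f 0 z := fun z => by
      have := sub_smul_dslope f 0 z
      simp only [sub_zero, smul_eq_mul] at this
      rw [this]; ring
    obtain ⟨p, hp⟩ := ih hd (B := |B| + ‖f 0‖) (R := max R 1) (fun z hzR => by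
      have h1 : 1 ≤ ‖z‖ := (le_max_right _ _).trans hzR
      have h0 : 0 < ‖z‖ := by linarith
      have h2 : ‖z * dslope f 0 z‖ ≤ |B| * ‖z‖ ^ (N + 1) + ‖f 0‖ := by
        rw [show z * dslope f 0 z = f z - f 0 by rw [hz z]; ring]
        refine (norm_sub_le _ _).trans (add_le_add ?_ le_rfl)
        refine (h z ((le_max_left _ _).trans hzR)).trans ?_
        gcongr; exact le_abs_self B
      rw [norm_mul] at h2
      have h3 : 1 ≤ ‖z‖ ^ (N + 1) := one_le_pow₀ h1
      have h4 : ‖z‖ * ‖dslope f 0 z‖ ≤ ‖z‖ * ((|B| + ‖f 0‖) * ‖z‖ ^ N) := by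
        calc _ ≤ |B| * ‖z‖ ^ (N + 1) + ‖f 0‖ := h2
          _ ≤ |B| * ‖z‖ ^ (N + 1) + ‖f 0‖ * ‖z‖ ^ (N + 1) := by
            gcongr; exact le_mul_of_one_le_right (norm_nonneg _) h3
          _ = _ := by ring
      exact le_of_mul_le_mul_left h4 h0)
    exact ⟨C (f 0) + X * p, fun z => by rw [hz z, hp z]; simp⟩

/-- The solutions of a linear differential equation with a regular singular point at `∞` have
polynomial growth. -/
theorem exists_growth_infty {f f' : ℂ → ℂ} {R M : ℝ} {K n : ℕ} (hR : 1 ≤ R)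
    (hf : ∀ z, R ≤ ‖z‖ → HasDerivAt f (f' z) z)
    (h : ∀ z, R ≤ ‖z‖ → ‖z * f' z‖ ≤ K * ‖f z‖ + M * ‖z‖ ^ n) :
    ∃ (B : ℝ) (N : ℕ), ∀ z, R ≤ ‖z‖ → ‖f z‖ ≤ B * ‖z‖ ^ N := by
  have hc : ContinuousOn f (Metric.sphere 0 R) := fun z hz =>
    (hf z (by simp at hz; rw [hz])).continuousAt.continuousWithinAt
  obtain ⟨δ, hδ⟩ := (isCompact_sphere (0 : ℂ) R).exists_bound_of_continuousOn hc
  have hM : ∀ z : ℂ, M * ‖z‖ ^ n ≤ |M| * ‖z‖ ^ n := fun z => by gcongr; exact le_abs_self M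
  refine ⟨|δ| + |M|, n + (K + 1), fun z hz => ?_⟩
  have hz0 : 0 < ‖z‖ := by linarith
  have hR0 : 0 < R := by linarith
  -- Gronwall's inequality is applied along the ray through `z`, parametrised as `exp s * u` with
  -- `u` on the circle of radius `R`; the derivative in `s` is then `z * f' z`.
  set u : ℂ := z / ‖z‖ * R with hu
  have hzn : (‖z‖ : ℂ) ≠ 0 := by exact_mod_cast hz0.ne'
  have hun : ‖u‖ = R := by
    rw [hu, norm_mul, norm_div]; simp [hz0.ne', abs_of_pos hR0]
  set L := Real.log (‖z‖ / R) with hL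
  have hL0 : 0 ≤ L := Real.log_nonneg (by rw [le_div_iff₀ hR0]; simpa using hz)
  have heL : Real.exp L = ‖z‖ / R := Real.exp_log (by positivity)
  have hns : ∀ s : ℝ, ‖Complex.exp s * u‖ = Real.exp s * R := fun s => by
    rw [norm_mul, hun, Complex.norm_exp]; simp
  have hge : ∀ s : ℝ, 0 ≤ s → R ≤ ‖Complex.exp s * u‖ := fun s hs => by
    rw [hns]
    have := Real.one_le_exp hs
    nlinarith
  have hder : ∀ s : ℝ, 0 ≤ s → HasDerivAt (fun s : ℝ => f (Complex.exp s * u))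
      (Complex.exp s * u * f' (Complex.exp s * u)) s := fun s hs => by
    have h1 : HasDerivAt (fun s : ℝ => Complex.exp s * u) (Complex.exp s * u) s :=
      ((Complex.hasDerivAt_exp s).comp_ofReal).mul_const u
    have h2 := (hf _ (hge s hs)).comp s h1
    rw [mul_comm] at h2
    exact h2
  -- The constant is `K + 1` to avoid the separate Gronwall bound for a vanishing constant. The
  -- inhomogeneity is bounded by its value at the endpoint `z`.
  have hgr := norm_le_gronwallBound_of_norm_deriv_right_le (a := 0) (b := L) (δ := |δ|)
    (K := (K + 1 : ℝ)) (ε := |M| * ‖z‖ ^ n) (f := fun s : ℝ => f (Complex.exp s * u))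
    (f' := fun s : ℝ => Complex.exp s * u * f' (Complex.exp s * u))
    (fun s hs => (hder s hs.1).continuousAt.continuousWithinAt)
    (fun s hs => (hder s hs.1).hasDerivWithinAt)
    (by
      simp only [Complex.ofReal_zero, Complex.exp_zero, one_mul]
      exact (hδ u (by simp [hun])).trans (le_abs_self δ))
    (fun s hs => by
      refine (h _ (hge s hs.1)).trans ?_
      refine add_le_add ?_ ((hM _).trans ?_)
      · gcongr; linarith
      · gcongr
        rw [hns]
        calc Real.exp s * R ≤ Real.exp L * R := by gcongr; exact hs.2.le
          _ = ‖z‖ := by rw [heL]; field_simp)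
    L ⟨hL0, le_rfl⟩
  have hzL : Complex.exp L * u = z := by
    rw [← Complex.ofReal_exp, heL, hu]
    have : (R : ℂ) ≠ 0 := by exact_mod_cast hR0.ne'
    push_cast
    field_simp
  have hK : ((K : ℝ) + 1) ≠ 0 := by positivity
  simp only [hzL, sub_zero, gronwallBound_of_K_ne_0 hK] at hgr
  have hexp : Real.exp (((K : ℝ) + 1) * L) = (‖z‖ / R) ^ (K + 1) := by
    rw [show ((K : ℝ) + 1) * L = ((K + 1 : ℕ) : ℝ) * L by push_cast; ring, Real.exp_nat_mul, heL]
  have hle : (‖z‖ / R) ^ (K + 1) ≤ ‖z‖ ^ (K + 1) := by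
    gcongr; exact div_le_self hz0.le hR
  have hz1 : 1 ≤ ‖z‖ ^ n := one_le_pow₀ (hR.trans hz)
  rw [hexp] at hgr
  refine hgr.trans ?_
  have h5 : |M| * ‖z‖ ^ n / (K + 1) ≤ |M| * ‖z‖ ^ n :=
    div_le_self (by positivity) (by linarith [(Nat.cast_nonneg K : (0 : ℝ) ≤ K)])
  calc |δ| * (‖z‖ / R) ^ (K + 1) + |M| * ‖z‖ ^ n / (K + 1) * ((‖z‖ / R) ^ (K + 1) - 1)
      ≤ |δ| * ‖z‖ ^ (K + 1) + |M| * ‖z‖ ^ n * ‖z‖ ^ (K + 1) := by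
        refine add_le_add (by gcongr) ?_
        refine (mul_le_mul_of_nonneg_left (a := |M| * ‖z‖ ^ n / (K + 1))
          (by linarith : (‖z‖ / R) ^ (K + 1) - 1 ≤ ‖z‖ ^ (K + 1)) (by positivity)).trans ?_
        gcongr
    _ ≤ |δ| * (‖z‖ ^ n * ‖z‖ ^ (K + 1)) + |M| * ‖z‖ ^ n * ‖z‖ ^ (K + 1) := by
        gcongr
        exact le_mul_of_one_le_left (by positivity) hz1
    _ = (|δ| + |M|) * ‖z‖ ^ (n + (K + 1)) := by rw [pow_add]; ring

/-- The solutions of a linear differential equation with a regular singular point at `0` have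
polynomial growth. -/
theorem exists_growth_zero {f f' : ℂ → ℂ} {r M : ℝ} {K n : ℕ} (hr0 : 0 < r) (hr : r ≤ 1)
    (hf : ∀ z, z ≠ 0 → ‖z‖ ≤ r → HasDerivAt f (f' z) z)
    (h : ∀ z, z ≠ 0 → ‖z‖ ≤ r → ‖z * f' z‖ * ‖z‖ ^ n ≤ K * ‖f z‖ * ‖z‖ ^ n + M) :
    ∃ (B : ℝ) (N : ℕ), ∀ z, z ≠ 0 → ‖z‖ ≤ r → ‖f z‖ * ‖z‖ ^ N ≤ B := by
  have hinv : ∀ z : ℂ, r⁻¹ ≤ ‖z‖ → z ≠ 0 ∧ ‖z⁻¹‖ ≤ r := fun z hz => by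
    have : 0 < ‖z‖ := lt_of_lt_of_le (by positivity) hz
    refine ⟨norm_pos_iff.1 this, ?_⟩
    rw [norm_inv]
    exact inv_le_of_inv_le₀ hr0 hz
  -- The inversion `z ↦ z⁻¹` preserves `z * f'` up to sign and moves the singular point to infinity.
  obtain ⟨B, N, hB⟩ := exists_growth_infty (f := fun z => f z⁻¹)
    (f' := fun z => f' z⁻¹ * (-(z ^ 2)⁻¹)) (R := r⁻¹) (M := M) (K := K) (n := n)
    ((one_le_inv₀ hr0).2 hr)
    (fun z hz => by
      obtain ⟨h1, h2⟩ := hinv z hz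
      exact (hf _ (inv_ne_zero h1) h2).comp z (hasDerivAt_inv h1))
    (fun z hz => by
      obtain ⟨h1, h2⟩ := hinv z hz
      have h3 := h _ (inv_ne_zero h1) h2
      have h4 : ‖z * (f' z⁻¹ * -(z ^ 2)⁻¹)‖ = ‖z⁻¹ * f' z⁻¹‖ := by
        rw [show z * (f' z⁻¹ * -(z ^ 2)⁻¹) = -(z⁻¹ * f' z⁻¹) by field_simp, norm_neg]
      rw [h4]
      rw [norm_inv, inv_pow, ← div_eq_mul_inv, ← div_eq_mul_inv] at h3
      have h5 : 0 < ‖z‖ ^ n := pow_pos (norm_pos_iff.2 h1) n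
      have h6 := mul_le_mul_of_nonneg_right h3 h5.le
      rw [add_mul, div_mul_cancel₀ _ h5.ne', div_mul_cancel₀ _ h5.ne'] at h6
      exact h6)
  refine ⟨B, N, fun z hz hzr => ?_⟩
  have hz0 : 0 < ‖z‖ := norm_pos_iff.2 hz
  have := hB z⁻¹ (by rw [norm_inv]; exact (inv_le_inv₀ hr0 hz0).2 hzr)
  rw [inv_inv, norm_inv, inv_pow] at this
  have h5 : 0 < ‖z‖ ^ N := pow_pos hz0 N
  calc ‖f z‖ * ‖z‖ ^ N ≤ B * (‖z‖ ^ N)⁻¹ * ‖z‖ ^ N := by gcongr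
    _ = B := by field_simp

theorem hasDerivAt_of_sq {U u : ℂ → ℂ} {u' z : ℂ} (hu : HasDerivAt u u' z)
    (hU : DifferentiableAt ℂ U z) (h : ∀ᶠ y in 𝓝 z, U y ^ 2 = u y) (h0 : U z ≠ 0) :
    HasDerivAt U (u' / (2 * U z)) z := by
  have h1 := (hU.hasDerivAt.pow 2).congr_of_eventuallyEq (h.mono fun y hy => hy.symm)
  have h2 := h1.unique hu
  have h3 : u' / (2 * U z) = deriv U z := by
    rw [← h2]
    field_simp
    norm_num
    ring
  rw [h3]
  exact hU.hasDerivAt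

/-- A nowhere vanishing holomorphic function on a disc has a holomorphic square root. -/
theorem exists_sqrt_on_ball {c : ℂ} {r : ℝ} {u : ℂ → ℂ}
    (hu : DifferentiableOn ℂ u (Metric.ball c r)) (h0 : ∀ z ∈ Metric.ball c r, u z ≠ 0) :
    ∃ U : ℂ → ℂ, DifferentiableOn ℂ U (Metric.ball c r) ∧ ∀ z ∈ Metric.ball c r, U z ^ 2 = u z := by
  by_cases hr : 0 < r
  swap
  · exact ⟨0, differentiableOn_const 0, fun z hz => by
      rw [Metric.ball_eq_empty.2 (not_lt.1 hr)] at hz; exact hz.elim⟩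
  have hc : c ∈ Metric.ball c r := Metric.mem_ball_self hr
  -- With a primitive `g` of `u' / u` the function `u * exp (-g)` is constant, hence a square `k ^
  -- 2`, and `k * exp (g / 2)` is the root.
  obtain ⟨g, hg⟩ := ((hu.deriv Metric.isOpen_ball).div hu h0).isExactOn_ball
  obtain ⟨k, hk⟩ : ∃ k : ℂ, k ^ 2 = u c * Complex.exp (-g c) :=
    ⟨(u c * Complex.exp (-g c)) ^ (1 / 2 : ℂ), by simp⟩
  have hd : ∀ z ∈ Metric.ball c r,
      HasDerivAt (fun z => u z * Complex.exp (-g z)) 0 z := fun z hz => by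
    have h1 := (hu.differentiableAt (Metric.isOpen_ball.mem_nhds hz)).hasDerivAt
    have h2 := h1.mul ((hg z hz).neg.cexp)
    have h3 : deriv u z * Complex.exp (-g z) + u z * (Complex.exp (-g z) * -(deriv u z / u z)) = 0 := by
      have := h0 z hz
      field_simp
      simp
    rw [← h3]
    exact h2
  have hconst : ∀ z ∈ Metric.ball c r, u z * Complex.exp (-g z) = u c * Complex.exp (-g c) :=
    fun z hz => by
      refine (convex_ball c r).is_const_of_fderivWithin_eq_zero (𝕜 := ℂ)
        (f := fun z => u z * Complex.exp (-g z))
        (fun y hy => (hd y hy).differentiableAt.differentiableWithinAt) (fun y hy => ?_) hz hc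
      rw [fderivWithin_of_isOpen Metric.isOpen_ball hy]
      have := (hd y hy).hasFDerivAt.fderiv
      rw [this]; ext; simp
  refine ⟨fun z => k * Complex.exp (g z / 2), ?_, fun z hz => ?_⟩
  · intro z hz
    exact (((hg z hz).differentiableAt.div_const 2).cexp.const_mul k).differentiableWithinAt
  · simp only
    rw [mul_pow, hk, ← hconst z hz, ← Complex.exp_nat_mul, mul_assoc, ← Complex.exp_add]
    have : -g z + ((2 : ℕ) : ℂ) * (g z / 2) = 0 := by push_cast; ring
    rw [this, Complex.exp_zero, mul_one]

/-- On a circle around `w` the function `z - w` has no continuous square root. -/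
theorem not_exists_sqrt_on_sphere {w : ℂ} {ρ : ℝ} (hρ : 0 < ρ) {s F : ℂ → ℂ}
    (hs : ContinuousOn s (Metric.sphere w ρ)) (hF : ContinuousOn F (Metric.sphere w ρ))
    (hF0 : ∀ z ∈ Metric.sphere w ρ, F z ≠ 0)
    (h : ∀ z ∈ Metric.sphere w ρ, s z ^ 2 = (z - w) * F z ^ 2) : False := by
  let γ : ℝ → ℂ := circleMap w ρ
  have hγ : ∀ t, γ t ∈ Metric.sphere w ρ := circleMap_mem_sphere w hρ.le
  have hγc : Continuous γ := continuous_circleMap w ρ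
  have hρ' : ((√ρ : ℝ) : ℂ) ≠ 0 := by
    exact_mod_cast (Real.sqrt_pos.2 hρ).ne'
  have hρ2 : ((√ρ : ℝ) : ℂ) ^ 2 = ρ := by exact_mod_cast Real.sq_sqrt hρ.le
  -- On the real line there is the explicit root `G`, which changes sign after a full turn. A root
  -- on the circle would pull back to a periodic function, yet agree with `G` up to one global sign.
  let G : ℝ → ℂ := fun t => √ρ * Complex.exp (t / 2 * Complex.I) * F (γ t)
  have hsc : Continuous fun t => s (γ t) := hs.comp_continuous hγc hγ
  have hGc : Continuous G := by
    have hFc : Continuous fun t => F (γ t) := hF.comp_continuous hγc hγ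
    exact (Continuous.mul (by fun_prop) (by fun_prop)).mul hFc
  have hG0 : ∀ t, G t ≠ 0 := fun t =>
    mul_ne_zero (mul_ne_zero hρ' (Complex.exp_ne_zero _)) (hF0 _ (hγ t))
  have hsq : ∀ t, s (γ t) ^ 2 = G t ^ 2 := fun t => by
    rw [h _ (hγ t)]
    simp only [G, γ, mul_pow, hρ2, circleMap, ← Complex.exp_nat_mul, add_sub_cancel_left]
    push_cast
    rw [show (2 : ℂ) * (t / 2 * Complex.I) = t * Complex.I by ring]
  have hp : γ (2 * Real.pi) = γ 0 := by
    simp [γ, circleMap, Complex.exp_two_pi_mul_I]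
  have hGp : G (2 * Real.pi) = -G 0 := by
    simp only [G, hp]
    push_cast
    rw [show (2 * Real.pi / 2 * Complex.I : ℂ) = Real.pi * Complex.I by ring, Complex.exp_pi_mul_I]
    simp
  rcases isPreconnected_univ.eq_or_eq_neg_of_sq_eq hsc.continuousOn hGc.continuousOn
    (fun t _ => hsq t) (fun {t} _ => hG0 t) with h1 | h1
  · have a := h1 (Set.mem_univ (2 * Real.pi))
    have b := h1 (Set.mem_univ 0)
    simp only [hp] at a b
    rw [hGp, b] at a
    exact hG0 0 (self_eq_neg.1 a)
  · have a := h1 (Set.mem_univ (2 * Real.pi))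
    have b := h1 (Set.mem_univ 0)
    simp only [hp, Pi.neg_apply] at a b
    rw [hGp, b] at a
    exact hG0 0 (self_eq_neg.1 (by simpa using a.symm))

end Analysis

end Whitham

namespace Whitham

/-! ### Holomorphic solutions at a simple zero. -/

section LocalSolution

/-- The equation `2 (z - ε) E' + E = m` has a holomorphic solution on a disc. -/
theorem exists_solution_half {c ε : ℂ} {r : ℝ} {m : ℂ → ℂ}
    (hm : DifferentiableOn ℂ m (Metric.ball c r)) (hε : ε ∈ Metric.ball c r) :
    ∃ E E' : ℂ → ℂ, ∀ z ∈ Metric.ball c r, HasDerivAt E (E' z) z ∧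
      2 * (z - ε) * E' z + E z = m z := by
  have hmem : ∀ z ∈ Metric.ball c r, ∀ s ∈ Set.Icc (0 : ℝ) 1,
      ε + ((s : ℂ) ^ 2) * (z - ε) ∈ Metric.ball c r := fun z hz s hs => by
    have h1 : s ^ 2 ∈ Set.Icc (0 : ℝ) 1 := ⟨by positivity, pow_le_one₀ hs.1 hs.2⟩
    have := (convex_ball c r).add_smul_sub_mem hε hz h1
    simpa using this
  have hd : ∀ z ∈ Metric.ball c r, HasDerivAt m (deriv m z) z := fun z hz =>
    (hm.differentiableAt (Metric.isOpen_ball.mem_nhds hz)).hasDerivAt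
  have hdc : ContinuousOn (deriv m) (Metric.ball c r) :=
    (hm.deriv Metric.isOpen_ball).continuousOn
  have hu : Set.uIcc (0 : ℝ) 1 = Set.Icc 0 1 := Set.uIcc_of_le zero_le_one
  have hF : ∀ z ∈ Metric.ball c r,
      ContinuousOn (fun s : ℝ => m (ε + ((s : ℂ) ^ 2) * (z - ε))) (Set.Icc 0 1) := fun z hz =>
    hm.continuousOn.comp (by fun_prop) (fun s hs => hmem z hz s hs)
  have hF' : ∀ z ∈ Metric.ball c r,
      ContinuousOn (fun s : ℝ => deriv m (ε + ((s : ℂ) ^ 2) * (z - ε))) (Set.Icc 0 1) :=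
    fun z hz => hdc.comp (by fun_prop) (fun s hs => hmem z hz s hs)
  -- The homogeneous solutions behave like `(z - ε) ^ (-1 / 2)`; averaging `m` with the parameter `s
  -- ^ 2` gives the holomorphic solution. Indeed `2 (z - ε) E' + E` integrates the `s`-derivative of
  -- `s * m (ε + s ^ 2 (z - ε))`.
  refine ⟨fun z => ∫ s in (0 : ℝ)..1, m (ε + ((s : ℂ) ^ 2) * (z - ε)),
    fun z => ∫ s in (0 : ℝ)..1, (s : ℂ) ^ 2 * deriv m (ε + ((s : ℂ) ^ 2) * (z - ε)),
    fun z hz => ⟨?_, ?_⟩⟩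
  · obtain ⟨δ, hδ, hball⟩ := Metric.isOpen_iff.1 Metric.isOpen_ball z hz
    have hsub : Metric.closedBall z (δ / 2) ⊆ Metric.ball c r :=
      (Metric.closedBall_subset_ball (by linarith)).trans hball
    have hcomp : IsCompact (Set.Icc (0 : ℝ) 1 ×ˢ Metric.closedBall z (δ / 2)) :=
      isCompact_Icc.prod (isCompact_closedBall _ _)
    obtain ⟨B, hB⟩ := hcomp.exists_bound_of_continuousOn
      (f := fun p : ℝ × ℂ => (p.1 : ℂ) ^ 2 * deriv m (ε + ((p.1 : ℂ) ^ 2) * (p.2 - ε)))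
      (ContinuousOn.mul (by fun_prop) (hdc.comp (by fun_prop)
        (fun p hp => hmem _ (hsub hp.2) _ hp.1)))
    refine (intervalIntegral.hasDerivAt_integral_of_dominated_loc_of_deriv_le
      (F := fun z (s : ℝ) => m (ε + ((s : ℂ) ^ 2) * (z - ε)))
      (F' := fun z (s : ℝ) => (s : ℂ) ^ 2 * deriv m (ε + ((s : ℂ) ^ 2) * (z - ε)))
      (bound := fun _ => B)
      (Metric.ball_mem_nhds z (half_pos hδ)) ?_ ?_ ?_ ?_ ?_ ?_).2
    · filter_upwards [Metric.ball_mem_nhds z hδ] with y hy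
      have := (hF y (hball hy)).intervalIntegrable_of_Icc (μ := MeasureTheory.volume) zero_le_one
      exact this.aestronglyMeasurable_restrict_uIoc
    · exact (hF z hz).intervalIntegrable_of_Icc zero_le_one
    · have : ContinuousOn (fun s : ℝ => (s : ℂ) ^ 2 * deriv m (ε + ((s : ℂ) ^ 2) * (z - ε)))
        (Set.Icc 0 1) := ContinuousOn.mul (by fun_prop) (hF' z hz)
      exact (this.intervalIntegrable_of_Icc
        (μ := MeasureTheory.volume) zero_le_one).aestronglyMeasurable_restrict_uIoc
    · refine Filter.Eventually.of_forall fun s hs y hy => ?_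
      rw [Set.uIoc_of_le zero_le_one] at hs
      exact hB (s, y) ⟨⟨hs.1.le, hs.2⟩, Metric.ball_subset_closedBall hy⟩
    · exact intervalIntegrable_const
    · refine Filter.Eventually.of_forall fun s hs y hy => ?_
      rw [Set.uIoc_of_le zero_le_one] at hs
      have h1 := hd _ (hmem y (hsub (Metric.ball_subset_closedBall hy)) s ⟨hs.1.le, hs.2⟩)
      have h2 : HasDerivAt (fun y : ℂ => ε + ((s : ℂ) ^ 2) * (y - ε)) ((s : ℂ) ^ 2) y := by
        simpa using (((hasDerivAt_id y).sub_const ε).const_mul ((s : ℂ) ^ 2)).const_add ε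
      have h3 := h1.comp y h2
      rw [mul_comm] at h3
      exact h3
  · have hder : ∀ s ∈ Set.uIcc (0 : ℝ) 1, HasDerivAt
        (fun s : ℝ => (s : ℂ) * m (ε + ((s : ℂ) ^ 2) * (z - ε)))
        (2 * (z - ε) * ((s : ℂ) ^ 2 * deriv m (ε + ((s : ℂ) ^ 2) * (z - ε))) +
          m (ε + ((s : ℂ) ^ 2) * (z - ε))) s := fun s hs => by
      rw [hu] at hs
      have h2 : HasDerivAt (fun s : ℝ => ε + ((s : ℂ) ^ 2) * (z - ε)) (2 * s * (z - ε)) s := by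
        have := ((((hasDerivAt_id (s : ℂ)).pow 2).mul_const (z - ε)).const_add ε).comp_ofReal
        simpa using this
      have h3 := (hd _ (hmem z hz s hs)).comp s h2
      have h4 : HasDerivAt (fun s : ℝ => (s : ℂ)) 1 s := (hasDerivAt_id (s : ℂ)).comp_ofReal
      have h5 := h4.mul h3
      have e : 1 * (m ∘ fun s : ℝ => ε + ((s : ℂ) ^ 2) * (z - ε)) s +
          (s : ℂ) * (deriv m (ε + ((s : ℂ) ^ 2) * (z - ε)) * (2 * s * (z - ε))) =
          (2 * (z - ε) * ((s : ℂ) ^ 2 * deriv m (ε + ((s : ℂ) ^ 2) * (z - ε))) +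
          m (ε + ((s : ℂ) ^ 2) * (z - ε))) := by
        simp only [Function.comp_apply]; ring
      rw [← e]
      exact h5
    have i1 : IntervalIntegrable (fun s : ℝ => 2 * (z - ε) * ((s : ℂ) ^ 2 *
        deriv m (ε + ((s : ℂ) ^ 2) * (z - ε)))) MeasureTheory.volume 0 1 :=
      (ContinuousOn.mul continuousOn_const
        (ContinuousOn.mul (by fun_prop) (hF' z hz))).intervalIntegrable_of_Icc zero_le_one
    have i2 := (hF z hz).intervalIntegrable_of_Icc (μ := MeasureTheory.volume) zero_le_one
    have := intervalIntegral.integral_eq_sub_of_hasDerivAt hder (i1.add i2)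
    rw [intervalIntegral.integral_add i1 i2, intervalIntegral.integral_const_mul] at this
    rw [this]
    simp

/-- Near a simple zero `ε` of `R` the equation `2 R C' - R' C = q` has a holomorphic solution. -/
theorem exists_local_solution {c ε : ℂ} {r : ℝ} {R u q : ℂ → ℂ}
    (hu : DifferentiableOn ℂ u (Metric.ball c r)) (hu0 : ∀ z ∈ Metric.ball c r, u z ≠ 0)
    (hε : ε ∈ Metric.ball c r) (hR : ∀ z ∈ Metric.ball c r, R z = (z - ε) * u z)
    (hq : DifferentiableOn ℂ q (Metric.ball c r)) :
    ∃ f f' : ℂ → ℂ, ∀ z ∈ Metric.ball c r, HasDerivAt f (f' z) z ∧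
      2 * R z * f' z - deriv R z * f z = q z := by
  obtain ⟨U, hU, hUu⟩ := exists_sqrt_on_ball hu hu0
  have hU0 : ∀ z ∈ Metric.ball c r, U z ≠ 0 := fun z hz h => hu0 z hz (by
    rw [← hUu z hz, h]; simp)
  set m : ℂ → ℂ := fun z => q z / (U z * u z) with hmdef
  have hm : DifferentiableOn ℂ m (Metric.ball c r) :=
    hq.div (hU.mul hu) fun z hz => mul_ne_zero (hU0 z hz) (hu0 z hz)
  have hslope : DifferentiableOn ℂ (dslope m ε) (Metric.ball c r) :=
    (Complex.differentiableOn_dslope (Metric.isOpen_ball.mem_nhds hε)).2 hm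
  obtain ⟨E, E', hE⟩ := exists_solution_half hslope hε
  -- Writing `C = U y` with `U ^ 2 = u` turns the equation into `2 (z - ε) y' - y = m` for `m = q /
  -- (U u)`. The ansatz `y = -m ε + (z - ε) E` reduces this to the previous lemma for the difference
  -- quotient of `m`.
  refine ⟨fun z => U z * (-m ε + (z - ε) * E z),
    fun z => deriv u z / (2 * U z) * (-m ε + (z - ε) * E z) + U z * (E z + (z - ε) * E' z),
    fun z hz => ⟨?_, ?_⟩⟩
  · have hnh := Metric.isOpen_ball.mem_nhds hz
    have h1 : HasDerivAt U (deriv u z / (2 * U z)) z :=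
      hasDerivAt_of_sq (hu.differentiableAt hnh).hasDerivAt (hU.differentiableAt hnh)
        (Filter.eventually_of_mem hnh hUu) (hU0 z hz)
    have h2 : HasDerivAt (fun z => -m ε + (z - ε) * E z) (E z + (z - ε) * E' z) z := by
      have := (((hasDerivAt_id z).sub_const ε).mul (hE z hz).1).const_add (-m ε)
      simpa using this
    exact h1.mul h2
  · have hnh := Metric.isOpen_ball.mem_nhds hz
    have hRd : HasDerivAt R (u z + (z - ε) * deriv u z) z := by
      have h1 := ((hasDerivAt_id z).sub_const ε).mul (hu.differentiableAt hnh).hasDerivAt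
      simp only [one_mul] at h1
      exact h1.congr_of_eventuallyEq (Filter.eventually_of_mem hnh hR)
    rw [hRd.deriv, hR z hz]
    have h3 := (hE z hz).2
    have h4 : (z - ε) * dslope m ε z = m z - m ε := by
      simpa using sub_smul_dslope m ε z
    have h5 : m z * (U z * u z) = q z :=
      div_mul_cancel₀ _ (mul_ne_zero (hU0 z hz) (hu0 z hz))
    have h6 := hUu z hz
    have h7 := hU0 z hz
    have h8 : u z * (deriv u z / (2 * U z)) = U z * deriv u z / 2 := by
      rw [← h6]; field_simp
    rw [← h5, show m z = m ε + (z - ε) * (2 * (z - ε) * E' z + E z) by rw [h3, h4]; ring]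
    linear_combination (2 * (z - ε) * (-m ε + (z - ε) * E z)) * h8

/-- A function with exactly one zero, a simple one, inside of a circle is a square times `z - w`
on the circle. -/
theorem exists_sqrt_on_sphere {w ε : ℂ} {r ρ : ℝ} {R u : ℂ → ℂ} (hρr : ρ < r)
    (hu : DifferentiableOn ℂ u (Metric.ball w r)) (hu0 : ∀ z ∈ Metric.ball w r, u z ≠ 0)
    (hε : ε ∈ Metric.ball w ρ) (hR : ∀ z ∈ Metric.ball w r, R z = (z - ε) * u z) :
    ∃ F : ℂ → ℂ, ContinuousOn F (Metric.sphere w ρ) ∧ (∀ z ∈ Metric.sphere w ρ, F z ≠ 0) ∧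
      ∀ z ∈ Metric.sphere w ρ, R z = (z - w) * F z ^ 2 := by
  obtain ⟨U, hU, hUu⟩ := exists_sqrt_on_ball hu hu0
  have hsub : Metric.sphere w ρ ⊆ Metric.ball w r := fun z hz => by
    rw [Metric.mem_sphere] at hz; rw [Metric.mem_ball, hz]; exact hρr
  have hU0 : ∀ z ∈ Metric.sphere w ρ, U z ≠ 0 := fun z hz h => hu0 z (hsub hz) (by
    rw [← hUu z (hsub hz), h]; simp)
  have hρ : 0 < ρ := dist_nonneg.trans_lt hε
  have hzw : ∀ z ∈ Metric.sphere w ρ, z - w ≠ 0 := fun z hz h => by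
    rw [Metric.mem_sphere, dist_eq_norm, h, norm_zero] at hz; linarith
  have hslit : ∀ z ∈ Metric.sphere w ρ, 1 - (ε - w) / (z - w) ∈ Complex.slitPlane := by
    intro z hz
    refine Complex.mem_slitPlane_of_norm_lt_one (z := -((ε - w) / (z - w))) ?_
    rw [Metric.mem_sphere, dist_eq_norm] at hz
    rw [Metric.mem_ball, dist_eq_norm] at hε
    rw [norm_neg, norm_div, hz, div_lt_one hρ]
    exact hε
  -- On the circle `ε` is closer to the centre than `z`, so `(z - ε) / (z - w)` lies within distance
  -- less than `1` of `1` and has a principal root.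
  refine ⟨fun z => (1 - (ε - w) / (z - w)) ^ (1 / 2 : ℂ) * U z, ?_, ?_, ?_⟩
  · refine ContinuousOn.mul (ContinuousOn.cpow ?_ continuousOn_const hslit) (hU.continuousOn.mono hsub)
    exact continuousOn_const.sub (continuousOn_const.div (by fun_prop) hzw)
  · intro z hz
    refine mul_ne_zero ?_ (hU0 z hz)
    rw [Ne, Complex.cpow_eq_zero_iff]
    exact fun h => Complex.slitPlane_ne_zero (hslit z hz) h.1
  · intro z hz
    have h1 : ((1 - (ε - w) / (z - w)) ^ (1 / 2 : ℂ)) ^ 2 = 1 - (ε - w) / (z - w) := by simp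
    rw [mul_pow, h1, hUu z (hsub hz), hR z (hsub hz)]
    have := hzw z hz
    field_simp
    ring

end LocalSolution

end Whitham

namespace Whitham

/-! ### Paths on the curve and integrals along them. -/

section Paths

/-- A piecewise continuously differentiable path in the part of the curve `ν ^ 2 = R(λ)` over
`S`. -/
structure IsPath (S : Set ℂ) (R : ℂ → ℂ) (γ ν : ℝ → ℂ) : Prop where
  continuousOn_fst : ContinuousOn γ (Set.Icc 0 1)
  continuousOn_snd : ContinuousOn ν (Set.Icc 0 1)
  piecewise : ∃ (s : Finset ℝ) (K : ℝ), ∀ t ∈ Set.Icc (0 : ℝ) 1, t ∉ s →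
    ContDiffAt ℝ 1 γ t ∧ ‖deriv γ t‖ ≤ K
  mem : ∀ t ∈ Set.Icc (0 : ℝ) 1, γ t ∈ S
  on_curve : ∀ t ∈ Set.Icc (0 : ℝ) 1, ν t ^ 2 = R (γ t)

/-- The derivative of any function of a real variable is measurable, so a bound off a finite set
suffices. -/
theorem intervalIntegrable_mul_deriv {γ w : ℝ → ℂ} (hw : ContinuousOn w (Set.Icc 0 1))
    (h : ∃ (s : Finset ℝ) (K : ℝ), ∀ t ∈ Set.Icc (0 : ℝ) 1, t ∉ s →
      ContDiffAt ℝ 1 γ t ∧ ‖deriv γ t‖ ≤ K) :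
    IntervalIntegrable (fun t => w t * deriv γ t) MeasureTheory.volume 0 1 := by
  obtain ⟨s, K, hs⟩ := h
  obtain ⟨B, hB⟩ := isCompact_Icc.exists_bound_of_continuousOn hw
  have hwm := (hw.intervalIntegrable_of_Icc
    (μ := MeasureTheory.volume) zero_le_one).aestronglyMeasurable_restrict_uIoc
  refine (intervalIntegrable_const (c := B * K)).mono_fun
    (hwm.mul (measurable_deriv γ).aestronglyMeasurable) ?_
  have hfin : ∀ᵐ t ∂(MeasureTheory.volume.restrict (Set.uIoc (0 : ℝ) 1)), t ∉ (s : Set ℝ) :=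
    MeasureTheory.ae_restrict_of_ae (s.finite_toSet.countable.ae_notMem _)
  filter_upwards [hfin, MeasureTheory.ae_restrict_mem measurableSet_uIoc] with t ht1 ht2
  rw [Set.uIoc_of_le zero_le_one] at ht2
  have ht : t ∈ Set.Icc (0 : ℝ) 1 := ⟨ht2.1.le, ht2.2⟩
  rw [norm_mul]
  refine (mul_le_mul (hB t ht) (hs t ht ht1).2 (norm_nonneg _)
    ((norm_nonneg _).trans (hB t ht))).trans (le_abs_self _)

variable {S : Set ℂ} {R h : ℂ → ℂ} {γ ν : ℝ → ℂ}

namespace IsPath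

theorem ne_zero (hp : IsPath S R γ ν) (hR : ∀ z ∈ S, R z ≠ 0) {t : ℝ}
    (ht : t ∈ Set.Icc (0 : ℝ) 1) : ν t ≠ 0 := fun h0 => by
  have := hp.on_curve t ht
  rw [h0] at this
  exact hR _ (hp.mem t ht) (by rw [← this]; simp)

theorem intervalIntegrable (hp : IsPath S R γ ν) (hR : ∀ z ∈ S, R z ≠ 0)
    (hh : ContinuousOn h S) :
    IntervalIntegrable (fun t => h (γ t) / ν t * deriv γ t) MeasureTheory.volume 0 1 :=
  intervalIntegrable_mul_deriv ((hh.comp hp.continuousOn_fst hp.mem).div hp.continuousOn_snd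
    fun _ ht => hp.ne_zero hR ht) hp.piecewise

theorem neg (hp : IsPath S R γ ν) : IsPath S R γ (fun t => -ν t) :=
  ⟨hp.continuousOn_fst, hp.continuousOn_snd.neg, hp.piecewise, hp.mem,
    fun t ht => by rw [neg_sq]; exact hp.on_curve t ht⟩

theorem symm (hp : IsPath S R γ ν) : IsPath S R (fun t => γ (1 - t)) (fun t => ν (1 - t)) := by
  have hm : ∀ t ∈ Set.Icc (0 : ℝ) 1, 1 - t ∈ Set.Icc (0 : ℝ) 1 := fun t ht =>
    ⟨by linarith [ht.2], by linarith [ht.1]⟩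
  refine ⟨hp.continuousOn_fst.comp (by fun_prop) hm, hp.continuousOn_snd.comp (by fun_prop) hm,
    ?_, fun t ht => hp.mem _ (hm t ht), fun t ht => hp.on_curve _ (hm t ht)⟩
  obtain ⟨s, K, hs⟩ := hp.piecewise
  refine ⟨s.image fun t => 1 - t, K, fun t ht hts => ?_⟩
  have h1 : 1 - t ∉ s := fun h => hts (Finset.mem_image.2 ⟨1 - t, h, by ring⟩)
  obtain ⟨h2, h3⟩ := hs _ (hm t ht) h1
  refine ⟨h2.comp t (contDiffAt_const.sub contDiffAt_id), ?_⟩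
  rw [deriv_comp_const_sub, norm_neg]
  exact h3

end IsPath

/-- The concatenation of two functions on the unit interval. -/
noncomputable def glue (f g : ℝ → ℂ) : ℝ → ℂ :=
  fun t => if t ≤ 1 / 2 then f (2 * t) else g (2 * t - 1)

theorem glue_left (f g : ℝ → ℂ) {t : ℝ} (ht : t ≤ 1 / 2) : glue f g t = f (2 * t) := if_pos ht

theorem glue_right {f g : ℝ → ℂ} (hfg : f 1 = g 0) {t : ℝ} (ht : 1 / 2 ≤ t) :
    glue f g t = g (2 * t - 1) := by
  rcases ht.lt_or_eq with h | h
  · exact if_neg (not_le.2 h)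
  · rw [← h, glue, if_pos le_rfl]; norm_num [hfg]

theorem continuousOn_glue {f g : ℝ → ℂ} (hf : ContinuousOn f (Set.Icc 0 1))
    (hg : ContinuousOn g (Set.Icc 0 1)) (hfg : f 1 = g 0) :
    ContinuousOn (glue f g) (Set.Icc 0 1) := by
  have h1 : ContinuousOn (glue f g) (Set.Icc 0 (1 / 2)) :=
    (hf.comp (f := fun t : ℝ => 2 * t) (by fun_prop)
      (fun t ht => ⟨by linarith [ht.1], by linarith [ht.2]⟩)).congr fun t ht => glue_left _ _ ht.2
  have h2 : ContinuousOn (glue f g) (Set.Icc (1 / 2) 1) :=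
    (hg.comp (f := fun t : ℝ => 2 * t - 1) (by fun_prop)
      (fun t ht => ⟨by linarith [ht.1], by linarith [ht.2]⟩)).congr fun t ht => glue_right hfg ht.1
  have h3 := h1.union_of_isClosed h2 isClosed_Icc isClosed_Icc
  rwa [Set.Icc_union_Icc_eq_Icc (by norm_num) (by norm_num)] at h3

theorem glue_eventuallyEq_left (f g : ℝ → ℂ) {t : ℝ} (ht : t < 1 / 2) :
    glue f g =ᶠ[𝓝 t] fun t => f (2 * t) :=
  Filter.eventually_of_mem (Iio_mem_nhds ht) fun _ hs => glue_left f g (le_of_lt hs)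

theorem glue_eventuallyEq_right (f g : ℝ → ℂ) {t : ℝ} (ht : 1 / 2 < t) :
    glue f g =ᶠ[𝓝 t] fun t => g (2 * t - 1) :=
  Filter.eventually_of_mem (Ioi_mem_nhds ht) fun _ hs => if_neg (not_le.2 hs)

theorem deriv_glue_left (f g : ℝ → ℂ) {t : ℝ} (ht : t < 1 / 2) :
    deriv (glue f g) t = 2 * deriv f (2 * t) := by
  rw [(glue_eventuallyEq_left f g ht).deriv_eq, deriv_comp_mul_left 2 f]
  simp

theorem deriv_glue_right (f g : ℝ → ℂ) {t : ℝ} (ht : 1 / 2 < t) :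
    deriv (glue f g) t = 2 * deriv g (2 * t - 1) := by
  rw [(glue_eventuallyEq_right f g ht).deriv_eq, deriv_comp_mul_left 2 (fun s => g (s - 1)),
    deriv_comp_sub_const]
  simp

theorem IsPath.glue {γ' ν' : ℝ → ℂ} (hp : IsPath S R γ ν) (hp' : IsPath S R γ' ν')
    (h1 : γ 1 = γ' 0) (h2 : ν 1 = ν' 0) : IsPath S R (glue γ γ') (glue ν ν') := by
  refine ⟨continuousOn_glue hp.continuousOn_fst hp'.continuousOn_fst h1,
    continuousOn_glue hp.continuousOn_snd hp'.continuousOn_snd h2, ?_, ?_, ?_⟩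
  · obtain ⟨s, K, hs⟩ := hp.piecewise
    obtain ⟨s', K', hs'⟩ := hp'.piecewise
    refine ⟨insert (1 / 2) (s.image (fun t => t / 2) ∪ s'.image fun t => (t + 1) / 2),
      2 * max K K', fun t ht hts => ?_⟩
    simp only [Finset.mem_insert, Finset.mem_union, Finset.mem_image, not_or, not_exists,
      not_and] at hts
    obtain ⟨hne, ha, hb⟩ := hts
    rcases lt_or_gt_of_ne hne with hlt | hgt
    · obtain ⟨h3, h4⟩ := hs (2 * t) ⟨by linarith [ht.1], by linarith⟩
        fun hm => ha _ hm (by ring)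
      refine ⟨(ContDiffAt.comp (f := fun t : ℝ => 2 * t) t h3
        (by fun_prop)).congr_of_eventuallyEq (glue_eventuallyEq_left _ _ hlt), ?_⟩
      rw [deriv_glue_left _ _ hlt, norm_mul]
      simpa using h4.trans (le_max_left _ _)
    · obtain ⟨h3, h4⟩ := hs' (2 * t - 1) ⟨by linarith, by linarith [ht.2]⟩
        fun hm => hb _ hm (by ring)
      refine ⟨(ContDiffAt.comp (f := fun t : ℝ => 2 * t - 1) t h3
        (by fun_prop)).congr_of_eventuallyEq (glue_eventuallyEq_right _ _ hgt), ?_⟩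
      rw [deriv_glue_right _ _ hgt, norm_mul]
      simpa using h4.trans (le_max_right _ _)
  · intro t ht
    rcases le_total t (1 / 2) with hl | hl
    · rw [glue_left _ _ hl]; exact hp.mem _ ⟨by linarith [ht.1], by linarith⟩
    · rw [glue_right h1 hl]; exact hp'.mem _ ⟨by linarith, by linarith [ht.2]⟩
  · intro t ht
    rcases le_total t (1 / 2) with hl | hl
    · rw [glue_left _ _ hl, glue_left _ _ hl]
      exact hp.on_curve _ ⟨by linarith [ht.1], by linarith⟩
    · rw [glue_right h1 hl, glue_right h2 hl]
      exact hp'.on_curve _ ⟨by linarith, by linarith [ht.2]⟩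

/-- The points `p` and `q` of the curve are joined by a path over `S`, along which the form
`h(λ) / ν dλ` has the integral `J`. -/
def Joined (S : Set ℂ) (R h : ℂ → ℂ) (p q : ℂ × ℂ) (J : ℂ) : Prop :=
  ∃ γ ν : ℝ → ℂ, IsPath S R γ ν ∧ (γ 0, ν 0) = p ∧ (γ 1, ν 1) = q ∧
    ∫ t in (0 : ℝ)..1, h (γ t) / ν t * deriv γ t = J

namespace Joined

variable {p q q' : ℂ × ℂ} {J J' : ℂ}

theorem neg (H : Joined S R h p q J) : Joined S R h (p.1, -p.2) (q.1, -q.2) (-J) := by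
  obtain ⟨γ, ν, hp, rfl, rfl, rfl⟩ := H
  refine ⟨γ, _, hp.neg, rfl, rfl, ?_⟩
  rw [← intervalIntegral.integral_neg]
  congr 1; ext t; rw [div_neg, neg_mul]

theorem symm (H : Joined S R h p q J) : Joined S R h q p (-J) := by
  obtain ⟨γ, ν, hp, rfl, rfl, rfl⟩ := H
  refine ⟨_, _, hp.symm, by simp, by simp, ?_⟩
  simp only [deriv_comp_const_sub]
  rw [intervalIntegral.integral_comp_sub_left (fun t => h (γ t) / ν t * -deriv γ t) 1,
    ← intervalIntegral.integral_neg]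
  simp

theorem trans (hR : ∀ z ∈ S, R z ≠ 0) (hh : ContinuousOn h S) (H : Joined S R h p q J)
    (H' : Joined S R h q q' J') : Joined S R h p q' (J + J') := by
  obtain ⟨γ, ν, hp, rfl, rfl, rfl⟩ := H
  obtain ⟨γ', ν', hp', he, rfl, rfl⟩ := H'
  obtain ⟨h1, h2⟩ := Prod.mk.inj he
  have hg := hp.glue hp' h1.symm h2.symm
  refine ⟨_, _, hg, ?_, ?_, ?_⟩
  · rw [glue_left _ _ (by norm_num), glue_left _ _ (by norm_num), mul_zero]
  · rw [glue_right h1.symm (by norm_num), glue_right h2.symm (by norm_num)]; norm_num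
  have hi := hg.intervalIntegrable hR hh
  have hm : (1 / 2 : ℝ) ∈ Set.uIcc (0 : ℝ) 1 := by
    rw [Set.uIcc_of_le zero_le_one]; norm_num
  rw [← intervalIntegral.integral_add_adjacent_intervals (b := 1 / 2)
    (hi.mono_set (Set.uIcc_subset_uIcc_left hm)) (hi.mono_set (Set.uIcc_subset_uIcc_right hm))]
  have hne : ∀ᵐ t : ℝ, t ≠ 1 / 2 := by
    simpa using (Set.countable_singleton (1 / 2 : ℝ)).ae_notMem MeasureTheory.volume
  congr 1
  · have e1 : ∫ t in (0 : ℝ)..1 / 2, h (Whitham.glue γ γ' t) / Whitham.glue ν ν' t *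
        deriv (Whitham.glue γ γ') t =
        ∫ t in (0 : ℝ)..1 / 2, 2 * (h (γ (2 * t)) / ν (2 * t) * deriv γ (2 * t)) := by
      refine intervalIntegral.integral_congr_ae (hne.mono fun t ht htm => ?_)
      rw [Set.uIoc_of_le (by norm_num)] at htm
      rw [deriv_glue_left _ _ (lt_of_le_of_ne htm.2 ht), glue_left _ _ htm.2, glue_left _ _ htm.2]
      ring
    rw [e1, intervalIntegral.integral_const_mul,
      intervalIntegral.integral_comp_mul_left (fun t => h (γ t) / ν t * deriv γ t) two_ne_zero]
    simp
  · have e1 : ∫ t in (1 / 2 : ℝ)..1, h (Whitham.glue γ γ' t) / Whitham.glue ν ν' t *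
        deriv (Whitham.glue γ γ') t =
        ∫ t in (1 / 2 : ℝ)..1, 2 * (h (γ' (2 * t - 1)) / ν' (2 * t - 1) * deriv γ' (2 * t - 1)) := by
      refine intervalIntegral.integral_congr_ae (hne.mono fun t ht htm => ?_)
      rw [Set.uIoc_of_le (by norm_num)] at htm
      rw [deriv_glue_right _ _ htm.1, glue_right h1.symm htm.1.le, glue_right h2.symm htm.1.le]
      ring
    rw [e1, intervalIntegral.integral_const_mul,
      intervalIntegral.integral_comp_mul_sub (fun t => h (γ' t) / ν' t * deriv γ' t) two_ne_zero]
    norm_num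
    ring

/-- Points of the graph of a branch of `ν` over a disc are joined by segments. -/
theorem segment {c z z' : ℂ} {r : ℝ} {s H : ℂ → ℂ} (hS : Metric.ball c r ⊆ S)
    (hR : ∀ z ∈ S, R z ≠ 0) (hh : ContinuousOn h S)
    (hs : ContinuousOn s (Metric.ball c r)) (hsR : ∀ z ∈ Metric.ball c r, s z ^ 2 = R z)
    (hH : ∀ z ∈ Metric.ball c r, HasDerivAt H (h z / s z) z)
    (hz : z ∈ Metric.ball c r) (hz' : z' ∈ Metric.ball c r) :
    Joined S R h (z, s z) (z', s z') (H z' - H z) := by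
  have hmem : ∀ t ∈ Set.Icc (0 : ℝ) 1, z + (t : ℂ) * (z' - z) ∈ Metric.ball c r := fun t ht => by
    simpa using (convex_ball c r).add_smul_sub_mem hz hz' ht
  have hd : ∀ t : ℝ, HasDerivAt (fun t : ℝ => z + (t : ℂ) * (z' - z)) (z' - z) t := fun t => by
    simpa using (((hasDerivAt_id (t : ℂ)).mul_const (z' - z)).const_add z).comp_ofReal
  have hp : IsPath S R (fun t : ℝ => z + (t : ℂ) * (z' - z))
      (fun t : ℝ => s (z + (t : ℂ) * (z' - z))) := by
    refine ⟨by fun_prop, hs.comp (by fun_prop) hmem, ⟨∅, ‖z' - z‖, fun t _ _ => ⟨?_, ?_⟩⟩,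
      fun t ht => hS (hmem t ht), fun t ht => hsR _ (hmem t ht)⟩
    · have : ContDiffAt ℝ 1 (fun t : ℝ => (t : ℂ)) t := Complex.ofRealCLM.contDiff.contDiffAt
      fun_prop
    · rw [(hd t).deriv]
  refine ⟨_, _, hp, by simp, by simp, ?_⟩
  rw [intervalIntegral.integral_eq_sub_of_hasDerivAt (f := fun t : ℝ => H (z + (t : ℂ) * (z' - z)))
    (fun t ht => ?_) (hp.intervalIntegrable hR hh)]
  · simp
  · rw [Set.uIcc_of_le zero_le_one] at ht
    rw [(hd t).deriv]
    exact (hH _ (hmem t ht)).comp t (hd t)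

end Joined

/-- A circle around which `R` is a square times `z - w` interchanges the sheets. -/
theorem exists_joined_neg {w : ℂ} {ρ : ℝ} (hρ : 0 < ρ) {F : ℂ → ℂ}
    (hS : Metric.sphere w ρ ⊆ S) (hF : ContinuousOn F (Metric.sphere w ρ))
    (h0 : ∀ z ∈ Metric.sphere w ρ, R z = (z - w) * F z ^ 2) :
    ∃ z v J, z ∈ S ∧ v ^ 2 = R z ∧ Joined S R h (z, -v) (z, v) J := by
  let γ : ℝ → ℂ := fun t => circleMap w ρ (2 * Real.pi * t)
  have hγ : ∀ t, γ t ∈ Metric.sphere w ρ := fun t => circleMap_mem_sphere w hρ.le _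
  have hρ2 : ((√ρ : ℝ) : ℂ) ^ 2 = ρ := by exact_mod_cast Real.sq_sqrt hρ.le
  -- Along the full turn `γ` the half-angle root picks up the factor `exp (π i) = -1`, so the lift
  -- ends on the other sheet.
  let ν : ℝ → ℂ := fun t => √ρ * Complex.exp (Real.pi * t * Complex.I) * F (γ t)
  have hd : ∀ t, HasDerivAt γ (2 * Real.pi * (circleMap 0 ρ (2 * Real.pi * t) * Complex.I)) t :=
    fun t => by
      have h1 : HasDerivAt (fun t : ℝ => 2 * Real.pi * t) (2 * Real.pi) t := by
        simpa using (hasDerivAt_id t).const_mul (2 * Real.pi)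
      have h2 := (hasDerivAt_circleMap w ρ (2 * Real.pi * t)).scomp t h1
      rw [Complex.real_smul] at h2
      push_cast at h2
      exact h2
  have hγs : ContDiff ℝ 1 γ := (contDiff_circleMap w ρ).comp (by fun_prop)
  have hsq : ∀ t, ν t ^ 2 = R (γ t) := fun t => by
    rw [h0 _ (hγ t)]
    simp only [ν, mul_pow, hρ2, ← Complex.exp_nat_mul, γ, circleMap, add_sub_cancel_left]
    push_cast
    rw [show (2 : ℂ) * (Real.pi * t * Complex.I) = 2 * Real.pi * t * Complex.I by ring]
  have hp : IsPath S R γ ν := by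
    refine ⟨hγs.continuous.continuousOn, ?_, ⟨∅, 2 * Real.pi * ρ, fun t _ _ =>
      ⟨hγs.contDiffAt, ?_⟩⟩, fun t _ => hS (hγ t), fun t _ => hsq t⟩
    · have hFc : Continuous fun t => F (γ t) := hF.comp_continuous hγs.continuous hγ
      exact (Continuous.mul (Continuous.mul (by fun_prop) (by fun_prop)) hFc).continuousOn
    · rw [(hd t).deriv]
      simp [abs_of_pos Real.pi_pos, abs_of_pos hρ]
  have hγ1 : γ 1 = γ 0 := by simp [γ, circleMap, Complex.exp_two_pi_mul_I]
  refine ⟨γ 0, ν 1, _, hS (hγ 0), by rw [hsq, hγ1], γ, ν, hp, ?_, by rw [hγ1], rfl⟩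
  simp [ν, hγ1, Complex.exp_pi_mul_I]

end Paths

end Whitham

namespace Whitham

/-! ### Connectedness of the complement of discs. -/

section Connected

/-- A separation of the complement would extend to the plane: each boundary circle is connected,
lies in the complement, and thus in one of the two parts; its disc is assigned to the same part
(`fill`). -/
theorem isPreconnected_compl_balls (Z : Finset ℂ) (ρ : ℂ → ℝ) (hρ : ∀ w ∈ Z, 0 < ρ w)
    (hd : ∀ w ∈ Z, ∀ w' ∈ Z, w ≠ w' →
      Disjoint (Metric.closedBall w (ρ w)) (Metric.closedBall w' (ρ w'))) :
    IsPreconnected {z : ℂ | ∀ w ∈ Z, ρ w ≤ dist z w} := by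
  set s := {z : ℂ | ∀ w ∈ Z, ρ w ≤ dist z w} with hs
  have hsc : IsClosed s := by
    simp only [hs, Set.setOf_forall]
    exact isClosed_iInter fun w => isClosed_iInter fun _ =>
      isClosed_le continuous_const (by fun_prop)
  have hsub : ∀ w ∈ Z, Metric.sphere w (ρ w) ⊆ s := fun w hw z hz w' hw' => by
    by_cases h : w = w'
    · rw [← h]; exact (Metric.mem_sphere.1 hz).ge
    · by_contra hlt
      exact Set.disjoint_left.1 (hd w hw w' hw' h) (Metric.sphere_subset_closedBall hz)
        (Metric.mem_closedBall.2 (not_le.1 hlt).le)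
  rw [isPreconnected_closed_iff]
  intro t t' ht ht' hst hne hne'
  by_contra hemp
  rw [Set.not_nonempty_iff_eq_empty] at hemp
  have hdis : ∀ z ∈ s, z ∈ t → z ∈ t' → False := fun z h1 h2 h3 => by
    have : z ∈ s ∩ (t ∩ t') := ⟨h1, h2, h3⟩
    rw [hemp] at this; exact this
  classical
  let fill : Set ℂ → Set ℂ := fun t =>
    (s ∩ t) ∪ ⋃ w ∈ Z.filter (fun w => Metric.sphere w (ρ w) ⊆ t), Metric.closedBall w (ρ w)
  have hfc : ∀ t, IsClosed t → IsClosed (fill t) := fun t ht =>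
    (hsc.inter ht).union (isClosed_biUnion_finset fun _ _ => Metric.isClosed_closedBall)
  have hcover : (Set.univ : Set ℂ) ⊆ fill t ∪ fill t' := by
    intro z _
    by_cases hz : z ∈ s
    · rcases hst hz with h | h
      · exact Or.inl (Or.inl ⟨hz, h⟩)
      · exact Or.inr (Or.inl ⟨hz, h⟩)
    · simp only [hs, Set.mem_ofPred_eq, not_forall, not_le] at hz
      obtain ⟨w, hw, hzw⟩ := hz
      have hpc : IsPreconnected (Metric.sphere w (ρ w)) :=
        isPreconnected_sphere (by simp) w (ρ w)
      have := isPreconnected_iff_subset_of_disjoint_closed.1 hpc t t' ht ht'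
        ((hsub w hw).trans hst) (by
          rw [Set.eq_empty_iff_forall_notMem]
          exact fun y hy => hdis y (hsub w hw hy.1) hy.2.1 hy.2.2)
      rcases this with h | h
      · exact Or.inl (Or.inr (Set.mem_biUnion (Finset.mem_filter.2 ⟨hw, h⟩)
          (Metric.mem_closedBall.2 hzw.le)))
      · exact Or.inr (Or.inr (Set.mem_biUnion (Finset.mem_filter.2 ⟨hw, h⟩)
          (Metric.mem_closedBall.2 hzw.le)))
  obtain ⟨z, -, hz, hz'⟩ := isPreconnected_closed_iff.1 isPreconnected_univ (fill t) (fill t')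
    (hfc t ht) (hfc t' ht') hcover (hne.mono fun z hz => ⟨trivial, Or.inl hz⟩)
    (hne'.mono fun z hz => ⟨trivial, Or.inl hz⟩)
  have hmix : ∀ t z, z ∈ s →
      z ∈ (⋃ w ∈ Z.filter (fun w => Metric.sphere w (ρ w) ⊆ t), Metric.closedBall w (ρ w)) →
      z ∈ t := fun t z hz hzU => by
    simp only [Set.mem_iUnion, Finset.mem_filter] at hzU
    obtain ⟨w, ⟨hw, hwt⟩, hzw⟩ := hzU
    exact hwt (Metric.mem_sphere.2 (le_antisymm hzw (hz w hw)))
  rcases hz with hz | hz <;> rcases hz' with hz' | hz'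
  · exact hdis z hz.1 hz.2 hz'.2
  · exact hdis z hz.1 hz.2 (hmix _ _ hz.1 hz')
  · exact hdis z hz'.1 (hmix _ _ hz'.1 hz) hz'.2
  · simp only [Set.mem_iUnion, Finset.mem_filter] at hz hz'
    obtain ⟨w, ⟨hw, hwt⟩, hzw⟩ := hz
    obtain ⟨w', ⟨hw', hwt'⟩, hzw'⟩ := hz'
    by_cases h : w = w'
    · subst h
      obtain ⟨y, hy⟩ : (Metric.sphere w (ρ w)).Nonempty :=
        NormedSpace.sphere_nonempty.2 (hρ w hw).le
      exact hdis y (hsub w hw hy) (hwt hy) (hwt' hy)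
    · exact Set.disjoint_left.1 (hd w hw w' hw' h) hzw hzw'

/-- Disjointness of closed discs is a strict inequality between radii and distance, and there are
finitely many of them. Radius zero is allowed, so that a marked point can be treated as a disc. -/
theorem exists_enlarge {Z : Finset ℂ} {ρ : ℂ → ℝ} (hρ : ∀ w ∈ Z, 0 ≤ ρ w)
    (hd : ∀ w ∈ Z, ∀ w' ∈ Z, w ≠ w' →
      Disjoint (Metric.closedBall w (ρ w)) (Metric.closedBall w' (ρ w'))) (Y : Finset ℂ)
    (hY : ∀ z ∈ Y, ∀ w ∈ Z, ρ w < dist z w) :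
    ∃ δ > 0, (∀ z ∈ Y, ∀ w ∈ Z, ρ w + δ ≤ dist z w) ∧ ∀ w ∈ Z, ∀ w' ∈ Z, w ≠ w' →
      Disjoint (Metric.closedBall w (ρ w + δ)) (Metric.closedBall w' (ρ w' + δ)) := by
  have h0 : ∀ᶠ δ : ℝ in 𝓝[>] 0, 0 < δ := eventually_mem_nhdsWithin
  have h1 : ∀ᶠ δ : ℝ in 𝓝[>] 0, ∀ z ∈ Y, ∀ w ∈ Z, ρ w + δ ≤ dist z w := by
    refine (Finset.eventually_all _).2 fun z hz => (Finset.eventually_all _).2 fun w hw => ?_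
    have : Filter.Tendsto (fun δ : ℝ => ρ w + δ) (𝓝 0) (𝓝 (ρ w + 0)) := by
      exact (continuous_const.add continuous_id).tendsto 0
    rw [add_zero] at this
    exact (this.mono_left nhdsWithin_le_nhds).eventually (eventually_le_nhds (hY z hz w hw))
  have h2 : ∀ᶠ δ : ℝ in 𝓝[>] 0, ∀ w ∈ Z, ∀ w' ∈ Z, w ≠ w' →
      Disjoint (Metric.closedBall w (ρ w + δ)) (Metric.closedBall w' (ρ w' + δ)) := by
    refine (Finset.eventually_all _).2 fun w hw => (Finset.eventually_all _).2 fun w' hw' => ?_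
    by_cases h : w = w'
    · exact Filter.Eventually.of_forall fun _ hne => (hne h).elim
    have h3 := (disjoint_closedBall_closedBall_iff (hρ w hw) (hρ w' hw')).1 (hd w hw w' hw' h)
    have : Filter.Tendsto (fun δ : ℝ => (ρ w + δ) + (ρ w' + δ)) (𝓝 0)
        (𝓝 ((ρ w + 0) + (ρ w' + 0))) :=
      ((continuous_const.add continuous_id).add (continuous_const.add continuous_id)).tendsto 0
    rw [add_zero, add_zero] at this
    filter_upwards [h0, (this.mono_left nhdsWithin_le_nhds).eventually (eventually_lt_nhds h3)]
      with δ hδ hlt _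
    exact (disjoint_closedBall_closedBall_iff (by linarith [hρ w hw])
      (by linarith [hρ w' hw'])).2 hlt
  obtain ⟨δ, a, b, c⟩ := (h0.and (h1.and h2)).exists
  exact ⟨δ, a, b, c⟩

/-- The complement of finitely many disjoint closed discs is connected. -/
theorem isPreconnected_compl_closedBalls {Z : Finset ℂ} {ρ : ℂ → ℝ} (hρ : ∀ w ∈ Z, 0 ≤ ρ w)
    (hd : ∀ w ∈ Z, ∀ w' ∈ Z, w ≠ w' →
      Disjoint (Metric.closedBall w (ρ w)) (Metric.closedBall w' (ρ w'))) :
    IsPreconnected {z : ℂ | ∀ w ∈ Z, ρ w < dist z w} := by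
  classical
  refine isPreconnected_of_forall_pair fun z hz z' hz' => ?_
  -- Any two points of the complement lie in the complement of slightly larger discs, which is
  -- connected by the previous case.
  obtain ⟨δ, hδ, h1, h2⟩ := exists_enlarge hρ hd {z, z'} (by
    intro y hy
    rcases Finset.mem_insert.1 hy with rfl | hy
    · exact hz
    · rw [Finset.mem_singleton.1 hy]; exact hz')
  exact ⟨{z : ℂ | ∀ w ∈ Z, ρ w + δ ≤ dist z w},
    fun y hy w hw => lt_of_lt_of_le (by linarith) (hy w hw),
    h1 z (by simp), h1 z' (by simp),
    isPreconnected_compl_balls Z (fun w => ρ w + δ) (fun w hw => by linarith [hρ w hw]) h2⟩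

end Connected

/-! ### The odd primitive of a form without periods. -/

section Primitive

variable {S : Set ℂ} {R h : ℂ → ℂ}

/-- Run along the segment on the sheet `-s`, then along the given path, then along the segment on
the sheet `s`. The form is odd and the first segment is traversed backwards, so the two segments
contribute equally. -/
theorem Joined.move {c z z' : ℂ} {r : ℝ} {s H : ℂ → ℂ} (hS : Metric.ball c r ⊆ S)
    (hR : ∀ z ∈ S, R z ≠ 0) (hh : ContinuousOn h S)
    (hs : ContinuousOn s (Metric.ball c r)) (hsR : ∀ z ∈ Metric.ball c r, s z ^ 2 = R z)
    (hH : ∀ z ∈ Metric.ball c r, HasDerivAt H (h z / s z) z)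
    (hz : z ∈ Metric.ball c r) (hz' : z' ∈ Metric.ball c r) {J : ℂ}
    (hJ : Joined S R h (z, -s z) (z, s z) J) :
    Joined S R h (z', -s z') (z', s z') (J + 2 * (H z' - H z)) := by
  have h1 := Joined.segment hS hR hh hs hsR hH hz hz'
  have h2 := h1.neg.symm.trans hR hh (hJ.trans hR hh h1)
  convert! h2 using 1
  ring

/-- If all periods of the form `h(λ) / ν dλ` vanish, then its odd primitive, multiplied by `ν`, is
a function of `λ`. -/
theorem exists_primitive_of_periods (hSo : IsOpen S) (hSc : IsPreconnected S)
    (hRd : DifferentiableOn ℂ R S) (hR : ∀ z ∈ S, R z ≠ 0) (hh : DifferentiableOn ℂ h S)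
    (hper : ∀ p J, Joined S R h p p J → J = 0)
    (hflip : ∃ z v J, z ∈ S ∧ v ^ 2 = R z ∧ Joined S R h (z, -v) (z, v) J) :
    ∃ f : ℂ → ℂ, ∀ z ∈ S, HasDerivAt f (h z + f z * deriv R z / (2 * R z)) z := by
  have hloc : ∀ z₀ ∈ S, ∃ r > 0, ∃ s H : ℂ → ℂ, Metric.ball z₀ r ⊆ S ∧
      DifferentiableOn ℂ s (Metric.ball z₀ r) ∧ (∀ z ∈ Metric.ball z₀ r, s z ^ 2 = R z) ∧
      ∀ z ∈ Metric.ball z₀ r, HasDerivAt H (h z / s z) z := fun z₀ hz₀ => by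
    obtain ⟨r, hr, hball⟩ := Metric.isOpen_iff.1 hSo z₀ hz₀
    obtain ⟨s, hs, hsR⟩ := exists_sqrt_on_ball (hRd.mono hball) (fun z hz => hR z (hball hz))
    have hs0 : ∀ z ∈ Metric.ball z₀ r, s z ≠ 0 := fun z hz h0 => hR z (hball hz) (by
      rw [← hsR z hz, h0]; simp)
    obtain ⟨H, hH⟩ := ((hh.mono hball).div hs hs0).isExactOn_ball
    exact ⟨r, hr, s, H, hball, hs, hsR, hH⟩
  -- Changing the path changes `J` by a period, which is zero; changing the root changes the sign of
  -- both `J` and `v`. So the product `J * v` depends on `z` alone.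
  have huniq : ∀ {z v J v' J'}, v ^ 2 = R z → v' ^ 2 = R z → Joined S R h (z, -v) (z, v) J →
      Joined S R h (z, -v') (z, v') J' → J * v = J' * v' := by
    intro z v J v' J' hv hv' hJ hJ'
    rcases sq_eq_sq_iff_eq_or_eq_neg.1 (hv.trans hv'.symm) with rfl | rfl
    · have := hper _ _ (hJ.trans hR hh.continuousOn hJ'.symm)
      rw [show J = J' by linear_combination this]
    · rw [neg_neg] at hJ
      have := hper _ _ (hJ.trans hR hh.continuousOn hJ')
      linear_combination (-v') * this
  have hsign : ∀ {z v v' J}, v ^ 2 = R z → v' ^ 2 = R z → Joined S R h (z, -v) (z, v) J →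
      ∃ J', Joined S R h (z, -v') (z, v') J' := by
    intro z v v' J hv hv' hJ
    rcases sq_eq_sq_iff_eq_or_eq_neg.1 (hv.trans hv'.symm) with rfl | rfl
    · exact ⟨J, hJ⟩
    · rw [neg_neg] at hJ
      exact ⟨-J, hJ.symm⟩
  let A : ℂ → Prop := fun z => ∃ v J, v ^ 2 = R z ∧ Joined S R h (z, -v) (z, v) J
  -- The set of points whose two lifts are joined is open and closed in the connected set `S`;
  -- `hflip` makes it nonempty.
  have hA : ∀ z ∈ S, A z := by
    have hmove : ∀ z₀ ∈ S, ∃ r > 0, Metric.ball z₀ r ⊆ S ∧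
        ∀ z ∈ Metric.ball z₀ r, ∀ z' ∈ Metric.ball z₀ r, A z → A z' := fun z₀ hz₀ => by
      obtain ⟨r, hr, s, H, hball, hs, hsR, hH⟩ := hloc z₀ hz₀
      refine ⟨r, hr, hball, fun z hz z' hz' ⟨v, J, hv, hJ⟩ => ?_⟩
      obtain ⟨J', hJ'⟩ := hsign hv (hsR z hz) hJ
      exact ⟨s z', _, hsR z' hz',
        hJ'.move hball hR hh.continuousOn hs.continuousOn hsR hH hz hz'⟩
    by_contra hcon
    push Not at hcon
    obtain ⟨z₁, hz₁, hAz₁⟩ := hcon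
    obtain ⟨z₂, v, J, hz₂, hv, hJ⟩ := hflip
    have ho : ∀ Q : ℂ → Prop, (∀ z₀ ∈ S, ∃ r > 0, Metric.ball z₀ r ⊆ S ∧
        ∀ z ∈ Metric.ball z₀ r, Q z₀ → Q z) → IsOpen {z | z ∈ S ∧ Q z} := fun Q hQ => by
      refine Metric.isOpen_iff.2 fun z₀ hz₀ => ?_
      obtain ⟨r, hr, hb, hq⟩ := hQ z₀ hz₀.1
      exact ⟨r, hr, fun z hz => ⟨hb hz, hq z hz hz₀.2⟩⟩
    obtain ⟨z, -, h1, h2⟩ := hSc {z | z ∈ S ∧ A z} {z | z ∈ S ∧ ¬ A z}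
      (ho A fun z₀ hz₀ => by
        obtain ⟨r, hr, hb, hm⟩ := hmove z₀ hz₀
        exact ⟨r, hr, hb, fun z hz hQ => hm z₀ (Metric.mem_ball_self hr) z hz hQ⟩)
      (ho (fun z => ¬ A z) fun z₀ hz₀ => by
        obtain ⟨r, hr, hb, hm⟩ := hmove z₀ hz₀
        exact ⟨r, hr, hb, fun z hz hQ hz' => hQ (hm z hz z₀ (Metric.mem_ball_self hr) hz')⟩)
      (fun z hz => by
        by_cases hAz : A z
        · exact Or.inl ⟨hz, hAz⟩
        · exact Or.inr ⟨hz, hAz⟩)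
      ⟨z₂, hz₂, hz₂, v, J, hv, hJ⟩ ⟨z₁, hz₁, hz₁, hAz₁⟩
    exact h2.2 h1.2
  choose! v J hv hJ using hA
  have hf : ∀ z ∈ S, ∀ v' J', v' ^ 2 = R z → Joined S R h (z, -v') (z, v') J' →
      J z * v z / 2 = J' * v' / 2 := fun z hz v' J' hv' hJ' => by
    rw [huniq (hv z hz) hv' (hJ z hz) hJ']
  -- The integral from one sheet to the other is twice the odd primitive, hence the factor `1 / 2`.
  refine ⟨fun z => J z * v z / 2, fun z₀ hz₀ => ?_⟩
  obtain ⟨r, hr, s, H, hball, hs, hsR, hH⟩ := hloc z₀ hz₀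
  have hzb : z₀ ∈ Metric.ball z₀ r := Metric.mem_ball_self hr
  have hnh : Metric.ball z₀ r ∈ 𝓝 z₀ := Metric.ball_mem_nhds z₀ hr
  obtain ⟨J₀, hJ₀⟩ := hsign (hv z₀ hz₀) (hsR z₀ hzb) (hJ z₀ hz₀)
  have hfeq : ∀ z ∈ Metric.ball z₀ r,
      J z * v z / 2 = (J₀ + 2 * (H z - H z₀)) * s z / 2 := fun z hz =>
    hf z (hball hz) _ _ (hsR z hz)
      (hJ₀.move hball hR hh.continuousOn hs.continuousOn hsR hH hzb hz)
  have hs0 : s z₀ ≠ 0 := fun h0 => hR z₀ hz₀ (by rw [← hsR z₀ hzb, h0]; simp)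
  have hsd : HasDerivAt s (deriv R z₀ / (2 * s z₀)) z₀ :=
    hasDerivAt_of_sq (hRd.differentiableAt (hSo.mem_nhds hz₀)).hasDerivAt
      (hs.differentiableAt hnh) (Filter.eventually_of_mem hnh hsR) hs0
  have hd := (((((hH z₀ hzb).sub_const (H z₀)).const_mul 2).const_add J₀).mul hsd).div_const 2
  have hd' := hd.congr_of_eventuallyEq (Filter.eventually_of_mem hnh hfeq)
  have e : (2 * (h z₀ / s z₀) * s z₀ +
      (J₀ + 2 * (H z₀ - H z₀)) * (deriv R z₀ / (2 * s z₀))) / 2 =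
      h z₀ + J z₀ * v z₀ / 2 * deriv R z₀ / (2 * R z₀) := by
    rw [hfeq z₀ hzb, ← hsR z₀ hzb]
    field_simp
  rw [← e]
  exact hd'

end Primitive

end Whitham

namespace Whitham

/-! ### Solutions away from the marked points are Laurent polynomials. -/

section Growth

theorem exists_norm_eval_le (P : ℂ[X]) {m : ℕ} (hm : P.natDegree ≤ m) :
    ∃ B : ℝ, 0 ≤ B ∧ ∀ z : ℂ, 1 ≤ ‖z‖ → ‖P.eval z‖ ≤ B * ‖z‖ ^ m := by
  refine ⟨∑ i ∈ Finset.range (m + 1), ‖P.coeff i‖, by positivity, fun z hz => ?_⟩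
  rw [eval_eq_sum_range' (Nat.lt_succ_of_le hm), Finset.sum_mul]
  refine (norm_sum_le _ _).trans (Finset.sum_le_sum fun i hi => ?_)
  rw [norm_mul, norm_pow]
  gcongr
  exact Nat.lt_succ_iff.1 (Finset.mem_range.1 hi)

theorem exists_le_norm_eval {Q : ℂ[X]} (hQ : Q ≠ 0) :
    ∃ b R : ℝ, 0 < b ∧ 1 ≤ R ∧ ∀ z : ℂ, R ≤ ‖z‖ → b * ‖z‖ ^ Q.natDegree ≤ ‖Q.eval z‖ := by
  have hl : 0 < ‖Q.leadingCoeff‖ := norm_pos_iff.2 (leadingCoeff_ne_zero.2 hQ)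
  rcases Nat.eq_zero_or_pos Q.natDegree with h0 | h0
  · refine ⟨‖Q.leadingCoeff‖, 1, hl, le_rfl, fun z _ => ?_⟩
    rw [eq_C_of_natDegree_eq_zero h0]
    simp
  obtain ⟨B, hB0, hB⟩ := exists_norm_eval_le Q.eraseLead (eraseLead_natDegree_le Q)
  refine ⟨‖Q.leadingCoeff‖ / 2, max 1 (2 * B / ‖Q.leadingCoeff‖), by positivity, le_max_left _ _,
    fun z hz => ?_⟩
  have h1 : 1 ≤ ‖z‖ := (le_max_left _ _).trans hz
  have h2 : 2 * B ≤ ‖z‖ * ‖Q.leadingCoeff‖ := by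
    rw [← div_le_iff₀ hl]; exact (le_max_right _ _).trans hz
  have h3 : Q.eval z = Q.leadingCoeff * z ^ Q.natDegree + Q.eraseLead.eval z := by
    have := congrArg (eval z) (eraseLead_add_C_mul_X_pow Q)
    simp only [eval_add, eval_mul, eval_C, eval_pow, eval_X] at this
    linear_combination -this
  have h4 := hB z h1
  have h5 : ‖z‖ ^ Q.natDegree = ‖z‖ ^ (Q.natDegree - 1) * ‖z‖ := by
    rw [← pow_succ, Nat.sub_add_cancel h0]
  have h6 : ‖Q.leadingCoeff * z ^ Q.natDegree‖ ≤ ‖Q.eval z‖ + ‖Q.eraseLead.eval z‖ := by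
    rw [show Q.leadingCoeff * z ^ Q.natDegree = Q.eval z - Q.eraseLead.eval z by rw [h3]; ring]
    exact norm_sub_le _ _
  rw [norm_mul, norm_pow] at h6
  have h7 : 2 * B * ‖z‖ ^ (Q.natDegree - 1) ≤ ‖Q.leadingCoeff‖ * ‖z‖ ^ Q.natDegree := by
    rw [h5]
    calc _ ≤ ‖z‖ * ‖Q.leadingCoeff‖ * ‖z‖ ^ (Q.natDegree - 1) := by gcongr
      _ = _ := by ring
  linarith

end Growth

section Exactness

/-- The polynomial `d` is the numerator over `λ ^ (n + j)`. At `λ = 0` only the last term on the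
left survives, with nonzero factor if `n > 0`; so `d` is divisible by `λ` and the pole order can be
lowered until `n = 0`. -/
theorem exists_descent {a p : ℂ[X]} {e j : ℕ} (ha : a.eval 0 ≠ 0) (n : ℕ) {d : ℂ[X]}
    (h : X * (2 * a * derivative d - derivative a * d) - C ((2 * (n + j) + e : ℕ) : ℂ) * a * d =
      X ^ n * p) :
    ∃ c : ℂ[X],
      X * (2 * a * derivative c - derivative a * c) - C ((2 * j + e : ℕ) : ℂ) * a * c = p := by
  induction n generalizing d with
  | zero => exact ⟨d, by simpa using h⟩
  | succ n ih =>
    have h0 : d.eval 0 = 0 := by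
      have h1 := congrArg (eval 0) h
      simp only [eval_sub, eval_mul, eval_X, zero_mul, eval_C, zero_sub, eval_pow, ne_eq,
        Nat.succ_ne_zero, not_false_eq_true, zero_pow, neg_eq_zero, mul_eq_zero, ha, or_false,
        Nat.cast_eq_zero] at h1
      rcases h1 with h1 | h1
      · omega
      · exact h1
    obtain ⟨d', rfl⟩ : X ∣ d := by
      rw [X_dvd_iff, coeff_zero_eq_eval_zero, h0]
    refine ih (d := d') (mul_left_cancel₀ (X_ne_zero (R := ℂ)) ?_)
    rw [← mul_assoc, ← pow_succ', ← h]
    simp only [derivative_mul, derivative_X]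
    push_cast
    simp only [map_add, map_mul, C_1, map_natCast, map_ofNat]
    ring

variable {a p : ℂ[X]} {e j : ℕ} {f : ℂ → ℂ}

/-- Solutions of the differential equation on the complement of the marked points are Laurent
polynomials. -/
theorem exists_polynomial_solution (ha : a ≠ 0) (hej : e + j ≤ 1)
    (ha0 : e + j = 1 → a.eval 0 ≠ 0)
    (hf : ∀ z, (e + j = 1 → z ≠ 0) → DifferentiableAt ℂ f z)
    (hode : ∀ z : ℂ, (e + j = 1 → z ≠ 0) →
      z ^ (2 * j + 1) * (2 * a.eval z * deriv f z - (derivative a).eval z * f z) -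
        z ^ (2 * j) * (e * a.eval z * f z) = z ^ (1 - e) * p.eval z) :
    ∃ c : ℂ[X],
      X * (2 * a * derivative c - derivative a * c) - C ((2 * j + e : ℕ) : ℂ) * a * c =
        X ^ (1 - e - j) * p := by
  obtain ⟨b, R₀, hb, hR₀, hlow⟩ := exists_le_norm_eval ha
  have hXa : (X * derivative a).natDegree ≤ a.natDegree := by
    rcases Nat.eq_zero_or_pos a.natDegree with h0 | h0
    · rw [eq_C_of_natDegree_eq_zero h0]; simp
    · refine natDegree_mul_le.trans ?_
      rw [natDegree_X]
      have := natDegree_derivative_lt h0.ne'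
      omega
  obtain ⟨B₁, hB₁0, hB₁⟩ := exists_norm_eval_le _ hXa
  obtain ⟨B₂, hB₂0, hB₂⟩ := exists_norm_eval_le p le_rfl
  have hne : ∀ z : ℂ, R₀ ≤ ‖z‖ → a.eval z ≠ 0 ∧ z ≠ 0 := fun z hz => by
    have hz0 : 0 < ‖z‖ := by linarith
    refine ⟨norm_pos_iff.1 (lt_of_lt_of_le (by positivity) (hlow z hz)), norm_pos_iff.1 hz0⟩
  -- Solved for `z * f'`, the equation has the coefficient `(z a' / a + e) / 2`, which is bounded
  -- near infinity, and near `0` if that is a marked point. This is what makes the singular points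
  -- regular.
  have hzf : ∀ z : ℂ, z ≠ 0 → a.eval z ≠ 0 → z * deriv f z =
      (z * (derivative a).eval z / a.eval z + e) / 2 * f z +
      z ^ (1 - e) * p.eval z / (2 * z ^ (2 * j) * a.eval z) := fun z hz haz => by
    have := hode z fun _ => hz
    rw [← this, pow_succ]
    field_simp
    ring
  obtain ⟨B, N, hBN⟩ := exists_growth_infty (f := f) (f' := deriv f) (R := R₀)
    (K := ⌈B₁ / b + e⌉₊) (M := B₂ / b) (n := 1 + p.natDegree) hR₀
    (fun z hz => (hf z fun _ => (hne z hz).2).hasDerivAt)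
    (fun z hz => by
      obtain ⟨haz, hz0⟩ := hne z hz
      have h1 : 1 ≤ ‖z‖ := hR₀.trans hz
      have hazn : 0 < ‖a.eval z‖ := norm_pos_iff.2 haz
      have h2 : ‖z * (derivative a).eval z / a.eval z‖ ≤ B₁ / b := by
        rw [norm_div, div_le_div_iff₀ hazn hb]
        have h3 := hB₁ z h1
        rw [eval_mul, eval_X] at h3
        calc _ ≤ B₁ * ‖z‖ ^ a.natDegree * b := by gcongr
          _ = B₁ * (b * ‖z‖ ^ a.natDegree) := by ring
          _ ≤ _ := by gcongr; exact hlow z hz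
      rw [hzf z hz0 haz]
      refine (norm_add_le _ _).trans (add_le_add ?_ ?_)
      · rw [norm_mul]
        gcongr
        refine le_trans ?_ (Nat.le_ceil _)
        rw [norm_div]
        refine (div_le_self (norm_nonneg _) (by simp)).trans ((norm_add_le _ _).trans ?_)
        gcongr
        simp
      · rw [norm_div, norm_mul, norm_mul, norm_mul, norm_pow, norm_pow]
        have h4 : ‖z‖ ^ (1 - e) ≤ ‖z‖ ^ 1 := pow_le_pow_right₀ h1 (by omega)
        have h5 : b ≤ ‖(2 : ℂ)‖ * ‖z‖ ^ (2 * j) * ‖a.eval z‖ := by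
          have h6 : b ≤ ‖a.eval z‖ := (le_mul_of_one_le_right hb.le (one_le_pow₀ h1)).trans
            (hlow z hz)
          have h7 : 1 ≤ ‖(2 : ℂ)‖ * ‖z‖ ^ (2 * j) := by
            have := one_le_pow₀ (n := 2 * j) h1
            simp only [Complex.norm_ofNat]; linarith
          nlinarith
        calc _ ≤ ‖z‖ ^ 1 * (B₂ * ‖z‖ ^ p.natDegree) / b := by
              gcongr
              exact hB₂ z h1
          _ = _ := by rw [pow_add]; ring)
  -- Clearing the pole at a marked point `0` leaves a polynomial. There the exponent is one more
  -- than the growth bound, so that the product tends to zero and the singularity is removable. The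
  -- bound `j ≤ M` ensures that the subtraction in the exponent `M + 1 - 2 * j - e` below does not
  -- truncate.
  obtain ⟨M, hMj, hM0, d, hd⟩ : ∃ M : ℕ, j ≤ M ∧ (e + j = 0 → M = 0) ∧ ∃ d : ℂ[X],
      ∀ z : ℂ, (e + j = 1 → z ≠ 0) → d.eval z = z ^ M * f z := by
    rcases Nat.eq_zero_or_pos (e + j) with h0 | h0
    · obtain ⟨d, hd⟩ := exists_polynomial_of_growth N (fun z => hf z fun h => by omega) hBN
      exact ⟨0, by omega, fun _ => rfl, d, fun z _ => by rw [← hd]; simp⟩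
    · have h1 : e + j = 1 := by omega
      obtain ⟨r, hr0, hr1, hra⟩ : ∃ r : ℝ, 0 < r ∧ r ≤ 1 ∧
          ∀ z ∈ Metric.closedBall (0 : ℂ) r, a.eval z ≠ 0 := by
        have := a.continuous.continuousAt.eventually_ne (ha0 h1)
        obtain ⟨δ, hδ, hb⟩ := Metric.eventually_nhds_iff_ball.1 this
        refine ⟨min (δ / 2) 1, by positivity, min_le_right _ _, fun z hz => hb z ?_⟩
        exact Metric.closedBall_subset_ball ((min_le_left _ _).trans_lt (by linarith)) hz
      obtain ⟨K₁, hK₁⟩ := (isCompact_closedBall (0 : ℂ) r).exists_bound_of_continuousOn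
        (f := fun z => (z * (derivative a).eval z / a.eval z + e) / 2)
        (((ContinuousOn.div (by fun_prop) (by fun_prop) hra).add continuousOn_const).div_const 2)
      obtain ⟨K₂, hK₂⟩ := (isCompact_closedBall (0 : ℂ) r).exists_bound_of_continuousOn
        (f := fun z => z ^ (1 - e) * p.eval z / (2 * a.eval z))
        (ContinuousOn.div (by fun_prop) (by fun_prop)
          fun z hz => mul_ne_zero two_ne_zero (hra z hz))
      obtain ⟨B', N', hB'⟩ := exists_growth_zero (f := f) (f' := deriv f) (r := r)
        (K := ⌈K₁⌉₊) (M := K₂) (n := 2 * j) hr0 hr1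
        (fun z hz _ => (hf z fun _ => hz).hasDerivAt)
        (fun z hz hzr => by
          have hzm : z ∈ Metric.closedBall (0 : ℂ) r := by simpa using hzr
          have haz := hra z hzm
          have h3 := hK₂ z hzm
          rw [hzf z hz haz]
          refine (mul_le_mul_of_nonneg_right (norm_add_le _ _) (by positivity)).trans ?_
          rw [add_mul, norm_mul]
          refine add_le_add ?_ ?_
          · gcongr
            exact (hK₁ z hzm).trans (Nat.le_ceil _)
          · rw [← norm_pow, ← norm_mul]
            refine le_trans (le_of_eq ?_) h3
            congr 1
            field_simp)
      have hent : Differentiable ℂ fun z => z ^ (N' + 1) * f z := by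
        have hd1 : DifferentiableOn ℂ (fun z => z ^ (N' + 1) * f z) (Set.univ \ {0}) :=
          fun z hz => ((differentiableAt_id.pow _).mul (hf z fun _ => hz.2)).differentiableWithinAt
        have hc : ContinuousAt (fun z => z ^ (N' + 1) * f z) 0 := by
          rw [ContinuousAt]
          simp only [ne_eq, Nat.succ_ne_zero, not_false_eq_true, zero_pow, zero_mul]
          have hlim : Filter.Tendsto (fun z : ℂ => |B'| * ‖z‖) (𝓝 0) (𝓝 0) := by
            have : Continuous fun z : ℂ => |B'| * ‖z‖ := by fun_prop
            simpa using this.tendsto 0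
          refine squeeze_zero_norm' ?_ hlim
          filter_upwards [Metric.closedBall_mem_nhds (0 : ℂ) hr0] with z hz
          by_cases hz0 : z = 0
          · simp [hz0]
          have h4 := hB' z hz0 (by simpa using hz)
          rw [norm_mul, norm_pow, pow_succ]
          calc _ = ‖f z‖ * ‖z‖ ^ N' * ‖z‖ := by ring
            _ ≤ |B'| * ‖z‖ := by gcongr; exact h4.trans (le_abs_self _)
        rw [← differentiableOn_univ]
        exact (Complex.differentiableOn_compl_singleton_and_continuousAt_iff
          Filter.univ_mem).1 ⟨hd1, hc⟩
      obtain ⟨d, hd⟩ := exists_polynomial_of_growth (N' + 1 + N) hent (B := B) (R := R₀)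
        (fun z hz => by
          rw [norm_mul, norm_pow, pow_add _ (N' + 1) N]
          calc _ ≤ ‖z‖ ^ (N' + 1) * (B * ‖z‖ ^ N) := by gcongr; exact hBN z hz
            _ = _ := by ring)
      exact ⟨N' + 1, by omega, fun h => by omega, d, fun z _ => (hd z).symm⟩
  have hdd : ∀ z : ℂ, z ≠ 0 →
      z * (derivative d).eval z = M * (z ^ M * f z) + z ^ M * (z * deriv f z) := fun z hz => by
    have h1 : HasDerivAt (fun z => z ^ M * f z) (M * z ^ (M - 1) * f z + z ^ M * deriv f z) z :=
      (hasDerivAt_pow M z).mul (hf z fun _ => hz).hasDerivAt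
    have h2 := (d.hasDerivAt z).unique (h1.congr_of_eventuallyEq (by
      filter_upwards [isOpen_ne.mem_nhds hz] with y hy using hd y fun _ => hy))
    rw [h2]
    rcases M with _ | M
    · simp
    · rw [Nat.add_sub_cancel, pow_succ]; ring
  have hpoly : X * (2 * a * derivative d - derivative a * d) -
      C ((2 * M + e : ℕ) : ℂ) * a * d = X ^ (M + 1 - 2 * j - e) * p := by
    refine eq_of_infinite_eval_eq _ _ (Set.infinite_of_finite_compl
      (s := {z : ℂ | _}) ((Set.finite_singleton (0 : ℂ)).subset fun z hz => ?_))
    by_contra hz0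
    refine hz ?_
    have hz0 : z ≠ 0 := hz0
    have h1 := hdd z hz0
    have h2 := hd z fun _ => hz0
    have h3 := hode z fun _ => hz0
    simp only [Set.mem_ofPred_eq, eval_sub, eval_mul, eval_X, eval_C, eval_pow, eval_ofNat]
    have hzp : z ^ (2 * j) ≠ 0 := pow_ne_zero _ hz0
    refine mul_left_cancel₀ hzp ?_
    have hexp : z ^ (2 * j) * (z ^ (M + 1 - 2 * j - e) * p.eval z) =
        z ^ M * (z ^ (1 - e) * p.eval z) := by
      rw [← mul_assoc, ← mul_assoc, ← pow_add, ← pow_add]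
      congr 2
      rcases Nat.eq_zero_or_pos (e + j) with h0 | h0
      · have := hM0 h0; omega
      · omega
    rw [hexp, ← h3, h2]
    push_cast
    rw [pow_succ]
    linear_combination (z ^ (2 * j) * (2 * a.eval z)) * h1
  rcases Nat.eq_zero_or_pos (e + j) with h0 | h0
  · have hM := hM0 h0
    obtain rfl : e = 0 := by omega
    obtain rfl : j = 0 := by omega
    subst hM
    exact ⟨d, by simpa using hpoly⟩
  · have h1 : e + j = 1 := by omega
    have h2 : 1 - e - j = 0 := by omega
    rw [h2, pow_zero, one_mul]
    obtain ⟨n, rfl⟩ := Nat.exists_eq_add_of_le hMj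
    refine exists_descent (ha0 h1) n (d := d) ?_
    rw [show n + j = j + n by ring, hpoly]
    congr 2
    omega

end Exactness

end Whitham

namespace Whitham

/-! ### Extension over the discs and exactness. -/

section Gluing

/-- A solution of `2 R f' - R' f = q` outside of a disc which contains only one simple zero of `R`
coincides with the holomorphic solution on the disc. -/
theorem eq_local_solution {w ε : ℂ} {r δ : ℝ} {R u q f C C' : ℂ → ℂ} (hr : 0 < r)
    (hu : DifferentiableOn ℂ u (Metric.ball w (r + δ)))
    (hu0 : ∀ z ∈ Metric.ball w (r + δ), u z ≠ 0) (hε : ε ∈ Metric.ball w r)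
    (hR : ∀ z ∈ Metric.ball w (r + δ), R z = (z - ε) * u z)
    (hf : ∀ z ∈ Metric.ball w (r + δ), r < dist z w → DifferentiableAt ℂ f z ∧
      2 * R z * deriv f z - deriv R z * f z = q z)
    (hC : ∀ z ∈ Metric.ball w (r + δ), HasDerivAt C (C' z) z ∧
      2 * R z * C' z - deriv R z * C z = q z) :
    ∀ z ∈ Metric.ball w (r + δ), r < dist z w → f z = C z := by
  intro z hz hzr
  set ρ := dist z w with hρ
  have hρ0 : 0 < ρ := hr.trans hzr
  have hρδ : ρ < r + δ := hz
  have hsph : ∀ y ∈ Metric.sphere w ρ, y ∈ Metric.ball w (r + δ) ∧ r < dist y w := fun y hy => by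
    rw [Metric.mem_sphere] at hy
    rw [Metric.mem_ball, hy]; exact ⟨hρδ, hzr⟩
  have hR0 : ∀ y ∈ Metric.sphere w ρ, R y ≠ 0 := fun y hy h0 => by
    rw [hR y (hsph y hy).1] at h0
    rcases mul_eq_zero.1 h0 with h | h
    · rw [sub_eq_zero] at h
      have h1 := (hsph y hy).2
      rw [h] at h1
      exact absurd hε (not_lt.2 h1.le)
    · exact hu0 y (hsph y hy).1 h
  -- The difference of two solutions solves the homogeneous equation, whose solutions are constant
  -- multiples of a square root of `R`.
  have hQ : ∀ y ∈ Metric.sphere w ρ, HasDerivAt (fun y => (f y - C y) ^ 2 / R y) 0 y := by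
    intro y hy
    obtain ⟨h1, h2⟩ := hsph y hy
    obtain ⟨hf1, hf2⟩ := hf y h1 h2
    obtain ⟨hC1, hC2⟩ := hC y h1
    have hRd : DifferentiableAt ℂ R y := by
      have hnh := Metric.isOpen_ball.mem_nhds h1
      have : DifferentiableAt ℂ (fun z => (z - ε) * u z) y :=
        (differentiableAt_id.sub_const ε).mul (hu.differentiableAt hnh)
      exact this.congr_of_eventuallyEq (Filter.eventually_of_mem hnh hR)
    have h3 := ((hf1.hasDerivAt.sub hC1).pow 2).div hRd.hasDerivAt (hR0 y hy)
    have e : ((2 : ℕ) * (f y - C y) ^ (2 - 1) * (deriv f y - C' y) * R y -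
        (f y - C y) ^ 2 * deriv R y) / R y ^ 2 = 0 := by
      rw [div_eq_zero_iff]
      left
      push_cast
      linear_combination (f y - C y) * (hf2 - hC2)
    rw [← e]
    exact h3
  have hconst : ∀ y ∈ Metric.sphere w ρ,
      (f y - C y) ^ 2 / R y = (f z - C z) ^ 2 / R z := by
    have hd : ∀ t : ℝ, HasDerivAt (fun t => (f (circleMap w ρ t) - C (circleMap w ρ t)) ^ 2 /
        R (circleMap w ρ t)) 0 t := fun t => by
      have := (hQ _ (circleMap_mem_sphere w hρ0.le t)).scomp t (hasDerivAt_circleMap w ρ t)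
      rw [smul_zero] at this
      exact this
    have hcst : ∀ t t' : ℝ, _ := is_const_of_deriv_eq_zero
      (fun t => (hd t).differentiableAt) (fun t => (hd t).deriv)
    intro y hy
    have hsurj : ∀ y ∈ Metric.sphere w ρ, ∃ t, circleMap w ρ t = y := fun y hy => by
      rw [← abs_of_pos hρ0, ← range_circleMap] at hy
      exact hy
    obtain ⟨t, rfl⟩ := hsurj y hy
    obtain ⟨t', ht'⟩ := hsurj z (Metric.mem_sphere.2 rfl)
    rw [← ht']
    exact hcst t t'
  -- If the constant `κ` were nonzero, `(f - C) / √κ` would be a continuous root of `R` on a circle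
  -- that surrounds only one, simple, zero of `R`.
  by_contra hne
  have hD : f z - C z ≠ 0 := sub_ne_zero.2 hne
  obtain ⟨F, hF, hF0, hFR⟩ := exists_sqrt_on_sphere hρδ hu hu0
    (Metric.ball_subset_ball hzr.le hε) hR
  have hRz : R z ≠ 0 := hR0 z (Metric.mem_sphere.2 rfl)
  set κ := (f z - C z) ^ 2 / R z with hκ
  have hκ0 : κ ≠ 0 := div_ne_zero (pow_ne_zero 2 hD) hRz
  have hk : (κ ^ (1 / 2 : ℂ)) ^ 2 = κ := by simp
  refine not_exists_sqrt_on_sphere hρ0 (s := fun y => (f y - C y) / κ ^ (1 / 2 : ℂ)) ?_ hF hF0 ?_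
  · intro y hy
    obtain ⟨h1, h2⟩ := hsph y hy
    exact (((hf y h1 h2).1.continuousAt.sub (hC y h1).1.continuousAt).div_const
      _).continuousWithinAt
  · intro y hy
    rw [div_pow, hk, ← hFR y hy, div_eq_iff hκ0, ← hconst y hy, mul_comm,
      div_mul_cancel₀ _ (hR0 y hy)]

/-- The complement of the discs and of the marked point. -/
def region (Z : Finset ℂ) (r : ℝ) (m : Prop) : Set ℂ :=
  {z | (∀ w ∈ Z, r < dist z w) ∧ (m → z ≠ 0)}

variable {Z : Finset ℂ} {r : ℝ} {m : Prop}

theorem region_facts (hr : 0 < r)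
    (hd : ∀ w ∈ Z, ∀ w' ∈ Z, w ≠ w' → Disjoint (Metric.closedBall w r) (Metric.closedBall w' r))
    (hm : m → ∀ w ∈ Z, (0 : ℂ) ∉ Metric.closedBall w r) :
    IsPreconnected (region Z r m) ∧ ∃ δ > 0, (∀ w ∈ Z, ∀ w' ∈ Z, w ≠ w' →
      Disjoint (Metric.closedBall w (r + δ)) (Metric.closedBall w' (r + δ))) ∧
      (m → ∀ w ∈ Z, (0 : ℂ) ∉ Metric.closedBall w (r + δ)) := by
  classical
  by_cases h : m
  · have h0 : ∀ w ∈ Z, w ≠ 0 := fun w hw hw0 => hm h w hw (by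
      rw [hw0]; exact Metric.mem_closedBall_self hr.le)
    -- The marked point is counted as a disc of radius `0`, which brings both cases under the same
    -- connectedness lemma.
    set ρ : ℂ → ℝ := fun w => if w = 0 then 0 else r with hρ
    have hρ0 : ρ 0 = 0 := if_pos rfl
    have hρw : ∀ w ∈ Z, ρ w = r := fun w hw => if_neg (h0 w hw)
    have hnn : ∀ w ∈ insert 0 Z, 0 ≤ ρ w := fun w _ => by
      simp only [hρ]; split_ifs <;> linarith
    have h0Z : (0 : ℂ) ∉ Z := fun hZ => h0 0 hZ rfl
    have hd0 : ∀ w ∈ Z, Disjoint (Metric.closedBall 0 (ρ 0)) (Metric.closedBall w (ρ w)) :=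
      fun w hw => by
        rw [hρ0, Metric.closedBall_zero, Set.disjoint_singleton_left, hρw w hw]
        exact hm h w hw
    have hd' : ∀ w ∈ insert 0 Z, ∀ w' ∈ insert 0 Z, w ≠ w' →
        Disjoint (Metric.closedBall w (ρ w)) (Metric.closedBall w' (ρ w')) := by
      intro w hw w' hw' hne
      rcases Finset.mem_insert.1 hw with rfl | hw <;> rcases Finset.mem_insert.1 hw' with rfl | hw'
      · exact (hne rfl).elim
      · exact hd0 w' hw'
      · exact (hd0 w hw).symm
      · rw [hρw w hw, hρw w' hw']; exact hd w hw w' hw' hne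
    refine ⟨?_, ?_⟩
    · convert isPreconnected_compl_closedBalls hnn hd' using 1
      ext z
      simp only [region, Set.mem_ofPred_eq, Finset.forall_mem_insert, hρ0, dist_pos]
      refine ⟨fun hz => ⟨hz.2 h, fun w hw => by rw [hρw w hw]; exact hz.1 w hw⟩,
        fun hz => ⟨fun w hw => by rw [← hρw w hw]; exact hz.2 w hw, fun _ => hz.1⟩⟩
    · obtain ⟨δ, hδ, -, h2⟩ := exists_enlarge hnn hd' ∅ (by simp)
      refine ⟨δ, hδ, fun w hw w' hw' hne => ?_, fun _ w hw hw0 => ?_⟩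
      · have := h2 w (Finset.mem_insert_of_mem hw) w' (Finset.mem_insert_of_mem hw') hne
        rwa [hρw w hw, hρw w' hw'] at this
      · have := h2 w (Finset.mem_insert_of_mem hw) 0 (Finset.mem_insert_self _ _) (h0 w hw)
        rw [hρw w hw] at this
        exact Set.disjoint_left.1 this hw0 (Metric.mem_closedBall_self (by rw [hρ0]; linarith))
  · refine ⟨?_, ?_⟩
    · convert isPreconnected_compl_closedBalls (ρ := fun _ => r) (fun _ _ => hr.le) hd using 1
      ext z; simp [region, h]
    · obtain ⟨δ, hδ, -, h2⟩ := exists_enlarge (ρ := fun _ => r) (fun _ _ => hr.le) hd ∅ (by simp)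
      exact ⟨δ, hδ, h2, fun h' => (h h').elim⟩

/-- If the integrals of the form `p / (2 λ ^ (2 j) R ν) dλ` along all closed paths outside of the
discs vanish, then it is the differential of `c / (λ ^ j ν)` for a polynomial `c`. -/
theorem exists_polynomial_of_periods (hr : 0 < r)
    (hd : ∀ w ∈ Z, ∀ w' ∈ Z, w ≠ w' → Disjoint (Metric.closedBall w r) (Metric.closedBall w' r))
    {ε : ℂ → ℂ} (hε : ∀ w ∈ Z, ε w ∈ Metric.ball w r) {l : ℂ} (hl : l ≠ 0) {a p : ℂ[X]}
    (ha : a = C l * ∏ w ∈ Z, (X - C (ε w))) {e j : ℕ} (hej : e + j ≤ 1)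
    (hm : e + j = 1 → ∀ w ∈ Z, (0 : ℂ) ∉ Metric.closedBall w r) (hZ : Z.Nonempty ∨ e = 1)
    {R h : ℂ → ℂ} (hRdef : ∀ z, R z = z ^ e * a.eval z)
    (hhdef : ∀ z, h z = p.eval z / (2 * z ^ (2 * j) * R z))
    (hper : ∀ q J, Joined (region Z r (e + j = 1)) R h q q J → J = 0) :
    ∃ c : ℂ[X],
      X * (2 * a * derivative c - derivative a * c) - C ((2 * j + e : ℕ) : ℂ) * a * c =
        X ^ (1 - e - j) * p := by
  classical
  obtain ⟨hconn, δ, hδ, hdδ, hmδ⟩ := region_facts hr hd hm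
  set S := region Z r (e + j = 1) with hS
  have hSo : IsOpen S := by
    have : S = (⋂ w ∈ Z, {z | r < dist z w}) ∩ {z | e + j = 1 → z ≠ 0} := by
      ext z; simp [hS, region]
    rw [this]
    refine IsOpen.inter (isOpen_biInter_finset fun w _ =>
      isOpen_lt continuous_const (by fun_prop)) ?_
    by_cases h1 : e + j = 1
    · simpa [h1] using isOpen_ne
    · simp [h1]
  have haev : ∀ z, a.eval z = l * ∏ w ∈ Z, (z - ε w) := fun z => by
    rw [ha]; simp [eval_prod]
  have ha0 : a ≠ 0 := by
    rw [ha]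
    exact mul_ne_zero (C_ne_zero.2 hl) (Finset.prod_ne_zero_iff.2 fun w _ => X_sub_C_ne_zero _)
  have hane : ∀ z, (∀ w ∈ Z, z ≠ ε w) → a.eval z ≠ 0 := fun z hz => by
    rw [haev]
    exact mul_ne_zero hl (Finset.prod_ne_zero_iff.2 fun w hw => sub_ne_zero.2 (hz w hw))
  have hpow : ∀ z : ℂ, (e + j = 1 → z ≠ 0) → z ^ e ≠ 0 ∧ z ^ (2 * j) ≠ 0 := fun z hz => by
    constructor
    · rcases Nat.eq_zero_or_pos e with h0 | h0
      · simp [h0]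
      · exact pow_ne_zero _ (hz (by omega))
    · rcases Nat.eq_zero_or_pos j with h0 | h0
      · simp [h0]
      · exact pow_ne_zero _ (hz (by omega))
  have hεlt : ∀ w ∈ Z, dist (ε w) w < r := hε
  have hR0 : ∀ z ∈ S, R z ≠ 0 := fun z hz => by
    rw [hRdef]
    refine mul_ne_zero (hpow z hz.2).1 (hane z fun w hw h => ?_)
    have := hz.1 w hw
    rw [h] at this
    linarith [hεlt w hw]
  have hRd : ∀ z, HasDerivAt R (e * z ^ (e - 1) * a.eval z + z ^ e * (derivative a).eval z) z :=
    fun z => by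
      rw [show R = fun z => z ^ e * a.eval z from funext hRdef]
      exact (hasDerivAt_pow e z).mul (a.hasDerivAt z)
  have hRdiff : Differentiable ℂ R := fun z => (hRd z).differentiableAt
  have hh : DifferentiableOn ℂ h S := by
    rw [show h = fun z => p.eval z / (2 * z ^ (2 * j) * R z) from funext hhdef]
    refine DifferentiableOn.div p.differentiable.differentiableOn
      (((differentiable_const _).mul (differentiable_id.pow _)).mul hRdiff).differentiableOn ?_
    exact fun z hz => mul_ne_zero (mul_ne_zero two_ne_zero (hpow z hz.2).2) (hR0 z hz)
  set q : ℂ → ℂ := fun z => p.eval z / z ^ (2 * j) with hq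
  set u : ℂ → ℂ → ℂ := fun w z => z ^ e * (l * ∏ w' ∈ Z.erase w, (z - ε w')) with hu
  have hud : ∀ w, Differentiable ℂ (u w) := fun w => by
    refine (differentiable_id.pow _).mul ((differentiable_const _).mul ?_)
    exact Differentiable.fun_finsetProd fun w' _ => differentiable_id.sub_const _
  have hRu : ∀ w ∈ Z, ∀ z, R z = (z - ε w) * u w z := fun w hw z => by
    rw [hRdef, haev, ← Finset.mul_prod_erase Z _ hw]; simp only [hu]; ring
  have hball0 : ∀ w ∈ Z, ∀ z ∈ Metric.ball w (r + δ), e + j = 1 → z ≠ 0 :=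
    fun w hw z hz h1 h0 => hmδ h1 w hw (by rw [← h0]; exact Metric.ball_subset_closedBall hz)
  have hballne : ∀ w ∈ Z, ∀ z ∈ Metric.ball w (r + δ), ∀ w' ∈ Z, w' ≠ w → r < dist z w' :=
    fun w hw z hz w' hw' hne => by
      by_contra hlt
      exact Set.disjoint_left.1 (hdδ w hw w' hw' hne.symm) (Metric.ball_subset_closedBall hz)
        (Metric.closedBall_subset_closedBall (by linarith) (not_lt.1 hlt))
  have hu0 : ∀ w ∈ Z, ∀ z ∈ Metric.ball w (r + δ), u w z ≠ 0 := fun w hw z hz => by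
    refine mul_ne_zero (hpow z (hball0 w hw z hz)).1 (mul_ne_zero hl
      (Finset.prod_ne_zero_iff.2 fun w' hw' => ?_))
    rw [Finset.mem_erase] at hw'
    rw [sub_ne_zero]
    intro h0
    have := hballne w hw z hz w' hw'.2 hw'.1
    rw [h0] at this
    linarith [hεlt w' hw'.2]
  have hann : ∀ w ∈ Z, ∀ z ∈ Metric.ball w (r + δ), r < dist z w → z ∈ S := fun w hw z hz hzr =>
    ⟨fun w' hw' => by
      by_cases h1 : w' = w
      · rw [h1]; exact hzr
      · exact hballne w hw z hz w' hw' h1, hball0 w hw z hz⟩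
  -- The sheets are interchanged along a circle of radius `r + δ / 2` around one of the discs. If
  -- there are no discs, then `e = 1`, and the unit circle around the branch point `0` does it.
  have hflip : ∃ z v J, z ∈ S ∧ v ^ 2 = R z ∧ Joined S R h (z, -v) (z, v) J := by
    rcases Finset.eq_empty_or_nonempty Z with hZe | ⟨w, hw⟩
    · have he : e = 1 := by
        rcases hZ with h1 | h1
        · rw [hZe] at h1; exact absurd h1 Finset.not_nonempty_empty
        · exact h1
      refine exists_joined_neg (w := 0) one_pos (F := fun _ => l ^ (1 / 2 : ℂ)) ?_
        continuousOn_const ?_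
      · intro z hz
        refine ⟨fun w hw => by rw [hZe] at hw; simp at hw, fun _ h0 => ?_⟩
        rw [h0] at hz; simp at hz
      · intro z _
        rw [hRdef, haev, hZe, he]
        simp
    · obtain ⟨F, hF, -, hFR⟩ := exists_sqrt_on_sphere (ρ := r + δ / 2) (r := r + δ)
        (by linarith) (hud w).differentiableOn (hu0 w hw)
        (Metric.ball_subset_ball (by linarith) (hε w hw)) (fun z _ => hRu w hw z)
      refine exists_joined_neg (by linarith) (fun z hz => ?_) hF hFR
      rw [Metric.mem_sphere] at hz
      exact hann w hw z (by rw [Metric.mem_ball, hz]; linarith) (by rw [hz]; linarith)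
  obtain ⟨f, hf⟩ := exists_primitive_of_periods hSo hconn hRdiff.differentiableOn hR0 hh hper hflip
  have hfode : ∀ z ∈ S, DifferentiableAt ℂ f z ∧
      2 * R z * deriv f z - deriv R z * f z = q z := fun z hz => by
    refine ⟨(hf z hz).differentiableAt, ?_⟩
    rw [(hf z hz).deriv, hhdef, hq]
    have h1 := hR0 z hz
    have h2 := (hpow z hz.2).2
    field_simp
    ring
  have hqd : ∀ w ∈ Z, DifferentiableOn ℂ q (Metric.ball w (r + δ)) := fun w hw =>
    DifferentiableOn.div p.differentiable.differentiableOn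
      (differentiable_id.pow _).differentiableOn fun z hz => (hpow z (hball0 w hw z hz)).2
  have hloc : ∀ w ∈ Z, ∃ C C' : ℂ → ℂ, ∀ z ∈ Metric.ball w (r + δ), HasDerivAt C (C' z) z ∧
      2 * R z * C' z - deriv R z * C z = q z := fun w hw =>
    exists_local_solution (hud w).differentiableOn (hu0 w hw)
      (Metric.ball_subset_ball (by linarith) (hε w hw)) (fun z _ => hRu w hw z) (hqd w hw)
  choose! L L' hL using hloc
  have hagree : ∀ w ∈ Z, ∀ z ∈ Metric.ball w (r + δ), r < dist z w → f z = L w z := fun w hw =>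
    eq_local_solution hr (hud w).differentiableOn (hu0 w hw) (hε w hw) (fun z _ => hRu w hw z)
      (fun z hz hzr => hfode z (hann w hw z hz hzr)) (hL w hw)
  -- The function `f` is continued by the local solutions. The choice of the disc is unique by
  -- disjointness, and on the annulus between `r` and `r + δ` both definitions agree, so the result
  -- is holomorphic.
  let g : ℂ → ℂ := fun z => if hz : ∃ w ∈ Z, dist z w ≤ r then L hz.choose z else f z
  have hgS : ∀ z ∈ S, g z = f z := fun z hz =>
    dif_neg fun ⟨w, hw, h1⟩ => absurd h1 (not_le.2 (hz.1 w hw))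
  have hgB : ∀ w ∈ Z, ∀ z ∈ Metric.ball w (r + δ), g z = L w z := fun w hw z hz => by
    rcases le_or_gt (dist z w) r with h1 | h1
    · have hex : ∃ w ∈ Z, dist z w ≤ r := ⟨w, hw, h1⟩
      have h2 : hex.choose = w := by
        by_contra hne
        exact absurd hex.choose_spec.2
          (not_le.2 (hballne w hw z hz _ hex.choose_spec.1 hne))
      simp only [g]
      rw [dif_pos hex, h2]
    · rw [hgS z (hann w hw z hz h1), hagree w hw z hz h1]
  have hg : ∀ z, (e + j = 1 → z ≠ 0) → DifferentiableAt ℂ g z ∧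
      2 * R z * deriv g z - deriv R z * g z = q z := fun z hz => by
    by_cases hzS : z ∈ S
    · have h1 : g =ᶠ[𝓝 z] f := Filter.eventually_of_mem (hSo.mem_nhds hzS) hgS
      obtain ⟨h2, h3⟩ := hfode z hzS
      exact ⟨h2.congr_of_eventuallyEq h1, by rw [h1.deriv_eq, hgS z hzS, h3]⟩
    · obtain ⟨w, hw, hzw⟩ : ∃ w ∈ Z, dist z w ≤ r := by
        by_contra hcon
        push Not at hcon
        exact hzS ⟨hcon, hz⟩
      have hzb : z ∈ Metric.ball w (r + δ) := by rw [Metric.mem_ball]; linarith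
      have h1 : g =ᶠ[𝓝 z] L w :=
        Filter.eventually_of_mem (Metric.isOpen_ball.mem_nhds hzb) (hgB w hw)
      obtain ⟨h2, h3⟩ := hL w hw z hzb
      exact ⟨h2.differentiableAt.congr_of_eventuallyEq h1,
        by rw [h1.deriv_eq, h2.deriv, hgB w hw z hzb, h3]⟩
  refine exists_polynomial_solution ha0 hej (fun h1 => hane 0 fun w hw h0 => ?_)
    (fun z hz => (hg z hz).1) (fun z hz => ?_)
  · refine hm h1 w hw ?_
    rw [h0]; exact Metric.ball_subset_closedBall (hε w hw)
  · have h1 := (hg z hz).2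
    have h2 := (hpow z hz).2
    rw [(hRd z).deriv, hRdef, hq, eq_div_iff h2] at h1
    rw [← h1]
    have he : e = 0 ∨ e = 1 := by omega
    rcases he with rfl | rfl
    · push_cast; ring
    · push_cast; simp only [Nat.sub_self, pow_zero, pow_one, one_mul, mul_one]; ring

end Gluing

end Whitham

namespace Whitham

/-! ### Roots of nearby polynomials, coefficient vectors, and the description of `T`. -/

section RootCount

/-- If `B / A` has positive real part on a circle around a zero of `A`, then `B` has a zero inside
of the circle. -/
theorem exists_root_of_re_pos {A B : ℂ[X]} {w : ℂ} {r : ℝ} (hr : 0 < r) (hA : A.eval w = 0)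
    (h : ∀ z ∈ Metric.sphere w r, 0 < (B.eval z / A.eval z).re) :
    ∃ ε ∈ Metric.ball w r, B.eval ε = 0 := by
  -- Otherwise `exp (-(A / B))` is holomorphic on the disc, of modulus less than `1` on the circle,
  -- but equal to `1` at the zero `w` of `A`, against the maximum principle.
  by_contra hcon
  push Not at hcon
  have hB : ∀ z ∈ Metric.closedBall w r, B.eval z ≠ 0 := fun z hz h0 => by
    rcases (Metric.mem_closedBall.1 hz).lt_or_eq with h1 | h1
    · exact hcon z h1 h0
    · have := h z h1
      rw [h0] at this; simp at this
  have hcl : closure (Metric.ball w r) = Metric.closedBall w r := closure_ball w hr.ne'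
  have hd : DiffContOnCl ℂ (fun z => Complex.exp (-(A.eval z / B.eval z))) (Metric.ball w r) := by
    refine DifferentiableOn.diffContOnCl ?_
    rw [hcl]
    exact ((A.differentiable.differentiableOn.div B.differentiable.differentiableOn hB).neg).cexp
  have hlt : ∀ z ∈ Metric.sphere w r, ‖Complex.exp (-(A.eval z / B.eval z))‖ < 1 := by
    intro z hz
    have h1 := h z hz
    rw [Complex.norm_exp, Real.exp_lt_one_iff, Complex.neg_re, neg_lt_zero,
      ← inv_div, Complex.inv_re]
    refine div_pos h1 (Complex.normSq_pos.2 fun h0 => ?_)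
    rw [h0] at h1; simp at h1
  have hcont : ContinuousOn (fun z => ‖Complex.exp (-(A.eval z / B.eval z))‖)
      (Metric.sphere w r) := by
    have := hd.continuousOn
    rw [hcl] at this
    exact (this.mono Metric.sphere_subset_closedBall).norm
  obtain ⟨y, hy, hmax⟩ := (isCompact_sphere w r).exists_isMaxOn
    (NormedSpace.sphere_nonempty.2 hr.le) hcont
  have h2 := Complex.norm_le_of_forall_mem_frontier_norm_le Metric.isBounded_ball hd
    (fun z hz => by
      rw [frontier_ball w hr.ne'] at hz
      exact hmax hz) (subset_closure (Metric.mem_ball_self hr))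
  simp only [hA, zero_div, neg_zero, Complex.exp_zero, norm_one] at h2
  exact absurd (hlt y hy) (not_lt.2 h2)

/-- A polynomial with a zero in each of `n` disjoint discs, `n` its degree, is a product. -/
theorem eq_C_mul_prod {B : ℂ[X]} (hB : B ≠ 0) {Z : Finset ℂ} {ε : ℂ → ℂ}
    (hinj : Set.InjOn ε Z) (hε : ∀ w ∈ Z, B.eval (ε w) = 0) (hcard : B.natDegree ≤ Z.card) :
    ∃ l : ℂ, l ≠ 0 ∧ B = C l * ∏ w ∈ Z, (X - C (ε w)) := by
  have hdvd : ∏ w ∈ Z, (X - C (ε w)) ∣ B := by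
    refine Finset.prod_dvd_of_coprime (fun w hw w' hw' hne => ?_)
      fun w hw => dvd_iff_isRoot.2 (hε w hw)
    exact isCoprime_X_sub_C_of_isUnit_sub (sub_ne_zero.2 fun h => hne (hinj hw hw' h)).isUnit
  obtain ⟨Q, hQ⟩ := hdvd
  have hQ0 : Q ≠ 0 := fun h => hB (by rw [hQ, h, mul_zero])
  have hP0 : ∏ w ∈ Z, (X - C (ε w)) ≠ 0 :=
    Finset.prod_ne_zero_iff.2 fun w _ => X_sub_C_ne_zero _
  have hdeg : B.natDegree = Z.card + Q.natDegree := by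
    rw [hQ, natDegree_mul hP0 hQ0, natDegree_prod_of_monic _ _ fun w _ => monic_X_sub_C _]
    simp
  have hQc := eq_C_of_natDegree_eq_zero (show Q.natDegree = 0 by omega)
  refine ⟨Q.coeff 0, fun h => hQ0 (by rw [hQc, h, C_0]), ?_⟩
  rw [← hQc, mul_comm]; exact hQ

end RootCount

section ToPoly

variable {n : ℕ}

theorem coeff_toPoly (v : Fin n → ℂ) (i : ℕ) :
    (toPoly v).coeff i = if h : i < n then v ⟨i, h⟩ else 0 := by
  rw [toPoly, finset_sum_coeff]
  simp only [coeff_C_mul_X_pow]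
  split_ifs with h
  · rw [Finset.sum_eq_single ⟨i, h⟩]
    · simp
    · intro j _ hj
      exact if_neg fun hij => hj (Fin.ext hij.symm)
    · simp
  · exact Finset.sum_eq_zero fun j _ => if_neg fun hij => h (by rw [hij]; exact j.2)

theorem coeff_toPoly_fin (v : Fin n → ℂ) (i : Fin n) : (toPoly v).coeff i = v i := by
  rw [coeff_toPoly, dif_pos i.2]

theorem coeff_toPoly_last (v : Fin (n + 1) → ℂ) : (toPoly v).coeff n = v (Fin.last n) :=
  coeff_toPoly_fin v (Fin.last n)

theorem natDegree_toPoly_le (v : Fin (n + 1) → ℂ) : (toPoly v).natDegree ≤ n := by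
  rw [natDegree_le_iff_coeff_eq_zero]
  intro i hi
  rw [coeff_toPoly, dif_neg (by omega)]

/-- The coefficients of a polynomial. -/
noncomputable def ofPoly (n : ℕ) (p : ℂ[X]) : Fin n → ℂ := fun i => p.coeff i

theorem toPoly_ofPoly {p : ℂ[X]} (hp : p.natDegree ≤ n) : toPoly (ofPoly (n + 1) p) = p := by
  ext i
  rw [coeff_toPoly]
  split_ifs with h
  · rfl
  · rw [coeff_eq_zero_of_natDegree_lt (by omega)]

theorem toPoly_injective : Function.Injective (toPoly : (Fin n → ℂ) → ℂ[X]) := fun v w h => by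
  ext i
  rw [← coeff_toPoly_fin v i, h, coeff_toPoly_fin]

theorem toPoly_add (v w : Fin n → ℂ) : toPoly (v + w) = toPoly v + toPoly w := by
  simp [toPoly, add_mul, Finset.sum_add_distrib]

theorem toPoly_smul (s : ℂ) (v : Fin n → ℂ) : toPoly (s • v) = C s * toPoly v := by
  simp [toPoly, Finset.mul_sum, mul_assoc]

theorem eval_toPoly (v : Fin n → ℂ) (z : ℂ) : (toPoly v).eval z = ∑ i, v i * z ^ (i : ℕ) := by
  simp [toPoly, eval_finset_sum]

end ToPoly

section SpaceT

variable {α β g : ℕ} {ρ : Reality} {x : Coeffs α β g}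

theorem natDegree_polyA_le : (polyA x).natDegree ≤ degA α β g := natDegree_toPoly_le _

theorem natDegree_polyB_le : (polyB x).natDegree ≤ degB α β g := natDegree_toPoly_le _

theorem coeff_polyA_top : (polyA x).coeff (degA α β g) = x.1 (Fin.last _) := coeff_toPoly_last _

theorem coeff_polyB_top : (polyB x).coeff (degB α β g) = x.2 (Fin.last _) := coeff_toPoly_last _

theorem Normalised.top_ne_zero (h : Normalised ρ x) : x.1 (Fin.last _) ≠ 0 := by
  cases ρ
  · have : x.1 (Fin.last _) = 1 := h
    rw [this]; exact one_ne_zero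
  · exact norm_ne_zero_iff.1 (by rw [h.1]; exact one_ne_zero)
  · exact norm_ne_zero_iff.1 (by rw [h.1]; exact one_ne_zero)

namespace IsSpectralData

theorem natDegree_A (h : IsSpectralData ρ x) : (polyA x).natDegree = degA α β g :=
  le_antisymm natDegree_polyA_le (le_natDegree_of_ne_zero (by
    rw [coeff_polyA_top]; exact h.normalised.top_ne_zero))

theorem A_ne_zero (h : IsSpectralData ρ x) : polyA x ≠ 0 := fun h0 => by
  have := h.normalised.top_ne_zero
  rw [← coeff_polyA_top, h0] at this
  exact this (coeff_zero _)

end IsSpectralData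

/-- By coprimality `b` does not vanish at a root of `a`, so the bound on the poles of `b / a` says
that this root is simple. A marked `0` is excluded from that bound but is not a root of `a`. -/
theorem mem_spaceT_iff : x ∈ spaceT α β g ρ ↔
    IsSpectralData ρ x ∧ (polyA x).Separable ∧ IsCoprime (polyA x) (polyB x) := by
  constructor
  · rintro ⟨⟨h1, h2⟩, h3⟩
    have hA := h1.A_ne_zero
    have hcop : IsCoprime (polyA x) (polyB x) := by
      by_contra hc
      exact h3 (resultant_eq_zero_iff.2 ⟨Or.inl hA, hc⟩)
    refine ⟨h1, ?_, hcop⟩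
    rw [← nodup_roots_iff_of_splits hA (IsAlgClosed.splits _), Multiset.nodup_iff_count_le_one]
    intro z
    rw [count_roots]
    by_cases hz : (polyA x).eval z = 0
    · have hb : (polyB x).rootMultiplicity z = 0 := by
        refine rootMultiplicity_eq_zero fun hB => ?_
        obtain ⟨u, v, huv⟩ := hcop
        have := congrArg (eval z) huv
        rw [eval_add, eval_mul, eval_mul, hz, hB.eq_zero] at this
        simp at this
      have := h2 z fun hβ h0 => h1.eval_zero_a hβ (by rwa [h0] at hz)
      omega
    · rw [rootMultiplicity_eq_zero hz]; exact zero_le_one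
  · rintro ⟨h1, h2, h3⟩
    refine ⟨⟨h1, fun z _ => ?_⟩, fun h => ?_⟩
    · exact (rootMultiplicity_le_one_of_separable h2 z).trans (by omega)
    · exact (resultant_eq_zero_iff.1 h).2 h3

end SpaceT

end Whitham

namespace Whitham

/-! ### Anti-linear involutions on polynomials. -/

section RealStructure

/-- The fixed points of an anti-linear involution of a complex vector space form a real vector
space of the same dimension. -/
theorem finrank_eqLocus {W : Type*} [AddCommGroup W] [Module ℂ W] [FiniteDimensional ℂ W]
    (σ : W →ₗ[ℝ] W) (hI : ∀ v, σ (Complex.I • v) = -(Complex.I • σ v)) (hσ : ∀ v, σ (σ v) = v) :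
    Module.finrank ℝ (LinearMap.eqLocus σ LinearMap.id) = Module.finrank ℂ W := by
  haveI : FiniteDimensional ℝ W := FiniteDimensional.complexToReal W
  set F := LinearMap.eqLocus σ LinearMap.id with hF
  have hmem : ∀ v, v ∈ F ↔ σ v = v := fun v => Iff.rfl
  let J : W →ₗ[ℝ] W := (Complex.I • (LinearMap.id : W →ₗ[ℂ] W)).restrictScalars ℝ
  have hJ : ∀ v, J v = Complex.I • v := fun v => rfl
  -- Every vector is uniquely `u + i v` with fixed vectors `u` and `v`, so the real dimension of `W`
  -- is twice that of the fixed space.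
  let Φ : F × F →ₗ[ℝ] W := F.subtype.coprod (J.comp F.subtype)
  have hΦ : ∀ u v : F, Φ (u, v) = (u : W) + Complex.I • (v : W) := fun u v => by
    simp [Φ, hJ]
  have hII : ∀ v : W, Complex.I • Complex.I • v = -v := fun v => by
    rw [smul_smul, Complex.I_mul_I, neg_one_smul]
  have hinj : Function.Injective Φ := by
    rw [injective_iff_map_eq_zero]
    rintro ⟨u, v⟩ h
    rw [hΦ] at h
    have h2 : (u : W) - Complex.I • (v : W) = 0 := by
      have := congrArg σ h
      rwa [map_add, hI, (hmem _).1 u.2, (hmem _).1 v.2, map_zero, ← sub_eq_add_neg] at this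
    have hu : (2 : ℝ) • (u : W) = 0 := by
      rw [two_smul, ← add_zero (0 : W), ← congrArg₂ (· + ·) h h2]; abel
    have hu' : (u : W) = 0 := (smul_eq_zero.1 hu).resolve_left two_ne_zero
    have hv' : (v : W) = 0 := by
      rw [hu', zero_add] at h
      exact (smul_eq_zero.1 h).resolve_left Complex.I_ne_zero
    exact Prod.ext (Subtype.ext hu') (Subtype.ext hv')
  have hsurj : Function.Surjective Φ := by
    intro w
    have hu : (1 / 2 : ℝ) • (w + σ w) ∈ F := by
      rw [hmem, map_smul, map_add, hσ, add_comm]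
    have hv : (1 / 2 : ℝ) • (-(Complex.I • (w - σ w))) ∈ F := by
      rw [hmem, map_smul, map_neg, hI, map_sub, hσ, neg_neg, ← smul_neg, neg_sub]
    refine ⟨(⟨_, hu⟩, ⟨_, hv⟩), ?_⟩
    rw [hΦ]
    simp only
    rw [smul_comm Complex.I, smul_neg, hII, neg_neg, ← smul_add, add_add_sub_cancel, ← two_smul ℝ w,
      smul_smul]
    norm_num
  have h1 := (LinearEquiv.ofBijective Φ ⟨hinj, hsurj⟩).finrank_eq
  rw [Module.finrank_prod, finrank_real_of_complex] at h1
  omega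

end RealStructure

namespace Reality

/-- The position of the coefficient which is moved to position `k`. -/
def idx : Reality → ℕ → ℕ → ℕ
  | line, _, k => k
  | circle, n, k => n - k
  | antipodal, n, k => n - k

/-- The sign with which a coefficient is moved to position `k`. -/
def sign : Reality → ℕ → ℕ → ℂ
  | line, _, _ => 1
  | circle, _, _ => 1
  | antipodal, n, k => (-1) ^ (n - k)

/-- The orientation character of the involution near its invariant set. -/
def flip : Reality → ℂ
  | line => 1
  | circle => -1
  | antipodal => -1

/-- The polynomial `λ ↦ factor * conj (p (conj λ))`. -/
noncomputable def star (ρ : Reality) (n : ℕ) (p : ℂ[X]) : ℂ[X] :=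
  toPoly fun i : Fin (n + 1) => ρ.sign n i * (starRingEnd ℂ) (p.coeff (ρ.idx n i))

variable {ρ : Reality} {n m : ℕ} {p q : ℂ[X]}

theorem coeff_star {k : ℕ} (hk : k ≤ n) :
    (ρ.star n p).coeff k = ρ.sign n k * (starRingEnd ℂ) (p.coeff (ρ.idx n k)) := by
  rw [star, coeff_toPoly, dif_pos (by omega)]

theorem natDegree_star_le : (ρ.star n p).natDegree ≤ n := natDegree_toPoly_le _

theorem conj_ne_zero {z : ℂ} (hz : z ≠ 0) : ρ.conj z ≠ 0 := by
  cases ρ <;> simpa [conj] using hz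

/-- This links the coefficient formula for `star` to the pointwise definition of `Fixes`; for the
two inversions it is a reversal of the order of summation. -/
theorem eval_star (hp : p.natDegree ≤ n) {z : ℂ} (hz : z ≠ 0) :
    (ρ.star n p).eval z = ρ.factor n z * (starRingEnd ℂ) (p.eval (ρ.conj z)) := by
  have hr : ∀ f : ℕ → ℂ, ∑ i : Fin (n + 1), f (n - i) * z ^ (i : ℕ) =
      z ^ n * ∑ i ∈ Finset.range (n + 1), f i * (z⁻¹) ^ i := fun f => by
    rw [Fin.sum_univ_eq_sum_range (fun i => f (n - i) * z ^ i),
      ← Finset.sum_range_reflect, Finset.mul_sum]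
    refine Finset.sum_congr rfl fun i hi => ?_
    have hi' : i ≤ n := by have := Finset.mem_range.1 hi; omega
    have h1 : n + 1 - 1 - i = n - i := by omega
    have h2 : n - (n - i) = i := by omega
    rw [h1, h2, inv_pow, ← pow_sub_mul_pow z hi']
    field_simp
  rw [star, eval_toPoly, eval_eq_sum_range' (Nat.lt_succ_of_le hp), map_sum]
  cases ρ
  · simp only [sign, idx, factor, conj, one_mul, map_mul, map_pow, Complex.conj_conj]
    rw [Fin.sum_univ_eq_sum_range (fun i => (starRingEnd ℂ) (p.coeff i) * z ^ i)]
  · simp only [sign, idx, factor, conj, one_mul, map_mul, map_pow, Complex.conj_conj, map_inv₀]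
    exact hr fun i => (starRingEnd ℂ) (p.coeff i)
  · simp only [sign, idx, factor, conj, map_mul, map_pow, Complex.conj_conj, map_inv₀, map_neg]
    rw [hr fun i => (-1) ^ i * (starRingEnd ℂ) (p.coeff i)]
    congr 1
    refine Finset.sum_congr rfl fun i _ => ?_
    rw [neg_pow z⁻¹]; ring

theorem eq_of_eval_ne_zero (h : ∀ z : ℂ, z ≠ 0 → p.eval z = q.eval z) : p = q :=
  eq_of_infinite_eval_eq p q ((Set.finite_singleton (0 : ℂ)).infinite_compl.mono fun z hz => h z hz)

theorem fixes_iff {s : ℂ} (hp : p.natDegree ≤ n) : ρ.Fixes s n p ↔ C s * ρ.star n p = p := by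
  constructor
  · intro h
    refine eq_of_eval_ne_zero fun z hz => ?_
    rw [eval_C_mul, eval_star hp hz, ← mul_assoc, h z hz]
  · intro h z hz
    have := congrArg (eval z) h
    rwa [eval_C_mul, eval_star hp hz, ← mul_assoc] at this

theorem star_mul (hp : p.natDegree ≤ n) (hq : q.natDegree ≤ m) :
    ρ.star (n + m) (p * q) = ρ.star n p * ρ.star m q := by
  refine eq_of_eval_ne_zero fun z hz => ?_
  rw [eval_star (natDegree_mul_le.trans (add_le_add hp hq)) hz, eval_mul, eval_mul,
    eval_star hp hz, eval_star hq hz, map_mul]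
  cases ρ <;> simp only [factor, pow_add] <;> ring

theorem star_add : ρ.star n (p + q) = ρ.star n p + ρ.star n q := by
  rw [star, star, star, ← toPoly_add]
  congr 1; ext i; simp [mul_add]

theorem star_C_mul (s : ℂ) : ρ.star n (C s * p) = C ((starRingEnd ℂ) s) * ρ.star n p := by
  rw [star, star, ← toPoly_smul]
  congr 1; ext i; simp only [coeff_C_mul, map_mul, Pi.smul_apply, smul_eq_mul]; ring

theorem star_neg : ρ.star n (-p) = -ρ.star n p := by
  have := star_C_mul (ρ := ρ) (n := n) (p := p) (-1)
  simpa using this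

theorem star_sub : ρ.star n (p - q) = ρ.star n p - ρ.star n q := by
  rw [sub_eq_add_neg, star_add, star_neg, ← sub_eq_add_neg]

/-- The antipodal map applied twice multiplies each coefficient by `(-1) ^ n`, which explains the
parity hypothesis. -/
theorem star_star (h : ρ = antipodal → Even n) (hp : p.natDegree ≤ n) :
    ρ.star n (ρ.star n p) = p := by
  ext k
  rcases le_or_gt k n with hk | hk
  · have hi : ρ.idx n k ≤ n := by cases ρ <;> simp [idx, hk]
    have hii : ρ.idx n (ρ.idx n k) = k := by cases ρ <;> simp [idx] <;> omega
    have hs : ρ.sign n k * (starRingEnd ℂ) (ρ.sign n (ρ.idx n k)) = 1 := by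
      cases ρ
      · simp [sign]
      · simp [sign]
      · simp only [sign, idx, map_pow, map_neg, map_one]
        rw [← pow_add, show n - k + (n - (n - k)) = n by omega, (h rfl).neg_one_pow]
    rw [coeff_star hk, coeff_star hi, hii, map_mul, Complex.conj_conj, ← mul_assoc, hs, one_mul]
  · rw [coeff_eq_zero_of_natDegree_lt (natDegree_star_le.trans_lt hk),
      coeff_eq_zero_of_natDegree_lt (hp.trans_lt hk)]

theorem coeff_X_mul_derivative (p : ℂ[X]) (k : ℕ) :
    (X * derivative p).coeff k = k * p.coeff k := by
  cases k with
  | zero => simp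
  | succ k => rw [coeff_X_mul, coeff_derivative]; push_cast; ring

theorem natDegree_X_mul_derivative_le (hp : p.natDegree ≤ n) :
    (X * derivative p).natDegree ≤ n := by
  rw [natDegree_le_iff_coeff_eq_zero]
  intro k hk
  rw [coeff_X_mul_derivative, coeff_eq_zero_of_natDegree_lt (hp.trans_lt hk), mul_zero]

/-- The operator `λ d/dλ` multiplies the coefficient `k` by `k`, and an inversion replaces this
weight by `n - k`. -/
theorem star_X_mul_derivative :
    ρ.star n (X * derivative p) =
      C ((1 - ρ.flip) / 2 * n) * ρ.star n p + C ρ.flip * (X * derivative (ρ.star n p)) := by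
  ext k
  rw [coeff_add, coeff_C_mul, coeff_C_mul, coeff_X_mul_derivative]
  rcases le_or_gt k n with hk | hk
  · rw [coeff_star hk, coeff_star hk, coeff_X_mul_derivative, map_mul, map_natCast]
    cases ρ <;> simp only [idx, flip] <;> push_cast [hk] <;> ring
  · rw [coeff_eq_zero_of_natDegree_lt (natDegree_star_le.trans_lt hk),
      coeff_eq_zero_of_natDegree_lt (natDegree_star_le.trans_lt hk)]
    simp

/-- For odd `n` the square of the antipodal map is `-1`, so it has no nonzero fixed points. -/
theorem Fixes.eq_zero_of_odd {s : ℂ} (hs : s * (starRingEnd ℂ) s = 1) (hn : ¬ Even n)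
    (h : antipodal.Fixes s n p) : p = 0 := by
  refine eq_of_eval_ne_zero fun z hz => ?_
  have h1 := h z hz
  have h2 := h (antipodal.conj z) (conj_ne_zero hz)
  have h3 : antipodal.conj (antipodal.conj z) = z := by simp [conj]
  have h4 : z * (starRingEnd ℂ) (antipodal.conj z) = -1 := by
    simp only [conj, map_neg, map_inv₀, Complex.conj_conj]; field_simp
  rw [h3] at h2
  simp only [factor] at h1 h2
  rw [← h2, map_mul, map_mul, map_pow, Complex.conj_conj] at h1
  have h5 : (z * (starRingEnd ℂ) (antipodal.conj z)) ^ n = -1 := by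
    rw [h4, (Nat.not_even_iff_odd.1 hn).neg_one_pow]
  rw [mul_pow] at h5
  have h6 : p.eval z = (s * (starRingEnd ℂ) s) *
      (z ^ n * (starRingEnd ℂ) (antipodal.conj z) ^ n) * p.eval z := by
    linear_combination -h1
  rw [hs, h5] at h6
  rw [eval_zero]; linear_combination h6 / 2

end Reality

end Whitham

namespace Whitham

namespace Reality

/-- The anti-linear involution on the vectors of coefficients. -/
noncomputable def starMap (ρ : Reality) (s : ℂ) (n : ℕ) :
    (Fin (n + 1) → ℂ) →ₗ[ℝ] (Fin (n + 1) → ℂ) where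
  toFun v := ofPoly (n + 1) (C s * ρ.star n (toPoly v))
  map_add' v w := by
    rw [toPoly_add, star_add, mul_add]; ext i; simp [ofPoly]
  map_smul' t v := by
    have : toPoly (t • v) = C (t : ℂ) * toPoly v := by
      rw [← toPoly_smul]; rfl
    rw [this, star_C_mul, Complex.conj_ofReal]
    ext i
    simp only [ofPoly, coeff_C_mul, RingHom.id_apply, Pi.smul_apply, Complex.real_smul]
    ring

variable {ρ : Reality} {s : ℂ} {n : ℕ}

theorem toPoly_starMap (v : Fin (n + 1) → ℂ) :
    toPoly (ρ.starMap s n v) = C s * ρ.star n (toPoly v) :=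
  toPoly_ofPoly ((natDegree_C_mul_le _ _).trans natDegree_star_le)

theorem starMap_eq_iff {v : Fin (n + 1) → ℂ} : ρ.starMap s n v = v ↔ ρ.Fixes s n (toPoly v) := by
  rw [fixes_iff (natDegree_toPoly_le v), ← toPoly_starMap]
  exact toPoly_injective.eq_iff.symm

theorem starMap_I_smul (v : Fin (n + 1) → ℂ) :
    ρ.starMap s n (Complex.I • v) = -(Complex.I • ρ.starMap s n v) := by
  apply toPoly_injective
  rw [← neg_smul, toPoly_smul, toPoly_starMap, toPoly_smul, star_C_mul, toPoly_starMap,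
    Complex.conj_I]
  ring

theorem starMap_starMap (hs : s * (starRingEnd ℂ) s = 1) (h : ρ = antipodal → Even n)
    (v : Fin (n + 1) → ℂ) : ρ.starMap s n (ρ.starMap s n v) = v := by
  apply toPoly_injective
  rw [toPoly_starMap, toPoly_starMap, star_C_mul, star_star h (natDegree_toPoly_le v), ← mul_assoc,
    ← C_mul, hs, C_1, one_mul]

theorem signB_mul_conj (g : ℕ) : ρ.signB g * (starRingEnd ℂ) (ρ.signB g) = 1 := by
  cases ρ <;> simp [signB, ← mul_pow]

theorem signC_mul_conj (α : ℕ) : ρ.signC α * (starRingEnd ℂ) (ρ.signC α) = 1 := by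
  cases ρ <;> simp [signC, ← mul_pow]

end Reality

/-- The real vectors of coefficients. -/
noncomputable def realVectors (ρ : Reality) (s : ℂ) (n : ℕ) : Submodule ℝ (Fin (n + 1) → ℂ) :=
  LinearMap.eqLocus (ρ.starMap s n) LinearMap.id

theorem mem_realVectors {ρ : Reality} {s : ℂ} {n : ℕ} {v : Fin (n + 1) → ℂ} :
    v ∈ realVectors ρ s n ↔ ρ.Fixes s n (toPoly v) := Reality.starMap_eq_iff

theorem finrank_realVectors {ρ : Reality} {s : ℂ} {n : ℕ} (hs : s * (starRingEnd ℂ) s = 1)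
    (h : ρ = .antipodal → Even n) : Module.finrank ℝ (realVectors ρ s n) = n + 1 := by
  rw [realVectors, finrank_eqLocus _ Reality.starMap_I_smul (Reality.starMap_starMap hs h)]
  simp

/-! ### The real vector space of real pairs. -/

section Pairs

variable {α β g : ℕ} {ρ : Reality}

/-- The anti-linear involution on the pairs of polynomials. -/
noncomputable def conjPair (ρ : Reality) : Coeffs α β g →ₗ[ℝ] Coeffs α β g :=
  (ρ.starMap 1 (degA α β g)).prodMap (ρ.starMap (ρ.signB g) (degB α β g))

theorem polyA_conjPair (x : Coeffs α β g) :
    polyA (conjPair ρ x) = ρ.star (degA α β g) (polyA x) := by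
  have := Reality.toPoly_starMap (ρ := ρ) (s := 1) x.1
  rwa [C_1, one_mul] at this

theorem polyB_conjPair (x : Coeffs α β g) :
    polyB (conjPair ρ x) = C (ρ.signB g) * ρ.star (degB α β g) (polyB x) :=
  Reality.toPoly_starMap (ρ := ρ) (s := ρ.signB g) x.2

/-- The real pairs. -/
noncomputable def realPairs (α β g : ℕ) (ρ : Reality) : Submodule ℝ (Coeffs α β g) :=
  LinearMap.eqLocus (conjPair ρ) LinearMap.id

theorem mem_realPairs {x : Coeffs α β g} : x ∈ realPairs α β g ρ ↔
    ρ.Fixes 1 (degA α β g) (polyA x) ∧ ρ.Fixes (ρ.signB g) (degB α β g) (polyB x) := by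
  have : x ∈ realPairs α β g ρ ↔ conjPair ρ x = x := Iff.rfl
  rw [this, conjPair, Prod.ext_iff]
  exact and_congr Reality.starMap_eq_iff Reality.starMap_eq_iff

theorem conjPair_eq {x : Coeffs α β g} (hx : x ∈ realPairs α β g ρ) : conjPair ρ x = x := hx

theorem star_polyA {x : Coeffs α β g} (hx : x ∈ realPairs α β g ρ) :
    ρ.star (degA α β g) (polyA x) = polyA x := by
  rw [← polyA_conjPair, conjPair_eq hx]

theorem signB_mul_star_polyB {x : Coeffs α β g} (hx : x ∈ realPairs α β g ρ) :
    C (ρ.signB g) * ρ.star (degB α β g) (polyB x) = polyB x := by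
  rw [← polyB_conjPair, conjPair_eq hx]

theorem even_degA (hβ : β = 1) : Even (degA α β g) := by
  subst hβ; simp [degA]

theorem conjPair_conjPair (hρ : β = 0 → ρ = .line) (hβ : β ≤ 1)
    (h : ρ = .antipodal → Even (degB α β g)) (x : Coeffs α β g) :
    conjPair ρ (conjPair ρ x) = x := by
  refine Prod.ext (Reality.starMap_starMap (by simp) (fun h' => even_degA ?_) x.1)
    (Reality.starMap_starMap (Reality.signB_mul_conj g) h x.2)
  by_contra h0
  have := hρ (by omega)
  rw [this] at h'; cases h'

theorem finrank_realPairs (hρ : β = 0 → ρ = .line) (hβ : β ≤ 1)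
    (h : ρ = .antipodal → Even (degB α β g)) :
    Module.finrank ℝ (realPairs α β g ρ) = degA α β g + degB α β g + 2 := by
  rw [realPairs, finrank_eqLocus _ (fun v => ?_) (conjPair_conjPair hρ hβ h)]
  · rw [Module.finrank_prod]; simp; ring
  · exact Prod.ext (Reality.starMap_I_smul v.1) (Reality.starMap_I_smul v.2)

end Pairs

/-! ### The differential operator in the flow equation. -/

section FlowRHS

/-- The right hand side of the integrability equation. -/
noncomputable def flowRHS (κ : ℕ) (A c : ℂ[X]) : ℂ[X] :=
  X * (2 * A * derivative c - derivative A * c) - C (κ : ℂ) * A * c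

variable {κ : ℕ} {A c : ℂ[X]}

theorem flowRHS_eq : flowRHS κ A c =
    2 * (A * (X * derivative c)) - X * derivative A * c - C (κ : ℂ) * (A * c) := by
  rw [flowRHS]; ring

theorem flowRHS_add (c c' : ℂ[X]) : flowRHS κ A (c + c') = flowRHS κ A c + flowRHS κ A c' := by
  rw [flowRHS, flowRHS, flowRHS, derivative_add]; ring

theorem flowRHS_C_mul (s : ℂ) (c : ℂ[X]) : flowRHS κ A (C s * c) = C s * flowRHS κ A c := by
  rw [flowRHS, flowRHS, derivative_C_mul]; ring

theorem flowRHS_sub (c c' : ℂ[X]) : flowRHS κ A (c - c') = flowRHS κ A c - flowRHS κ A c' := by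
  rw [flowRHS, flowRHS, flowRHS, derivative_sub]; ring

theorem natDegree_flowRHS_le {d n : ℕ} (hA : A.natDegree ≤ d) (hc : c.natDegree ≤ n) :
    (flowRHS κ A c).natDegree ≤ d + n := by
  have hA' := Reality.natDegree_X_mul_derivative_le hA
  have hc' := Reality.natDegree_X_mul_derivative_le hc
  rw [flowRHS_eq]
  refine (natDegree_sub_le _ _).trans (max_le ((natDegree_sub_le _ _).trans (max_le ?_
    (natDegree_mul_le.trans (add_le_add hA' hc)))) ?_)
  · rw [show (2 : ℂ[X]) = C 2 from rfl]
    exact (natDegree_C_mul_le _ _).trans (natDegree_mul_le.trans (add_le_add hA hc'))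
  · exact (natDegree_C_mul_le _ _).trans (natDegree_mul_le.trans (add_le_add hA hc))

/-- For `κ = β (1 + α)` the factor is twice the exponent with which `c / (λ ^ (α β) ν)` behaves at
infinity. It bounds the degree of `c` wherever it is nonzero. -/
theorem coeff_flowRHS {d n : ℕ} (hA : A.natDegree ≤ d) (hc : c.natDegree ≤ n) :
    (flowRHS κ A c).coeff (d + n) = (2 * n - d - κ) * (A.coeff d * c.coeff n) := by
  rw [flowRHS_eq, coeff_sub, coeff_sub, show (2 : ℂ[X]) = C 2 from rfl, coeff_C_mul, coeff_C_mul,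
    coeff_mul_add_eq_of_natDegree_le hA (Reality.natDegree_X_mul_derivative_le hc),
    coeff_mul_add_eq_of_natDegree_le (Reality.natDegree_X_mul_derivative_le hA) hc,
    coeff_mul_add_eq_of_natDegree_le hA hc, Reality.coeff_X_mul_derivative,
    Reality.coeff_X_mul_derivative]
  ring

/-- Under an inversion the two derivatives produce the extra constant `2 n - d`. The hypothesis
turns `2 n - d - κ` into `κ`, so that all terms change sign together. -/
theorem star_flowRHS {ρ : Reality} {d n : ℕ} (hd : ρ ≠ .line → 2 * n = d + 2 * κ)
    (hA : A.natDegree ≤ d) (hc : c.natDegree ≤ n) (hs : ρ.star d A = A) :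
    ρ.star (d + n) (flowRHS κ A c) = C ρ.flip * flowRHS κ A (ρ.star n c) := by
  have hA' := Reality.natDegree_X_mul_derivative_le hA
  have hc' := Reality.natDegree_X_mul_derivative_le hc
  rw [flowRHS_eq, flowRHS_eq, Reality.star_sub, Reality.star_sub, show (2 : ℂ[X]) = C 2 from rfl,
    Reality.star_C_mul, Reality.star_C_mul, Reality.star_mul hA hc', Reality.star_mul hA' hc,
    Reality.star_mul hA hc, Reality.star_X_mul_derivative, Reality.star_X_mul_derivative, hs]
  have key : (1 - ρ.flip) / 2 * (2 * n - d) - κ = -(ρ.flip * κ) := by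
    have : ρ ≠ .line → (2 * n : ℂ) = d + 2 * κ := fun h => by exact_mod_cast hd h
    cases ρ
    · simp [Reality.flip]
    · simp only [Reality.flip]; rw [this (by simp)]; ring
    · simp only [Reality.flip]; rw [this (by simp)]; ring
  have key' := congrArg C key
  simp only [C_mul, C_sub, C_neg] at key'
  simp only [C_mul, C_sub, map_natCast, Complex.conj_ofNat]
  simp only [map_natCast] at key'
  linear_combination (A * ρ.star n c) * key'

/-- The flow equation has only the trivial homogeneous solution. -/
theorem eq_zero_of_flowRHS_eq_zero (hA : A ≠ 0) (hsep : A.Separable)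
    (h0 : A.eval 0 = 0 → κ = 0) (hκ : A.natDegree = 0 → Odd κ)
    (h : flowRHS κ A c = 0) : c = 0 := by
  by_contra hc
  -- A constant `A` has no root to work at; there the top coefficient gives `2 * c.natDegree = κ`,
  -- against the parity of `κ`.
  by_cases hd : A.natDegree = 0
  · have h1 := coeff_flowRHS (κ := κ) (le_refl A.natDegree) (le_refl c.natDegree)
    rw [h, coeff_zero, hd] at h1
    have h2 : A.coeff 0 * c.coeff c.natDegree ≠ 0 := by
      refine mul_ne_zero ?_ (leadingCoeff_ne_zero.2 hc)
      have := leadingCoeff_ne_zero.2 hA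
      rwa [leadingCoeff, hd] at this
    have h3 := (mul_eq_zero.1 h1.symm).resolve_right h2
    obtain ⟨k, hk⟩ := hκ hd
    have h4 : ((2 * c.natDegree : ℕ) : ℂ) = (κ : ℕ) := by push_cast; push_cast at h3; linear_combination h3
    have h5 : 2 * c.natDegree = κ := by exact_mod_cast h4
    omega
  · obtain ⟨w, hw⟩ := IsAlgClosed.exists_root A (by
      rw [Ne, degree_eq_natDegree hA]; exact_mod_cast hd)
    obtain ⟨A1, hA1⟩ := dvd_iff_isRoot.2 hw
    obtain ⟨c1, hc1, hc2⟩ := exists_eq_pow_rootMultiplicity_mul_and_not_dvd c hc w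
    set m := rootMultiplicity w c
    have hc3 : c1.eval w ≠ 0 := fun h => hc2 (dvd_iff_isRoot.2 h)
    have hA' : (derivative A).eval w = A1.eval w := by
      rw [hA1]; simp
    have hA1w : A1.eval w ≠ 0 := by
      rw [← hA']
      obtain ⟨u, v, huv⟩ := hsep
      intro h0
      have := congrArg (eval w) huv
      simp [h0, hw.eq_zero] at this
    have hder : (X - C w) * derivative c =
        (X - C w) ^ m * (C (m : ℂ) * c1 + (X - C w) * derivative c1) := by
      rw [hc1, derivative_mul, derivative_X_sub_C_pow]
      rcases Nat.eq_zero_or_pos m with hm | hm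
      · simp [hm]
      · conv_rhs => rw [← Nat.sub_add_cancel hm, pow_succ]
        rw [Nat.sub_add_cancel hm]; conv_lhs => rw [← Nat.sub_add_cancel hm, pow_succ]
        rw [Nat.sub_add_cancel hm]; simp; ring
    have h1 : (X - C w) ^ m * (X * (2 * A1 * (C (m : ℂ) * c1 + (X - C w) * derivative c1)
        - derivative A * c1) - C (κ : ℂ) * A * c1) = 0 := by
      have h2 : 2 * A * derivative c = 2 * A1 * ((X - C w) * derivative c) := by
        conv_lhs => rw [hA1]
        ring
      rw [flowRHS, h2, hder] at h
      rw [← h]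
      conv_rhs => rw [hc1]
      ring
    have h2 := (mul_eq_zero.1 h1).resolve_left (pow_ne_zero _ (X_sub_C_ne_zero w))
    -- At a root `w ≠ 0` the factor `X` is invertible and the `κ`-term vanishes with `A`. At `w = 0`
    -- one has `κ = 0` and `X` can be cancelled.
    have h3 : 2 * A1 * (C (m : ℂ) * c1 + (X - C w) * derivative c1)
        - derivative A * c1 = 0 ∨ w ≠ 0 := by
      by_cases hw0 : w = 0
      · left
        have : κ = 0 := h0 (by rw [hw0] at hw; exact hw)
        rw [this] at h2
        simp only [Nat.cast_zero, C_0, zero_mul, sub_zero] at h2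
        exact (mul_eq_zero.1 h2).resolve_left X_ne_zero
      · exact Or.inr hw0
    have h4 : (2 * m - 1 : ℂ) * (A1.eval w * c1.eval w) = 0 := by
      rcases h3 with h3 | h3
      · have := congrArg (eval w) h3
        simp [hA'] at this
        linear_combination this
      · have := congrArg (eval w) h2
        simp [hA', hw.eq_zero, h3] at this
        linear_combination this
    have h5 := (mul_eq_zero.1 h4).resolve_right (mul_ne_zero hA1w hc3)
    have h6 : ((2 * m : ℕ) : ℂ) = (1 : ℕ) := by push_cast; linear_combination h5
    have h7 : 2 * m = 1 := by exact_mod_cast h6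
    omega

/-- The linearised equation `2 A Q - P B = F` is solvable when `A` and `B` are coprime. -/
theorem exists_bezout_natDegree_le {A B F : ℂ[X]} {d : ℕ} (hA : A ≠ 0) (h : IsCoprime A B)
    (hB : B.natDegree ≤ d) (hF : F.natDegree ≤ A.natDegree + d) :
    ∃ P Q : ℂ[X], P.natDegree ≤ A.natDegree ∧ Q.natDegree ≤ d ∧ 2 * A * Q - P * B = F := by
  obtain ⟨u, v, huv⟩ := h
  -- This is the residue class modulo `A` which solves `F + P B ≡ 0`. The degree of `Q` is then
  -- forced by comparing degrees in `F + P B = 2 A Q`.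
  set P := (-(F * v)) % A
  have hP : P.natDegree ≤ A.natDegree := natDegree_le_natDegree (degree_mod_lt _ hA).le
  have h1 : A ∣ F + P * B := by
    have h2 : P = -(F * v) - A * (-(F * v) / A) := by
      rw [eq_sub_iff_add_eq, add_comm]; exact EuclideanDomain.div_add_mod _ _
    refine ⟨F * u - (-(F * v) / A) * B, ?_⟩
    rw [h2]
    linear_combination F * huv.symm
  obtain ⟨Q, hQ⟩ := h1
  refine ⟨P, C (1 / 2) * Q, hP, (natDegree_C_mul_le _ _).trans ?_, ?_⟩
  · by_cases hQ0 : Q = 0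
    · simp [hQ0]
    · have h2 : (F + P * B).natDegree ≤ A.natDegree + d :=
        natDegree_add_le_of_degree_le hF (natDegree_mul_le.trans (add_le_add hP hB))
      rw [hQ, natDegree_mul hA hQ0] at h2
      omega
  · have h2 : (2 : ℂ[X]) * C (1 / 2) = 1 := by
      rw [show (2 : ℂ[X]) = C 2 from rfl, ← C_mul]; norm_num
    linear_combination A * Q * h2 - hQ

end FlowRHS

end Whitham

namespace Whitham

/-! ### The residue conditions in terms of coefficients. -/

section CircleIntegrals

/-- Inversion reverses the orientation of the circle, which cancels the sign in `d(1 / z) = -dz / z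
^ 2`. -/
theorem circleIntegral_inv (f : ℂ → ℂ) (R : ℝ) (hR : 0 < R) :
    (∮ z in C(0, R), f z⁻¹) = ∮ z in C(0, R⁻¹), f z / z ^ 2 := by
  rw [circleIntegral, circleIntegral]
  have h := intervalIntegral.integral_comp_sub_left (a := 0) (b := 2 * Real.pi)
    (fun θ => deriv (circleMap 0 R) θ • f (circleMap 0 R θ)⁻¹) (2 * Real.pi)
  rw [sub_self, sub_zero] at h
  rw [← h]
  refine intervalIntegral.integral_congr fun θ _ => ?_
  have h1 : circleMap 0 R (2 * Real.pi - θ) = (circleMap 0 R⁻¹ θ)⁻¹ := by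
    simp only [circleMap, zero_add, mul_inv, Complex.ofReal_inv, inv_inv, ← Complex.exp_neg]
    congr 1
    have : ((2 * Real.pi - θ : ℝ) : ℂ) * Complex.I = -(θ * Complex.I) + 2 * Real.pi * Complex.I := by
      push_cast; ring
    rw [this, Complex.exp_add, Complex.exp_two_pi_mul_I, mul_one]
  have h2 : circleMap 0 R⁻¹ θ ≠ 0 := circleMap_ne_center (inv_pos.2 hR).ne'
  simp only [deriv_circleMap, smul_eq_mul, h1, inv_inv]
  field_simp

/-- By Cauchy's formula the integral is `2 π i` times the derivative of `P / √Q` at `0`, and that is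
the stated expression divided by `2 S(0) ^ 3`. -/
theorem exists_sqrt_circleIntegral (P Q : ℂ[X]) (hQ : Q.coeff 0 ≠ 0) :
    ∃ δ : ℝ, 0 < δ ∧ ∃ S : ℂ → ℂ, ContinuousOn S (Metric.ball 0 δ) ∧
      (∀ z ∈ Metric.ball (0 : ℂ) δ, S z ^ 2 = Q.eval z ∧ S z ≠ 0) ∧
      ∀ R : ℝ, 0 < R → R < δ → ((∮ z in C(0, R), P.eval z / S z / z ^ 2) = 0 ↔
        2 * Q.coeff 0 * P.coeff 1 - Q.coeff 1 * P.coeff 0 = 0) := by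
  have hQ0 : ∀ᶠ z in 𝓝 (0 : ℂ), Q.eval z ≠ 0 :=
    Q.continuous.continuousAt.eventually_ne (by rwa [← coeff_zero_eq_eval_zero])
  obtain ⟨δ, hδ, hball⟩ := Metric.eventually_nhds_iff_ball.1 hQ0
  obtain ⟨S, hS, hS2⟩ := exists_sqrt_on_ball Q.differentiable.differentiableOn hball
  have hS0 : ∀ z ∈ Metric.ball (0 : ℂ) δ, S z ≠ 0 := fun z hz h => by
    have := hS2 z hz
    rw [h, zero_pow two_ne_zero] at this
    exact hball z hz this.symm
  have h0 : (0 : ℂ) ∈ Metric.ball (0 : ℂ) δ := Metric.mem_ball_self hδ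
  have hf : DifferentiableOn ℂ (fun z => P.eval z / S z) (Metric.ball 0 δ) :=
    P.differentiable.differentiableOn.div hS hS0
  have hSd : HasDerivAt S ((derivative Q).eval 0 / (2 * S 0)) 0 :=
    hasDerivAt_of_sq (Q.hasDerivAt 0) (hS.differentiableAt (Metric.isOpen_ball.mem_nhds h0))
      (Filter.mem_of_superset (Metric.isOpen_ball.mem_nhds h0) hS2) (hS0 0 h0)
  have hd := (P.hasDerivAt 0).div hSd (hS0 0 h0)
  refine ⟨δ, hδ, S, hS.continuousOn, fun z hz => ⟨hS2 z hz, hS0 z hz⟩, fun R hR hRδ => ?_⟩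
  have h1 := Complex.two_pi_I_inv_smul_circleIntegral_sub_sq_inv_smul_of_differentiable
    Metric.isOpen_ball (Metric.closedBall_subset_ball hRδ) hf (Metric.mem_ball_self hR)
  have h2 : (∮ z in C(0, R), ((z - 0) ^ 2)⁻¹ • (P.eval z / S z)) =
      ∮ z in C(0, R), P.eval z / S z / z ^ 2 := by
    congr 1; ext z; rw [sub_zero, smul_eq_mul]; ring
  have e : (derivative P).eval 0 = P.coeff 1 := by
    rw [← coeff_zero_eq_eval_zero, coeff_derivative]; simp
  have e' : (derivative Q).eval 0 = Q.coeff 1 := by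
    rw [← coeff_zero_eq_eval_zero, coeff_derivative]; simp
  have h3 : deriv (fun z => P.eval z / S z) 0 =
      (2 * Q.coeff 0 * P.coeff 1 - Q.coeff 1 * P.coeff 0) / (2 * S 0 ^ 3) := by
    have hs := hS0 0 h0
    have e2 : Q.coeff 0 = S 0 ^ 2 := by rw [hS2 0 h0, coeff_zero_eq_eval_zero]
    have := hd.deriv
    rw [e, e', ← coeff_zero_eq_eval_zero] at this
    rw [show (fun z => P.eval z / S z) = (fun x => eval x P) / S from rfl, this, e2]
    field_simp
  rw [h2, h3] at h1
  have hpi : (2 * Real.pi * Complex.I : ℂ)⁻¹ ≠ 0 := inv_ne_zero Complex.two_pi_I_ne_zero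
  have hs3 : 2 * S 0 ^ 3 ≠ 0 := mul_ne_zero two_ne_zero (pow_ne_zero 3 (hS0 0 h0))
  constructor
  · intro h
    rw [h, smul_zero, eq_comm, div_eq_zero_iff] at h1
    exact h1.resolve_right hs3
  · intro h
    rw [h, zero_div] at h1
    exact (smul_eq_zero.1 h1).resolve_left hpi

end CircleIntegrals

section Residues

variable {α β g : ℕ} {ρ : Reality} {x : Coeffs α β g}

/-- The circle is connected, so `s` and `-s` are its only continuous lifts, and `ω` is odd. -/
theorem circleIntegralsVanish_iff {R : ℝ} (hR : 0 < R) {s : ℂ → ℂ}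
    (hs : ContinuousOn s (Metric.sphere 0 R)) (hs0 : ∀ z ∈ Metric.sphere (0 : ℂ) R, s z ≠ 0)
    (h : ∀ z ∈ Metric.sphere (0 : ℂ) R, s z ^ 2 = curveRHS x z) :
    CircleIntegralsVanish x R ↔ (∮ z in C(0, R), omega x z (s z)) = 0 := by
  refine ⟨fun hv => hv s hs h, fun h0 ν hν hν2 => ?_⟩
  have hpre : IsPreconnected (Metric.sphere (0 : ℂ) R) := isPreconnected_sphere (by simp) 0 R
  rcases hpre.eq_or_eq_neg_of_sq_eq hν hs (fun z hz => by
    simp only [Pi.pow_apply]; rw [hν2 z hz, h z hz]) (fun {z} hz => hs0 z hz) with h1 | h1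
  · refine Eq.trans ?_ h0
    refine circleIntegral.integral_congr hR.le fun z hz => ?_
    simp only [h1 hz]
  · have : (∮ z in C(0, R), omega x z (ν z)) = ∮ z in C(0, R), (-1 : ℂ) • omega x z (s z) :=
      circleIntegral.integral_congr hR.le fun z hz => by
        simp only [h1 hz, omega, Pi.neg_apply, smul_eq_mul]
        rw [mul_neg, div_neg]; ring
    rw [this, circleIntegral.integral_smul, h0, smul_zero]

/-- The vanishing of the residues over infinity in terms of the coefficients. -/
noncomputable def residueInfty (x : Coeffs α β g) : ℂ :=
  2 * (polyA x).coeff (degA α β g) * (polyB x).coeff (degB α β g - 1) -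
    (polyA x).coeff (degA α β g - 1) * (polyB x).coeff (degB α β g)

/-- The vanishing of the residues over zero in terms of the coefficients. -/
noncomputable def residueZero (x : Coeffs α β g) : ℂ :=
  2 * (polyA x).coeff 0 * (polyB x).coeff 1 - (polyA x).coeff 1 * (polyB x).coeff 0

/-- For `α = 0` the point `0` is a branch point, small circles have no closed lift and the condition
is vacuous. For `α = 1` there are two sheets, on which `ω` has the denominator `λ ^ 2 ν`. -/
theorem residue_zero_iff (hα : α ≤ 1) (hβ : β = 1) (h0 : (polyA x).eval 0 ≠ 0) :
    (∀ᶠ R : ℝ in 𝓝[>] 0, CircleIntegralsVanish x R) ↔ (α = 1 → residueZero x = 0) := by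
  rw [← coeff_zero_eq_eval_zero] at h0
  obtain ⟨δ, hδ, S, hS, hS2, hint⟩ := exists_sqrt_circleIntegral (polyB x) (polyA x) h0
  have hev : ∀ᶠ R : ℝ in 𝓝[>] 0, 0 < R ∧ R < δ := Ioo_mem_nhdsGT hδ
  have hsub : ∀ R < δ, Metric.sphere (0 : ℂ) R ⊆ Metric.ball 0 δ := fun R hR =>
    Metric.sphere_subset_closedBall.trans (Metric.closedBall_subset_ball hR)
  rcases Nat.eq_zero_or_pos α with hα0 | hα1
  · refine ⟨fun _ h => absurd h (by omega), fun _ => ?_⟩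
    filter_upwards [hev] with R hR ν hν hν2
    refine (not_exists_sqrt_on_sphere hR.1 hν (hS.mono (hsub R hR.2))
      (fun z hz => (hS2 z (hsub R hR.2 hz)).2) fun z hz => ?_).elim
    rw [hν2 z hz, (hS2 z (hsub R hR.2 hz)).1, curveRHS, show (1 - α) * β = 1 by rw [hα0, hβ]]
    simp
  · have hα' : α = 1 := by omega
    have key : ∀ R : ℝ, 0 < R ∧ R < δ → (CircleIntegralsVanish x R ↔ residueZero x = 0) := by
      rintro R ⟨hR, hRδ⟩
      rw [circleIntegralsVanish_iff hR (hS.mono (hsub R hRδ))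
        (fun z hz => (hS2 z (hsub R hRδ hz)).2) fun z hz => ?_, residueZero, ← hint R hR hRδ]
      · rw [circleIntegral.integral_congr hR.le fun z hz => ?_]
        simp only [omega]
        rw [show β + α * β = 2 by rw [hα', hβ], div_div, mul_comm (S z)]
      · rw [(hS2 z (hsub R hRδ hz)).1, curveRHS, show (1 - α) * β = 0 by rw [hα']; simp]
        simp
    constructor
    · intro h _
      obtain ⟨R, h1, h2⟩ := (h.and hev).exists
      exact (key R h2).1 h1
    · intro h
      filter_upwards [hev] with R hR
      exact (key R hR).2 (h hα')

theorem eval_eq_pow_mul_reflect {p : ℂ[X]} {n : ℕ} (hp : p.natDegree ≤ n) {z : ℂ} (hz : z ≠ 0) :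
    p.eval z = z ^ n * (reflect n p).eval z⁻¹ := by
  letI := invertibleOfNonzero hz
  have := eval₂_reflect_mul_pow (RingHom.id ℂ) z n p hp
  rw [invOf_eq_inv] at this
  rw [eval, eval, ← this, mul_comm]

/-- In the coordinate `1 / λ` the reflected polynomials replace `a` and `b`, and the curve becomes
`z ^ (1 - α)` times a square. So `α` again decides between a branch point and two sheets. -/
theorem residue_infty_iff (hα : α ≤ 1) (hβ : β ≤ 1) (hg : α ≤ g)
    (h0 : (polyA x).coeff (degA α β g) ≠ 0) :
    (∀ᶠ R : ℝ in Filter.atTop, CircleIntegralsVanish x R) ↔ (α = 1 → residueInfty x = 0) := by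
  have c0 : ∀ (n : ℕ) (p : ℂ[X]), (reflect n p).coeff 0 = p.coeff n := fun n p => by
    rw [coeff_reflect, revAt_le (Nat.zero_le n), Nat.sub_zero]
  have c1 : ∀ (n : ℕ) (p : ℂ[X]), 1 ≤ n → (reflect n p).coeff 1 = p.coeff (n - 1) :=
    fun n p hn => by rw [coeff_reflect, revAt_le hn]
  obtain ⟨δ, hδ, S, hS, hS2, hint⟩ := exists_sqrt_circleIntegral
    (reflect (degB α β g) (polyB x)) (reflect (degA α β g) (polyA x)) (by rwa [c0])
  have hev : ∀ᶠ R : ℝ in Filter.atTop, 0 < R ∧ R⁻¹ < δ := by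
    filter_upwards [Filter.eventually_gt_atTop 0, Filter.eventually_gt_atTop δ⁻¹] with R h1 h2
    exact ⟨h1, inv_lt_of_inv_lt₀ hδ h2⟩
  have hz0 : ∀ R : ℝ, 0 < R → ∀ z ∈ Metric.sphere (0 : ℂ) R, z ≠ 0 := fun R hR z hz h => by
    rw [h, mem_sphere_zero_iff_norm, norm_zero] at hz
    exact hR.ne hz
  have hmem : ∀ R : ℝ, 0 < R ∧ R⁻¹ < δ → ∀ z ∈ Metric.sphere (0 : ℂ) R,
      z⁻¹ ∈ Metric.ball (0 : ℂ) δ := fun R hR z hz => by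
    rw [mem_ball_zero_iff, norm_inv, mem_sphere_zero_iff_norm.1 hz]; exact hR.2
  have hF : ∀ R : ℝ, 0 < R ∧ R⁻¹ < δ →
      ContinuousOn (fun z => z ^ g * S z⁻¹) (Metric.sphere 0 R) := fun R hR =>
    (continuousOn_id.pow g).mul (hS.comp (continuousOn_inv₀.mono fun z hz => hz0 R hR.1 z hz)
      fun z hz => hmem R hR z hz)
  have hF0 : ∀ R : ℝ, 0 < R ∧ R⁻¹ < δ → ∀ z ∈ Metric.sphere (0 : ℂ) R, z ^ g * S z⁻¹ ≠ 0 :=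
    fun R hR z hz => mul_ne_zero (pow_ne_zero _ (hz0 R hR.1 z hz)) (hS2 _ (hmem R hR z hz)).2
  have hcurve : ∀ R : ℝ, 0 < R ∧ R⁻¹ < δ → ∀ z ∈ Metric.sphere (0 : ℂ) R,
      curveRHS x z = z ^ (1 - α) * (z ^ g * S z⁻¹) ^ 2 := fun R hR z hz => by
    rw [curveRHS, eval_eq_pow_mul_reflect natDegree_polyA_le (hz0 R hR.1 z hz), mul_pow,
      (hS2 _ (hmem R hR z hz)).1, ← mul_assoc, ← mul_assoc, ← pow_mul, ← pow_add, ← pow_add]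
    congr 2
    rw [degA]
    interval_cases α <;> interval_cases β <;> omega
  rcases Nat.eq_zero_or_pos α with hα0 | hα1
  · refine ⟨fun _ h => absurd h (by omega), fun _ => ?_⟩
    filter_upwards [hev] with R hR ν hν hν2
    refine (not_exists_sqrt_on_sphere hR.1 hν (hF R hR) (hF0 R hR) fun z hz => ?_).elim
    rw [hν2 z hz, hcurve R hR z hz, hα0]
    simp
  · have hα' : α = 1 := by omega
    have key : ∀ R : ℝ, 0 < R ∧ R⁻¹ < δ → (CircleIntegralsVanish x R ↔ residueInfty x = 0) := by
      intro R hR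
      rw [circleIntegralsVanish_iff hR.1 (hF R hR) (hF0 R hR) fun z hz => ?_]
      · have hdA : 1 ≤ degA α β g := by rw [degA]; omega
        have hdB : 1 ≤ degB α β g := by rw [degB]; omega
        have h1 := hint R⁻¹ (inv_pos.2 hR.1) hR.2
        rw [← circleIntegral_inv (fun z => (reflect (degB α β g) (polyB x)).eval z / S z) R hR.1,
          c0, c0, c1 _ _ hdA, c1 _ _ hdB] at h1
        rw [residueInfty, ← h1, circleIntegral.integral_congr hR.1.le fun z hz => ?_]
        have hz' := hz0 R hR.1 z hz
        have hS' := (hS2 _ (hmem R hR z hz)).2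
        rw [omega, eval_eq_pow_mul_reflect natDegree_polyB_le hz']
        have : degB α β g = β + α * β + g := by rw [degB]; ring
        rw [this, pow_add]
        field_simp
      · rw [hcurve R hR z hz, hα']; simp
    constructor
    · intro h _
      obtain ⟨R, h1, h2⟩ := (h.and hev).exists
      exact (key R h2).1 h1
    · intro h
      filter_upwards [hev] with R hR
      exact (key R hR).2 (h hα')

end Residues

end Whitham

namespace Whitham

/-! ### The open conditions in the definition of `T`. -/

section Coprime

theorem continuousAt_resultant {T : Type*} [TopologicalSpace T] {t : T} {f g : T → ℂ[X]} (m n : ℕ)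
    (hf : ∀ k, ContinuousAt (fun s => (f s).coeff k) t)
    (hg : ∀ k, ContinuousAt (fun s => (g s).coeff k) t) :
    ContinuousAt (fun s => resultant (f s) (g s) m n) t := by
  have : ContinuousAt (fun s => sylvester (f s) (g s) m n) t := by
    refine continuousAt_pi.2 fun i => continuousAt_pi.2 fun j => ?_
    simp only [sylvester, Matrix.of_apply]
    induction j using Fin.addCases with
    | left j =>
      simp only [Fin.addCases_left]
      split_ifs
      · exact hg _
      · exact continuousAt_const
    | right j =>
      simp only [Fin.addCases_right]
      split_ifs
      · exact hf _
      · exact continuousAt_const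
  exact (Continuous.matrix_det continuous_id).continuousAt.comp this

/-- Coprimeness of polynomials of constant degree is an open condition. -/
theorem eventually_isCoprime {T : Type*} [TopologicalSpace T] {t : T} {f g : T → ℂ[X]} {m n : ℕ}
    (hf : ∀ k, ContinuousAt (fun s => (f s).coeff k) t)
    (hg : ∀ k, ContinuousAt (fun s => (g s).coeff k) t)
    (hm : ∀ᶠ s in 𝓝 t, (f s).natDegree = m) (hn : ∀ᶠ s in 𝓝 t, (g s).natDegree = n)
    (hf0 : ∀ᶠ s in 𝓝 t, f s ≠ 0) (h : IsCoprime (f t) (g t)) :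
    ∀ᶠ s in 𝓝 t, IsCoprime (f s) (g s) := by
  have key : ∀ s, (f s).natDegree = m → (g s).natDegree = n → f s ≠ 0 →
      (IsCoprime (f s) (g s) ↔ resultant (f s) (g s) m n ≠ 0) := by
    intro s h1 h2 h3
    subst h1 h2
    rw [Ne, resultant_eq_zero_iff]
    simp [h3]
  have h0 := (key t hm.self_of_nhds hn.self_of_nhds hf0.self_of_nhds).1 h
  filter_upwards [hm, hn, hf0, (continuousAt_resultant m n hf hg).eventually_ne h0] with s h1 h2 h3 h4
  exact (key s h1 h2 h3).2 h4

end Coprime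

section SpaceT

variable {α β g : ℕ} {ρ : Reality} {x : Coeffs α β g}

theorem polyA_add (x y : Coeffs α β g) : polyA (x + y) = polyA x + polyA y := toPoly_add _ _

theorem polyB_add (x y : Coeffs α β g) : polyB (x + y) = polyB x + polyB y := toPoly_add _ _

theorem polyA_smul (t : ℝ) (x : Coeffs α β g) : polyA (t • x) = C (t : ℂ) * polyA x := by
  rw [polyA, polyA, ← toPoly_smul]; rfl

theorem polyB_smul (t : ℝ) (x : Coeffs α β g) : polyB (t • x) = C (t : ℂ) * polyB x := by
  rw [polyB, polyB, ← toPoly_smul]; rfl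

/-- A coefficient of `a` as a function of the pair. -/
noncomputable def coeffA (k : ℕ) : Coeffs α β g →L[ℝ] ℂ :=
  LinearMap.toContinuousLinearMap
    { toFun := fun x => (polyA x).coeff k
      map_add' := fun x y => by simp [polyA_add]
      map_smul' := fun t x => by simp [polyA_smul] }

/-- A coefficient of `b` as a function of the pair. -/
noncomputable def coeffB (k : ℕ) : Coeffs α β g →L[ℝ] ℂ :=
  LinearMap.toContinuousLinearMap
    { toFun := fun x => (polyB x).coeff k
      map_add' := fun x y => by simp [polyB_add]
      map_smul' := fun t x => by simp [polyB_smul] }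

theorem coeffA_apply (k : ℕ) (x : Coeffs α β g) : coeffA k x = (polyA x).coeff k := rfl

theorem coeffB_apply (k : ℕ) (x : Coeffs α β g) : coeffB k x = (polyB x).coeff k := rfl

theorem coeffs_ext {x y : Coeffs α β g} (hA : polyA x = polyA y) (hB : polyB x = polyB y) : x = y :=
  Prod.ext (toPoly_injective hA) (toPoly_injective hB)

/-- Once reality, normalisation and residues are set apart, everything in the definition of `T` is
open. The last clause serves the reality condition `line`, where a real top coefficient of modulus
`1` could also be `-1`. -/
theorem eventually_mem_openConditions (hα : α ≤ 1) (hx : x ∈ spaceT α β g ρ) :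
    ∀ᶠ y in 𝓝 x, (polyA y).coeff (degA α β g) ≠ 0 ∧ y.2 (Fin.last _) ≠ 0 ∧
      (β = 1 → (polyA y).eval 0 ≠ 0) ∧ (β = 1 → (polyB y).eval 0 ≠ 0) ∧
      (polyA y).Separable ∧ IsCoprime (polyA y) (polyB y) ∧
      (ρ = .line → 0 < ((polyA y).coeff (degA α β g)).re) := by
  obtain ⟨h1, h2, h3⟩ := mem_spaceT_iff.1 hx
  have cA : ∀ k, ContinuousAt (fun y : Coeffs α β g => (polyA y).coeff k) x := fun k =>
    (coeffA k).continuous.continuousAt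
  have cB : ∀ k, ContinuousAt (fun y : Coeffs α β g => (polyB y).coeff k) x := fun k =>
    (coeffB k).continuous.continuousAt
  have a1 : ∀ᶠ y : Coeffs α β g in 𝓝 x, (polyA y).coeff (degA α β g) ≠ 0 :=
    (cA _).eventually_ne (by rw [coeff_polyA_top]; exact h1.normalised.top_ne_zero)
  have b1 : ∀ᶠ y : Coeffs α β g in 𝓝 x, (polyB y).coeff (degB α β g) ≠ 0 :=
    (cB _).eventually_ne (by rw [coeff_polyB_top]; exact h1.lead_ne_zero)
  have a2 : ∀ᶠ y : Coeffs α β g in 𝓝 x, β = 1 → (polyA y).eval 0 ≠ 0 := by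
    by_cases hβ : β = 1
    · filter_upwards [(cA 0).eventually_ne (by
        rw [coeff_zero_eq_eval_zero]; exact h1.eval_zero_a hβ)] with y hy _
      rwa [← coeff_zero_eq_eval_zero]
    · exact Filter.Eventually.of_forall fun y h => absurd h hβ
  have b2 : ∀ᶠ y : Coeffs α β g in 𝓝 x, β = 1 → (polyB y).eval 0 ≠ 0 := by
    by_cases hβ : β = 1
    · filter_upwards [(cB 0).eventually_ne (by
        rw [coeff_zero_eq_eval_zero]; exact h1.eval_zero_b hβ)] with y hy _
      rwa [← coeff_zero_eq_eval_zero]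
    · exact Filter.Eventually.of_forall fun y h => absurd h hβ
  have dA : ∀ᶠ y : Coeffs α β g in 𝓝 x, (polyA y).natDegree = degA α β g := a1.mono fun y hy =>
    le_antisymm natDegree_polyA_le (le_natDegree_of_ne_zero hy)
  have dB : ∀ᶠ y : Coeffs α β g in 𝓝 x, (polyB y).natDegree = degB α β g := b1.mono fun y hy =>
    le_antisymm natDegree_polyB_le (le_natDegree_of_ne_zero hy)
  have nA : ∀ᶠ y : Coeffs α β g in 𝓝 x, polyA y ≠ 0 := a1.mono fun y hy h => hy (by simp [h])
  have dA' : ∀ᶠ y : Coeffs α β g in 𝓝 x, (derivative (polyA y)).natDegree = degA α β g - 1 :=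
    dA.mono fun y hy => by rw [natDegree_derivative, hy]
  have cA' : ∀ k, ContinuousAt (fun y : Coeffs α β g => (derivative (polyA y)).coeff k) x := by
    intro k
    simp only [coeff_derivative]
    exact (cA _).mul continuousAt_const
  have a3 : ∀ᶠ y : Coeffs α β g in 𝓝 x, ρ = .line → 0 < ((polyA y).coeff (degA α β g)).re := by
    by_cases hρ : ρ = .line
    · have : 0 < ((polyA x).coeff (degA α β g)).re := by
        subst hρ
        have : x.1 (Fin.last _) = 1 := h1.normalised
        rw [coeff_polyA_top, this]; simp
      filter_upwards [(Complex.continuous_re.continuousAt.comp (cA (degA α β g))).tendsto.eventually_const_lt this] with y hy _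
      exact hy
    · exact Filter.Eventually.of_forall fun y h => absurd h hρ
  filter_upwards [a1, b1, a2, b2, eventually_isCoprime cA cA' dA dA' nA h2,
    eventually_isCoprime cA cB dA dB nA h3, a3] with y e1 e2 e3 e4 e5 e6 e7
  exact ⟨e1, by rwa [← coeff_polyB_top], e3, e4, e5, e6, e7⟩

end SpaceT

end Whitham

namespace Whitham

/-! ### Reality of the residues and the equations of `T`. -/

section ResidueReality

variable {α β g : ℕ} {ρ : Reality} {x y v : Coeffs α β g}

theorem coeff_polyA_of_real (hy : y ∈ realPairs α β g ρ) {k : ℕ} (hk : k ≤ degA α β g) :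
    (polyA y).coeff k = ρ.sign (degA α β g) k *
      (starRingEnd ℂ) ((polyA y).coeff (ρ.idx (degA α β g) k)) := by
  rw [← Reality.coeff_star hk, star_polyA hy]

theorem coeff_polyB_of_real (hy : y ∈ realPairs α β g ρ) {k : ℕ} (hk : k ≤ degB α β g) :
    (polyB y).coeff k = ρ.signB g * (ρ.sign (degB α β g) k *
      (starRingEnd ℂ) ((polyB y).coeff (ρ.idx (degB α β g) k))) := by
  rw [← Reality.coeff_star hk, ← coeff_C_mul, signB_mul_star_polyB hy]

/-- For odd `degB` the only antipodally real `b` would be zero; so a point of `P` forces the parity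
that the involution needs. -/
theorem even_degB (hx : IsSpectralData ρ x) : ρ = .antipodal → Even (degB α β g) := by
  intro h
  subst h
  by_contra hn
  have h1 := Reality.Fixes.eq_zero_of_odd (Reality.signB_mul_conj (ρ := .antipodal) g) hn hx.real_b
  have := hx.lead_ne_zero
  rw [← coeff_polyB_top, h1] at this
  exact this (coeff_zero _)

theorem IsSpectralData.mem_realPairs (hx : IsSpectralData ρ x) : x ∈ realPairs α β g ρ :=
  Whitham.mem_realPairs.2 ⟨hx.real_a, hx.real_b⟩

/-- The sign in the relation between the residue conditions over zero and infinity. -/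
noncomputable def residueSign (g : ℕ) : Reality → ℝ
  | .line => 1
  | .circle => -1
  | .antipodal => -(-1) ^ g

theorem residueSign_mul_self : residueSign g ρ * residueSign g ρ = 1 := by
  cases ρ <;> simp [residueSign, ← mul_pow]

/-- The relations between the residues over infinity and zero for real pairs. -/
def ResidueRel (ρ : Reality) (g : ℕ) (p q : ℂ) : Prop :=
  (ρ = .line → (starRingEnd ℂ) p = p ∧ (starRingEnd ℂ) q = q) ∧
    (ρ ≠ .line → q = residueSign g ρ * (starRingEnd ℂ) p)

theorem ResidueRel.sub {p q p' q' : ℂ} (h : ResidueRel ρ g p q) (h' : ResidueRel ρ g p' q') :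
    ResidueRel ρ g (p - p') (q - q') := by
  refine ⟨fun hρ => ?_, fun hρ => ?_⟩
  · rw [map_sub, map_sub, (h.1 hρ).1, (h.1 hρ).2, (h'.1 hρ).1, (h'.1 hρ).2]
    exact ⟨rfl, rfl⟩
  · rw [h.2 hρ, h'.2 hρ, map_sub]; ring

/-- This allows one complex equation to encode both residues in all cases. For `line` the terms are
the real and imaginary part; for the inversions `p` and `q` have equal modulus, so the factor `2`
rules out a cancellation. -/
theorem ResidueRel.sum_eq_zero_iff {p q : ℂ} (h : ResidueRel ρ g p q) (hρ : β = 0 → ρ = .line)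
    (hβ : β ≤ 1) : p + 2 * Complex.I * β * q = 0 ↔ p = 0 ∧ (β = 1 → q = 0) := by
  constructor
  · intro h0
    rcases Nat.eq_zero_or_pos β with hβ0 | hβ1
    · rw [hβ0] at h0
      refine ⟨by simpa using h0, fun h => by omega⟩
    · have hβ' : β = 1 := by omega
      rw [hβ'] at h0
      by_cases hl : ρ = .line
      · obtain ⟨p', hp⟩ := Complex.conj_eq_iff_real.1 (h.1 hl).1
        obtain ⟨q', hq⟩ := Complex.conj_eq_iff_real.1 (h.1 hl).2
        rw [hp, hq, Complex.ext_iff] at h0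
        simp at h0
        rw [hp, hq, h0.1, h0.2]; simp
      · have hq := h.2 hl
        have h1 : p = -(2 * Complex.I * q) := by
          rw [eq_neg_iff_add_eq_zero]; simpa using h0
        have h2 : ‖q‖ = ‖p‖ := by
          have hs : ‖(residueSign g ρ : ℂ)‖ = 1 := by
            rw [Complex.norm_real, Real.norm_eq_abs]
            rcases mul_self_eq_one_iff.1 (residueSign_mul_self (g := g) (ρ := ρ)) with e | e <;>
              simp [e]
          rw [hq, norm_mul, RCLike.norm_conj, hs, one_mul]
        have h3 := congrArg norm h1
        rw [norm_neg, norm_mul, norm_mul, Complex.norm_I, h2] at h3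
        simp only [Complex.norm_ofNat, mul_one] at h3
        have h4 : ‖p‖ = 0 := by linarith
        exact ⟨norm_eq_zero.1 h4, fun _ => norm_eq_zero.1 (h2.trans h4)⟩
  · rintro ⟨h1, h2⟩
    rcases Nat.eq_zero_or_pos β with hβ0 | hβ1
    · rw [h1, hβ0]; simp
    · rw [h1, h2 (by omega)]; simp

/-- The inversions interchange `0` and `∞`, so they also interchange the two residues up to
conjugation and sign; complex conjugation fixes both points. -/
theorem residueRel (hα : α = 1) (hρ : β = 0 → ρ = .line) (hβ : β ≤ 1) (hg : α ≤ g)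
    (he : ρ = .antipodal → Even (degB α β g)) (hy : y ∈ realPairs α β g ρ) :
    ResidueRel ρ g (residueInfty y) (residueZero y) := by
  have hdA : 1 ≤ degA α β g := by rw [degA]; omega
  have hdB : 1 ≤ degB α β g := by rw [degB]; omega
  have a0 := coeff_polyA_of_real hy (Nat.zero_le _)
  have a1 := coeff_polyA_of_real hy hdA
  have a2 := coeff_polyA_of_real hy (Nat.sub_le (degA α β g) 1)
  have a3 := coeff_polyA_of_real hy (le_refl (degA α β g))
  have b0 := coeff_polyB_of_real hy (Nat.zero_le _)
  have b1 := coeff_polyB_of_real hy hdB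
  have b2 := coeff_polyB_of_real hy (Nat.sub_le (degB α β g) 1)
  have b3 := coeff_polyB_of_real hy (le_refl (degB α β g))
  refine ⟨fun hl => ?_, fun hl => ?_⟩
  · subst hl
    simp only [Reality.sign, Reality.idx, one_mul, Reality.signB] at a0 a1 a2 a3 b0 b1 b2 b3
    simp only [residueInfty, residueZero, map_sub, map_mul, Complex.conj_ofNat, ← a0, ← a1, ← a2,
      ← a3, ← b0, ← b1, ← b2, ← b3, and_self]
  · have hβ' : β = 1 := by
      by_contra h
      exact hl (hρ (by omega))
    cases ρ
    · exact absurd rfl hl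
    · simp only [Reality.sign, Reality.idx, one_mul, Reality.signB, Nat.sub_zero] at a0 a1 b0 b1
      rw [residueZero, a0, a1, b0, b1, residueInfty]
      simp only [map_sub, map_mul, Complex.conj_ofNat, residueSign]
      push_cast; ring
    · have eA : Even (degA α β g) := even_degA hβ'
      have oA : Odd (degA α β g - 1) := Nat.Even.sub_odd hdA eA odd_one
      have oB : Odd (degB α β g - 1) := Nat.Even.sub_odd hdB (he rfl) odd_one
      simp only [Reality.sign, Reality.idx, Reality.signB, Nat.sub_zero, eA.neg_one_pow,
        (he rfl).neg_one_pow, oA.neg_one_pow, oB.neg_one_pow] at a0 a1 b0 b1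
      rw [residueZero, a0, a1, b0, b1, residueInfty]
      simp only [map_sub, map_mul, Complex.conj_ofNat, residueSign]
      push_cast; ring

end ResidueReality

section Constraint

variable {α β g : ℕ} {ρ : Reality} {x y v : Coeffs α β g}

/-- The constraint is quadratic, so its derivative is obtained by polarisation, without
differentiating each coefficient. -/
theorem fderiv_apply_of_quadratic {E F : Type*} [NormedAddCommGroup E] [NormedSpace ℝ E]
    [NormedAddCommGroup F] [NormedSpace ℝ F] {f : E → F} {x v : E} {d q : F}
    (hf : DifferentiableAt ℝ f x) (h : ∀ t : ℝ, f (x + t • v) = f x + t • d + t ^ 2 • q) :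
    fderiv ℝ f x v = d := by
  have h1 : HasDerivAt (fun t : ℝ => f (x + t • v)) (fderiv ℝ f x v) 0 :=
    hf.hasFDerivAt.hasLineDerivAt v
  have h2 : HasDerivAt (fun t : ℝ => f x + t • d + t ^ 2 • q) d 0 := by
    have := (((hasDerivAt_id (0 : ℝ)).smul_const d).const_add (f x)).add
      (((hasDerivAt_id (0 : ℝ)).pow 2).smul_const q)
    simp at this
    exact this
  rw [funext h] at h1
  exact h1.unique h2

/-- The polarisation of `residueInfty`. -/
noncomputable def polarInfty (x v : Coeffs α β g) : ℂ :=
  residueInfty (x + v) - residueInfty x - residueInfty v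

/-- The polarisation of `residueZero`. -/
noncomputable def polarZero (x v : Coeffs α β g) : ℂ :=
  residueZero (x + v) - residueZero x - residueZero v

/-- The equations of `T` inside of the space of real pairs. -/
noncomputable def constraint (x : Coeffs α β g) : ℝ × ℂ :=
  (‖coeffA (degA α β g) x‖ ^ 2 - 1,
    (α : ℂ) * (residueInfty x + 2 * Complex.I * β * residueZero x))

theorem contDiff_constraint : ContDiff ℝ ∞ (constraint : Coeffs α β g → ℝ × ℂ) := by
  have cA : ∀ k, ContDiff ℝ ∞ (fun x : Coeffs α β g => (polyA x).coeff k) := fun k =>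
    (coeffA k).contDiff
  have cB : ∀ k, ContDiff ℝ ∞ (fun x : Coeffs α β g => (polyB x).coeff k) := fun k =>
    (coeffB k).contDiff
  refine ContDiff.prodMk ((ContDiff.norm_sq ℝ (cA _)).sub contDiff_const) ?_
  simp only [residueInfty, residueZero]
  fun_prop

theorem fderiv_constraint : fderiv ℝ constraint x v =
    (2 * (((polyA x).coeff (degA α β g)).re * ((polyA v).coeff (degA α β g)).re +
        ((polyA x).coeff (degA α β g)).im * ((polyA v).coeff (degA α β g)).im),
      (α : ℂ) * (polarInfty x v + 2 * Complex.I * β * polarZero x v)) := by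
  refine fderiv_apply_of_quadratic (q := (‖coeffA (degA α β g) v‖ ^ 2, 
    (α : ℂ) * (residueInfty v + 2 * Complex.I * β * residueZero v)))
    (contDiff_constraint.contDiffAt.differentiableAt (by simp)) fun t => ?_
  refine Prod.ext ?_ ?_
  · simp only [constraint, map_add, map_smul, Complex.sq_norm, Complex.normSq_apply, coeffA_apply,
      Prod.fst_add, Prod.smul_fst, Complex.add_re, Complex.add_im, smul_eq_mul, Complex.real_smul,
      Complex.re_ofReal_mul, Complex.im_ofReal_mul]
    ring
  · simp only [constraint, polarInfty, polarZero, residueInfty, residueZero, polyA_add, polyB_add,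
      polyA_smul, polyB_smul, coeff_add, coeff_C_mul, Prod.snd_add, Prod.smul_snd,
      Complex.real_smul]
    push_cast; ring

/-- The tangent space of `T`. -/
noncomputable def tangentSpace (ρ : Reality) (x : Coeffs α β g) : Submodule ℝ (Coeffs α β g) :=
  realPairs α β g ρ ⊓ (fderiv ℝ constraint x : Coeffs α β g →ₗ[ℝ] ℝ × ℂ).ker

theorem mem_tangentSpace : v ∈ tangentSpace ρ x ↔
    v ∈ realPairs α β g ρ ∧ fderiv ℝ constraint x v = 0 := Iff.rfl

theorem mem_tangentSpace_iff (hα : α ≤ 1) (hβ : β ≤ 1) (hg : α ≤ g) (hρ : β = 0 → ρ = .line)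
    (he : ρ = .antipodal → Even (degB α β g)) (hx : x ∈ realPairs α β g ρ) :
    v ∈ tangentSpace ρ x ↔ v ∈ realPairs α β g ρ ∧
      ((polyA x).coeff (degA α β g)).re * ((polyA v).coeff (degA α β g)).re +
        ((polyA x).coeff (degA α β g)).im * ((polyA v).coeff (degA α β g)).im = 0 ∧
      (α = 1 → polarInfty x v = 0 ∧ (β = 1 → polarZero x v = 0)) := by
  rw [mem_tangentSpace, fderiv_constraint]
  refine and_congr_right fun hv => ?_
  rw [Prod.mk_eq_zero]
  refine and_congr (by simp) ?_
  rcases Nat.eq_zero_or_pos α with h0 | h1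
  · rw [show (α : ℂ) = 0 by exact_mod_cast h0, zero_mul]
    exact ⟨fun _ h => by omega, fun _ => rfl⟩
  · have hα' : α = 1 := by omega
    have hrel : ResidueRel ρ g (polarInfty x v) (polarZero x v) :=
      ((residueRel hα' hρ hβ hg he ((realPairs α β g ρ).add_mem hx hv)).sub
        (residueRel hα' hρ hβ hg he hx)).sub (residueRel hα' hρ hβ hg he hv)
    rw [← hrel.sum_eq_zero_iff hρ hβ, show (α : ℂ) = 1 by exact_mod_cast hα', one_mul]
    exact ⟨fun h _ => h, fun h => h hα'⟩

theorem norm_coeff_zero (hβ : β = 1) (hρ : ρ ≠ .line) (hx : x ∈ realPairs α β g ρ) :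
    ‖(polyA x).coeff 0‖ = ‖(polyA x).coeff (degA α β g)‖ := by
  rw [coeff_polyA_of_real hx (Nat.zero_le _), norm_mul, RCLike.norm_conj]
  cases ρ <;> simp_all [Reality.sign, Reality.idx]

/-- For real pairs the top coefficient alone carries the normalisation: under an inversion the
lowest one has the same modulus, and for `line` a positive real number of modulus `1` is `1`. -/
theorem spaceT_eventually_iff (hα : α ≤ 1) (hβ : β ≤ 1) (hg : α ≤ g) (hρ : β = 0 → ρ = .line)
    (hx : x ∈ spaceT α β g ρ) :
    ∀ᶠ y in 𝓝 x, y ∈ spaceT α β g ρ ↔ y ∈ realPairs α β g ρ ∧ constraint y = 0 := by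
  have he := even_degB (mem_spaceT_iff.1 hx).1
  filter_upwards [eventually_mem_openConditions hα hx] with y ⟨h1, h2, h3, h4, h5, h6, h7⟩
  have hfst : y.1 0 = (polyA y).coeff 0 := (coeff_toPoly_fin y.1 0).symm
  have key : y ∈ realPairs α β g ρ → (constraint y = 0 ↔
      Normalised ρ y ∧ (α = 1 → residueInfty y = 0) ∧ (β = 1 → α = 1 → residueZero y = 0)) := by
    intro hy
    rw [constraint, Prod.mk_eq_zero, coeffA_apply]
    have hn : ‖(polyA y).coeff (degA α β g)‖ ^ 2 - 1 = 0 ↔ Normalised ρ y := by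
      have e1 : ‖(polyA y).coeff (degA α β g)‖ ^ 2 - 1 = 0 ↔
          ‖(polyA y).coeff (degA α β g)‖ = 1 := by
        rw [sub_eq_zero]
        exact pow_eq_one_iff_of_nonneg (norm_nonneg _) two_ne_zero
      rw [e1]
      by_cases hl : ρ = .line
      · subst hl
        have hr : (polyA y).coeff (degA α β g) = (((polyA y).coeff (degA α β g)).re : ℂ) := by
          have := coeff_polyA_of_real hy (le_refl (degA α β g))
          simp only [Reality.sign, Reality.idx, one_mul] at this
          exact (Complex.conj_eq_iff_re.1 this.symm).symm
        have hp := h7 rfl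
        show _ ↔ y.1 (Fin.last _) = 1
        rw [← coeff_polyA_top, hr, Complex.norm_real, Real.norm_of_nonneg hp.le]
        norm_cast
      · have hβ' : β = 1 := by
          by_contra h
          exact hl (hρ (by omega))
        have h0 := norm_coeff_zero hβ' hl hy
        have : Normalised ρ y ↔ ‖y.1 (Fin.last _)‖ = 1 ∧ ‖y.1 0‖ = 1 := by
          cases ρ
          · exact absurd rfl hl
          · exact Iff.rfl
          · exact Iff.rfl
        rw [this, ← coeff_polyA_top, hfst, h0, and_self]
    rw [hn]
    refine and_congr_right fun _ => ?_
    rcases Nat.eq_zero_or_pos α with h0 | h1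
    · rw [show (α : ℂ) = 0 by exact_mod_cast h0, zero_mul]
      exact ⟨fun _ => ⟨fun h => by omega, fun _ h => by omega⟩, fun _ => rfl⟩
    · have hα' : α = 1 := by omega
      rw [show (α : ℂ) = 1 by exact_mod_cast hα', one_mul,
        (residueRel hα' hρ hβ hg he hy).sum_eq_zero_iff hρ hβ]
      exact ⟨fun h => ⟨fun _ => h.1, fun hb _ => h.2 hb⟩, fun h => ⟨h.1 hα', fun hb => h.2 hb hα'⟩⟩
  rw [mem_spaceT_iff]
  constructor
  · rintro ⟨hs, -, -⟩
    exact ⟨hs.mem_realPairs, (key hs.mem_realPairs).2 ⟨hs.normalised,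
      (residue_infty_iff hα hβ hg h1).1 hs.residue_infty,
      fun hb => (residue_zero_iff hα hb (h3 hb)).1 (hs.residue_zero hb)⟩⟩
  · rintro ⟨hy, hc⟩
    obtain ⟨k1, k2, k3⟩ := (key hy).1 hc
    obtain ⟨r1, r2⟩ := mem_realPairs.1 hy
    exact ⟨⟨k1, h2, h3, h4, r1, r2, (residue_infty_iff hα hβ hg h1).2 k2,
      fun hb => (residue_zero_iff hα hb (h3 hb)).2 (k3 hb)⟩, h5, h6⟩

end Constraint

end Whitham

namespace Whitham

/-! ### Surjectivity of the linearised constraint. -/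

section Surjective

variable {α β g : ℕ} {ρ : Reality} {x y v : Coeffs α β g}

/-- The real vector space in which the residue conditions take their values. -/
noncomputable def residueSpace (α β : ℕ) : Submodule ℝ ℂ :=
  if α = 0 then ⊥ else if β = 0 then LinearMap.range (Complex.ofRealCLM : ℝ →ₗ[ℝ] ℂ) else ⊤

theorem finrank_residueSpace (hα : α ≤ 1) (hβ : β ≤ 1) :
    Module.finrank ℝ (residueSpace α β) = α + α * β := by
  have h1 : Module.finrank ℝ (LinearMap.range (Complex.ofRealCLM : ℝ →ₗ[ℝ] ℂ)) = 1 := by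
    rw [LinearMap.finrank_range_of_inj Complex.ofReal_injective, Module.finrank_self]
  rw [residueSpace]
  interval_cases α <;> interval_cases β
  · simp
  · simp
  · simpa using h1
  · simp

theorem constraintSum_mem_residueSpace {p q : ℂ} (hρ : β = 0 → ρ = .line)
    (h : α = 1 → ResidueRel ρ g p q) (hα : α ≤ 1) :
    (α : ℂ) * (p + 2 * Complex.I * β * q) ∈ residueSpace α β := by
  rw [residueSpace]
  split_ifs with h0 h1
  · rw [show (α : ℂ) = 0 by exact_mod_cast h0, zero_mul]; exact Submodule.zero_mem _
  · have hα' : α = 1 := by omega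
    obtain ⟨r, hr⟩ := Complex.conj_eq_iff_real.1 (((h hα').1 (hρ h1)).1)
    rw [show (α : ℂ) = 1 by exact_mod_cast hα', show (β : ℂ) = 0 by exact_mod_cast h1]
    exact ⟨r, by simp [hr]⟩
  · trivial

theorem polarRel (hα : α = 1) (hρ : β = 0 → ρ = .line) (hβ : β ≤ 1) (hg : α ≤ g)
    (he : ρ = .antipodal → Even (degB α β g)) (hx : x ∈ realPairs α β g ρ)
    (hv : v ∈ realPairs α β g ρ) : ResidueRel ρ g (polarInfty x v) (polarZero x v) :=
  ((residueRel hα hρ hβ hg he ((realPairs α β g ρ).add_mem hx hv)).sub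
    (residueRel hα hρ hβ hg he hx)).sub (residueRel hα hρ hβ hg he hv)

theorem add_conjPair_mem (hρ : β = 0 → ρ = .line) (hβ : β ≤ 1)
    (he : ρ = .antipodal → Even (degB α β g)) (v : Coeffs α β g) :
    v + conjPair ρ v ∈ realPairs α β g ρ := by
  show conjPair ρ (v + conjPair ρ v) = v + conjPair ρ v
  rw [map_add, conjPair_conjPair hρ hβ he, add_comm]

theorem polarInfty_of_polyA_eq_zero (h : polyA v = 0) : polarInfty x v =
    2 * (polyA x).coeff (degA α β g) * (polyB v).coeff (degB α β g - 1) -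
    (polyA x).coeff (degA α β g - 1) * (polyB v).coeff (degB α β g) := by
  simp only [polarInfty, residueInfty, polyA_add, polyB_add, h, coeff_add, coeff_zero]; ring

theorem polarZero_of_polyA_eq_zero (h : polyA v = 0) : polarZero x v =
    2 * (polyA x).coeff 0 * (polyB v).coeff 1 - (polyA x).coeff 1 * (polyB v).coeff 0 := by
  simp only [polarZero, residueZero, polyA_add, polyB_add, h, coeff_add, coeff_zero]; ring

theorem exists_polar_eq (hα : α = 1) (hρ : β = 0 → ρ = .line) (hβ : β ≤ 1) (hg : α ≤ g)
    (he : ρ = .antipodal → Even (degB α β g)) (hx : x ∈ realPairs α β g ρ)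
    (h1 : (polyA x).coeff (degA α β g) ≠ 0) (h2 : β = 1 → (polyA x).coeff 0 ≠ 0) {w : ℂ}
    (hw : β = 0 → (starRingEnd ℂ) w = w) :
    ∃ v ∈ realPairs α β g ρ, polyA v = 0 ∧
      polarInfty x v + 2 * Complex.I * β * polarZero x v = w := by
  have hdB : degB α β g = g + 2 * β := by rw [degB, hα]; ring
  by_cases hl : ρ = .line
  · obtain ⟨q, hq, hq0, hq1⟩ : ∃ q : ℂ, (starRingEnd ℂ) q = q ∧ (β = 0 → q = 0) ∧
        (β = 1 → 4 * (polyA x).coeff 0 * q = w.im) := by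
      rcases Nat.eq_zero_or_pos β with hβ0 | hβ1
      · exact ⟨0, by simp, fun _ => rfl, fun h => by omega⟩
      · have hβ' : β = 1 := by omega
        have hr := coeff_polyA_of_real hx (Nat.zero_le _)
        rw [hl] at hr
        simp only [Reality.sign, Reality.idx, one_mul] at hr
        have h2' := h2 hβ'
        refine ⟨w.im / (4 * (polyA x).coeff 0), ?_, fun h => by omega, fun _ => by field_simp⟩
        rw [map_div₀, map_mul, ← hr, Complex.conj_ofReal, Complex.conj_ofNat]
    obtain ⟨p, hp, hp1⟩ : ∃ p : ℂ, (starRingEnd ℂ) p = p ∧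
        2 * (polyA x).coeff (degA α β g) * p = w.re := by
      have hr := coeff_polyA_of_real hx (le_refl (degA α β g))
      rw [hl] at hr
      simp only [Reality.sign, Reality.idx, one_mul] at hr
      refine ⟨w.re / (2 * (polyA x).coeff (degA α β g)), ?_, by field_simp⟩
      rw [map_div₀, map_mul, ← hr, Complex.conj_ofReal, Complex.conj_ofNat]
    -- Only the second highest and the second lowest coefficient of `ḃ` are used: `p` adjusts the
    -- residue at infinity and `q` the one at zero. They do not interfere, since `degB = g + 2` is
    -- at least `3` when `β = 1`.
    set B : ℂ[X] := C p * X ^ (degB α β g - 1) + C q * X with hB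
    have hBd : B.natDegree ≤ degB α β g := by
      refine natDegree_add_le_of_degree_le ((natDegree_C_mul_X_pow_le _ _).trans (by omega)) ?_
      exact (natDegree_C_mul_le _ _).trans (natDegree_X_le.trans (by omega))
    let v : Coeffs α β g := (0, ofPoly _ B)
    have hA : polyA v = 0 := by simp [polyA, v, toPoly]
    have hBv : polyB v = B := toPoly_ofPoly hBd
    refine ⟨v, mem_realPairs.2 ⟨?_, ?_⟩, hA, ?_⟩
    · intro z _; rw [hA]; simp
    · intro z _
      rw [hBv, hB, hl]
      simp [Reality.factor, Reality.conj, Reality.signB, hp, hq]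
    · rw [polarInfty_of_polyA_eq_zero hA, polarZero_of_polyA_eq_zero hA, hBv, hB]
      simp only [coeff_add, coeff_C_mul, coeff_X_pow, coeff_X, if_true]
      rcases Nat.eq_zero_or_pos β with hβ0 | hβ1
      · have : (w.re : ℂ) = w := Complex.conj_eq_iff_re.1 (hw hβ0)
        rw [hq0 hβ0, if_neg (show ¬ degB α β g = degB α β g - 1 by omega),
          show (β : ℂ) = 0 by exact_mod_cast hβ0]
        linear_combination hp1 + this
      · have hβ' : β = 1 := by omega
        rw [if_neg (show ¬ degB α β g = degB α β g - 1 by omega),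
          if_neg (show ¬ 1 = degB α β g - 1 by omega), if_neg (show ¬ 1 = degB α β g by omega),
          if_neg (show ¬ 0 = degB α β g - 1 by omega), if_neg (show ¬ 1 = 0 by omega),
          show (β : ℂ) = 1 by exact_mod_cast hβ']
        linear_combination hp1 + Complex.I * hq1 hβ' + Complex.re_add_im w
  · have hβ' : β = 1 := by
      by_contra h
      exact hl (hρ (by omega))
    set κ : ℂ := ((residueSign g ρ : ℝ) : ℂ) with hκ
    have hκ2 : κ * κ = 1 := by
      rw [hκ, ← Complex.ofReal_mul, residueSign_mul_self, Complex.ofReal_one]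
    -- This inverts the real linear map `u ↦ u + 2 i κ conj u`; the denominator is `1 - |2 i κ| ^ 2
    -- = -3`.
    set u : ℂ := (w - 2 * Complex.I * κ * (starRingEnd ℂ) w) / (-3) with hu
    have hu1 : u + 2 * Complex.I * κ * (starRingEnd ℂ) u = w := by
      rw [hu]
      simp only [map_div₀, map_sub, map_mul, map_neg, Complex.conj_ofNat, Complex.conj_I,
        Complex.conj_conj, hκ, Complex.conj_ofReal]
      rw [← hκ]
      linear_combination (4 / 3 * w) * hκ2 - (4 / 3 * κ ^ 2 * w) * Complex.I_sq
    set p : ℂ := u / (2 * (polyA x).coeff (degA α β g)) with hp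
    have hBd : (C p * X ^ (degB α β g - 1) : ℂ[X]).natDegree ≤ degB α β g :=
      (natDegree_C_mul_X_pow_le _ _).trans (by omega)
    let v0 : Coeffs α β g := (0, ofPoly _ (C p * X ^ (degB α β g - 1)))
    have hA0 : polyA v0 = 0 := by simp [polyA, v0, toPoly]
    have hB0 : polyB v0 = C p * X ^ (degB α β g - 1) := toPoly_ofPoly hBd
    have hA : polyA (v0 + conjPair ρ v0) = 0 := by
      rw [polyA_add, polyA_conjPair, hA0, zero_add]
      have := Reality.star_C_mul (ρ := ρ) (n := degA α β g) (p := 0) 0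
      simpa using this
    have hv := add_conjPair_mem hρ hβ he v0
    refine ⟨v0 + conjPair ρ v0, hv, hA, ?_⟩
    have hrel := (polarRel hα hρ hβ hg he hx hv).2 hl
    have hinf : polarInfty x (v0 + conjPair ρ v0) = u := by
      have i1 : ρ.idx (degB α β g) (degB α β g - 1) = 1 := by
        cases ρ
        · exact absurd rfl hl
        · simp only [Reality.idx]; omega
        · simp only [Reality.idx]; omega
      have i2 : ρ.idx (degB α β g) (degB α β g) = 0 := by
        cases ρ
        · exact absurd rfl hl
        · simp only [Reality.idx]; omega
        · simp only [Reality.idx]; omega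
      rw [polarInfty_of_polyA_eq_zero hA, polyB_add, polyB_conjPair, hB0, coeff_add, coeff_add,
        coeff_C_mul, coeff_C_mul (ρ.star _ _), coeff_C_mul, coeff_C_mul (ρ.star _ _), 
        Reality.coeff_star (Nat.sub_le _ _),
        Reality.coeff_star le_rfl, i1, i2, coeff_C_mul, coeff_C_mul, coeff_X_pow, coeff_X_pow,
        coeff_X_pow, coeff_X_pow, if_pos rfl,
        if_neg (show ¬ degB α β g = degB α β g - 1 by omega),
        if_neg (show ¬ 1 = degB α β g - 1 by omega), if_neg (show ¬ 0 = degB α β g - 1 by omega)]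
      simp only [mul_zero, map_zero, add_zero, mul_one, sub_zero]
      rw [hp]; field_simp
    rw [hrel, hinf, ← hu1, show (β : ℂ) = 1 by exact_mod_cast hβ']
    ring

/-- The direction of the rescaling `(a, b) ↦ (t ^ 2 a, t b)`. -/
noncomputable def scaling (x : Coeffs α β g) : Coeffs α β g := ((2 : ℝ) • x.1, x.2)

theorem polyA_scaling : polyA (scaling x) = 2 * polyA x :=
  toPoly_smul 2 x.1

theorem polyB_scaling : polyB (scaling x) = polyB x := rfl

theorem scaling_mem (hx : x ∈ realPairs α β g ρ) : scaling x ∈ realPairs α β g ρ := by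
  obtain ⟨h1, h2⟩ := mem_realPairs.1 hx
  refine mem_realPairs.2 ⟨fun z hz => ?_, h2⟩
  have := h1 z hz
  rw [polyA_scaling, eval_mul, eval_mul, ← this, map_mul]
  simp only [eval_ofNat, Complex.conj_ofNat]
  ring

theorem polarInfty_scaling : polarInfty x (scaling x) = 3 * residueInfty x := by
  simp only [polarInfty, residueInfty, polyA_add, polyB_add, polyA_scaling, polyB_scaling,
    coeff_add, coeff_ofNat_mul]
  ring

theorem polarZero_scaling : polarZero x (scaling x) = 3 * residueZero x := by
  simp only [polarZero, residueZero, polyA_add, polyB_add, polyA_scaling, polyB_scaling,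
    coeff_add, coeff_ofNat_mul]
  ring

theorem constraint_eq_zero (hα : α ≤ 1) (hβ : β ≤ 1) (hg : α ≤ g) (hρ : β = 0 → ρ = .line)
    (hx : x ∈ spaceT α β g ρ) : constraint x = 0 :=
  (((spaceT_eventually_iff hα hβ hg hρ hx).self_of_nhds).1 hx).2

theorem norm_top (hα : α ≤ 1) (hβ : β ≤ 1) (hg : α ≤ g) (hρ : β = 0 → ρ = .line)
    (hx : x ∈ spaceT α β g ρ) :
    ((polyA x).coeff (degA α β g)).re * ((polyA x).coeff (degA α β g)).re +
        ((polyA x).coeff (degA α β g)).im * ((polyA x).coeff (degA α β g)).im = 1 := by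
  have := congrArg Prod.fst (constraint_eq_zero hα hβ hg hρ hx)
  simp only [constraint, Complex.sq_norm, Complex.normSq_apply, coeffA_apply, Prod.fst_zero] at this
  linarith

/-- Under `(t ^ 2 a, t b)` the squared modulus of the top coefficient has weight `4`. The residue
numbers have weight `3` and vanish on `T`. -/
theorem fderiv_constraint_scaling (hα : α ≤ 1) (hβ : β ≤ 1) (hg : α ≤ g) (hρ : β = 0 → ρ = .line)
    (hx : x ∈ spaceT α β g ρ) : fderiv ℝ constraint x (scaling x) = (4, 0) := by
  have h1 := norm_top hα hβ hg hρ hx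
  have h2 := congrArg Prod.snd (constraint_eq_zero hα hβ hg hρ hx)
  simp only [constraint, Prod.snd_zero] at h2
  rw [fderiv_constraint, polarInfty_scaling, polarZero_scaling, polyA_scaling, coeff_ofNat_mul]
  refine Prod.ext ?_ ?_
  · simp only [Complex.mul_re, Complex.mul_im, Complex.re_ofNat, Complex.im_ofNat]
    linear_combination 4 * h1
  · linear_combination 3 * h2

theorem finrank_submodule_prod {E F : Type*} [AddCommGroup E] [Module ℝ E] [AddCommGroup F]
    [Module ℝ F] [FiniteDimensional ℝ E] [FiniteDimensional ℝ F] (p : Submodule ℝ E)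
    (q : Submodule ℝ F) :
    Module.finrank ℝ (p.prod q) = Module.finrank ℝ p + Module.finrank ℝ q := by
  have h : LinearMap.range (p.subtype.prodMap q.subtype) = p.prod q := by
    rw [LinearMap.range_prodMap]; simp
  rw [← h, LinearMap.finrank_range_of_inj, Module.finrank_prod]
  exact Function.Injective.prodMap p.injective_subtype q.injective_subtype

theorem exists_isLocalSubmersion_spaceT (hα : α ≤ 1) (hβ : β ≤ 1) (hg : α ≤ g)
    (hρ : β = 0 → ρ = .line) (hx : x ∈ spaceT α β g ρ) :
    ∃ (V : Submodule ℝ (Coeffs α β g)) (S : Submodule ℝ (ℝ × ℂ)) (f : Coeffs α β g → V × S),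
      IsLocalSubmersion (spaceT α β g ρ) x f Set.univ ∧
      3 * g + 2 + α * β - 2 * α + Module.finrank ℝ (V × S) = Module.finrank ℝ (Coeffs α β g) ∧
      ∀ v, fderiv ℝ f x v = 0 ↔ v ∈ tangentSpace ρ x := by
  obtain ⟨h1, h2, h3⟩ := mem_spaceT_iff.1 hx
  have he := even_degB h1
  have hxV := h1.mem_realPairs
  have hS : ∀ t : ℝ, ∀ p q : ℂ, (α = 1 → ResidueRel ρ g p q) →
      (t, (α : ℂ) * (p + 2 * Complex.I * β * q)) ∈
        (⊤ : Submodule ℝ ℝ).prod (residueSpace α β) := fun t p q h =>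
    ⟨trivial, constraintSum_mem_residueSpace hρ h hα⟩
  obtain ⟨V', f, hf, hdim, hker⟩ := exists_isLocalSubmersion (realPairs α β g ρ)
    ((⊤ : Submodule ℝ ℝ).prod (residueSpace α β)) contDiff_constraint hx
    (spaceT_eventually_iff hα hβ hg hρ hx)
    (fun y hy => hS _ _ _ fun hα' => residueRel hα' hρ hβ hg he hy)
    (fun v hv => by
      rw [fderiv_constraint]
      exact hS _ _ _ fun hα' => polarRel hα' hρ hβ hg he hxV hv)
    (by
      rintro ⟨t, w⟩ ⟨-, hw⟩
      change w ∈ residueSpace α β at hw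
      have hw' : ∃ v ∈ realPairs α β g ρ, fderiv ℝ constraint x v = (0, w) := by
        rcases Nat.eq_zero_or_pos α with hα0 | hα1
        · refine ⟨0, Submodule.zero_mem _, ?_⟩
          rw [residueSpace, if_pos hα0] at hw
          rw [map_zero, (Submodule.mem_bot ℝ).1 hw]; rfl
        · have hα' : α = 1 := by omega
          obtain ⟨v, hv, hA, hp⟩ := exists_polar_eq hα' hρ hβ hg he hxV
            (by rw [coeff_polyA_top]; exact h1.normalised.top_ne_zero)
            (fun h => by rw [coeff_zero_eq_eval_zero]; exact h1.eval_zero_a h) (w := w)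
            (fun hβ0 => by
              rw [residueSpace, if_neg (by omega), if_pos hβ0] at hw
              obtain ⟨r, hr⟩ := hw
              rw [← hr]; exact Complex.conj_ofReal r)
          refine ⟨v, hv, ?_⟩
          rw [fderiv_constraint, hp, hA, show (α : ℂ) = 1 by exact_mod_cast hα']
          simp
      obtain ⟨v, hv, hvw⟩ := hw'
      refine ⟨(t / 4) • scaling x + v, Submodule.add_mem _ (Submodule.smul_mem _ _
        (scaling_mem hxV)) hv, ?_⟩
      rw [map_add, map_smul, fderiv_constraint_scaling hα hβ hg hρ hx, hvw]
      refine Prod.ext ?_ ?_ <;> simp)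
  refine ⟨V', _, f, hf, ?_, fun v => (hker v).trans mem_tangentSpace.symm⟩
  rw [Module.finrank_prod, finrank_submodule_prod, finrank_residueSpace hα hβ, finrank_top,
    Module.finrank_self, ← hdim, finrank_realPairs hρ hβ he]
  have : 3 * g + 2 + α * β - 2 * α + (1 + (α + α * β)) = degA α β g + degB α β g + 2 := by
    rw [degA, degB]
    interval_cases α <;> interval_cases β <;> omega
  omega

theorem tangentVectors_spaceT (hα : α ≤ 1) (hβ : β ≤ 1) (hg : α ≤ g) (hρ : β = 0 → ρ = .line)
    (hx : x ∈ spaceT α β g ρ) : tangentVectors (spaceT α β g ρ) x = tangentSpace ρ x := by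
  obtain ⟨V, S, f, hf, -, hker⟩ := exists_isLocalSubmersion_spaceT hα hβ hg hρ hx
  rw [hf.tangentVectors_eq]
  ext v
  exact hker v

theorem isSmoothSubmanifold_spaceT (hα : α ≤ 1) (hβ : β ≤ 1) (hg : α ≤ g) (hρ : β = 0 → ρ = .line) :
    IsSmoothSubmanifold (3 * g + 2 + α * β - 2 * α) (spaceT α β g ρ) := by
  intro x hx
  obtain ⟨V, S, f, hf, hd, -⟩ := exists_isLocalSubmersion_spaceT hα hβ hg hρ hx
  exact hf.exists_submersion hd

end Surjective

end Whitham

namespace Whitham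

/-! ### The correspondence between tangent vectors and polynomials `c`. -/

section Flow

variable {α β g : ℕ} {ρ : Reality} {x y v w : Coeffs α β g} {c c' : ℂ[X]}

theorem integrability_iff : Integrability x v c ↔
    X ^ (1 - β) * (2 * polyA x * polyB v - polyA v * polyB x) =
      flowRHS (β * (1 + α)) (polyA x) c := Iff.rfl

theorem Integrability.add (h : Integrability x v c) (h' : Integrability x w c') :
    Integrability x (v + w) (c + c') := by
  rw [integrability_iff] at *
  rw [flowRHS_add, ← h, ← h', polyA_add, polyB_add]; ring

theorem Integrability.smul (t : ℝ) (h : Integrability x v c) :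
    Integrability x (t • v) (C (t : ℂ) * c) := by
  rw [integrability_iff] at *
  rw [flowRHS_C_mul, ← h, polyA_smul, polyB_smul]; ring

theorem Integrability.sub (h : Integrability x v c) (h' : Integrability x w c') :
    Integrability x (v - w) (c - c') := by
  have := h.add (h'.smul (-1))
  simpa [sub_eq_add_neg] using this

theorem integrability_scaling : Integrability x (scaling x) 0 := by
  rw [integrability_iff, polyA_scaling, polyB_scaling, flowRHS]; simp

theorem degA_add_degC (hα : α ≤ 1) (hβ : β ≤ 1) :
    degA α β g + degC α β g = 1 - β + (degA α β g + degB α β g) := by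
  rw [degA, degB, degC]; interval_cases β <;> omega

theorem two_mul_degC (hα : α ≤ 1) (hβ : β = 1) :
    2 * degC α β g = degA α β g + 2 * (β * (1 + α)) := by
  subst hβ; rw [degA, degC]; interval_cases α <;> omega

theorem two_mul_degC_eq (hα : α = 1) (hβ : β ≤ 1) :
    2 * degC α β g = degA α β g + β * (1 + α) + 2 := by
  subst hα; rw [degA, degC]; interval_cases β <;> omega

theorem le_two_mul_degC (hα : α ≤ 1) (hβ : β ≤ 1) :
    degA α β g + β * (1 + α) ≤ 2 * degC α β g := by
  rw [degA, degC]; interval_cases α <;> interval_cases β <;> omega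

theorem degB_eq_degC (hβ : β = 1) : degB α β g = degC α β g := by
  subst hβ; rw [degB, degC]

theorem beta_of_ne_line (hβ : β ≤ 1) (hρ : β = 0 → ρ = .line) (hl : ρ ≠ .line) : β = 1 := by
  by_contra h
  exact hl (hρ (by omega))

theorem even_degC (hβ : β ≤ 1) (hρ : β = 0 → ρ = .line)
    (he : ρ = .antipodal → Even (degB α β g)) : ρ = .antipodal → Even (degC α β g) := fun h => by
  rw [← degB_eq_degC (beta_of_ne_line hβ hρ (by rw [h]; simp))]
  exact he h

/-- The signs in the reality conditions on `b` and `c` are matched so that the flow equation is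
equivariant. In the antipodal case this is the evenness of `degB = g + 1 + α`. -/
theorem signB_mul_flip (hβ : β ≤ 1) (hρ : β = 0 → ρ = .line)
    (he : ρ = .antipodal → Even (degB α β g)) : ρ.signB g * ρ.flip = ρ.signC α := by
  cases ρ
  · simp [Reality.signB, Reality.flip, Reality.signC]
  · simp [Reality.signB, Reality.flip, Reality.signC]
  · have hβ' : β = 1 := beta_of_ne_line hβ hρ (by simp)
    have h1 : ((-1) : ℂ) ^ (g + 1 + α) = 1 := by
      have := (he rfl).neg_one_pow (α := ℂ)
      rwa [degB, hβ', mul_one] at this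
    have h2 : ((-1) : ℂ) ^ α * (-1) ^ α = 1 := by rw [← mul_pow]; simp
    simp only [Reality.signB, Reality.flip, Reality.signC]
    rw [pow_add, pow_add] at h1
    linear_combination (-1) ^ α * h1 - (-1) ^ g * (-1) * h2

theorem star_X_pow (hβ : β ≤ 1) (hρ : β = 0 → ρ = .line) :
    ρ.star (1 - β) (X ^ (1 - β)) = X ^ (1 - β) := by
  refine Reality.eq_of_eval_ne_zero fun z hz => ?_
  rw [Reality.eval_star (natDegree_X_pow_le _) hz]
  rcases Nat.eq_zero_or_pos β with h | h
  · rw [hρ h]; simp [Reality.factor, Reality.conj]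
  · rw [show 1 - β = 0 by omega]
    cases ρ <;> simp [Reality.factor]

theorem natDegree_linearised_le :
    (2 * polyA x * polyB v - polyA v * polyB x).natDegree ≤ degA α β g + degB α β g := by
  refine (natDegree_sub_le _ _).trans (max_le ?_
    (natDegree_mul_le.trans (add_le_add natDegree_polyA_le natDegree_polyB_le)))
  rw [mul_assoc, show (2 : ℂ[X]) = C 2 from rfl]
  exact (natDegree_C_mul_le _ _).trans
    (natDegree_mul_le.trans (add_le_add natDegree_polyA_le natDegree_polyB_le))

theorem Integrability.conj (hα : α ≤ 1) (hβ : β ≤ 1) (hρ : β = 0 → ρ = .line)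
    (he : ρ = .antipodal → Even (degB α β g)) (hx : x ∈ realPairs α β g ρ)
    (hc : c.natDegree ≤ degC α β g) (h : Integrability x v c) :
    Integrability x (conjPair ρ v) (C (ρ.signC α) * ρ.star (degC α β g) c) := by
  rw [integrability_iff] at *
  have h1 := congrArg (fun p => C (ρ.signB g) * ρ.star (degA α β g + degC α β g) p) h
  rw [star_flowRHS (fun hl => two_mul_degC hα (beta_of_ne_line hβ hρ hl)) natDegree_polyA_le hc
    (star_polyA hx), degA_add_degC hα hβ, Reality.star_mul (natDegree_X_pow_le _)
    natDegree_linearised_le, star_X_pow hβ hρ, Reality.star_sub, mul_assoc,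
    show (2 : ℂ[X]) = C 2 from rfl, Reality.star_C_mul,
    Reality.star_mul natDegree_polyA_le natDegree_polyB_le,
    Reality.star_mul natDegree_polyA_le natDegree_polyB_le, star_polyA hx] at h1
  rw [flowRHS_C_mul, ← signB_mul_flip hβ hρ he, C_mul, mul_assoc (C _) (C _), ← h1, polyA_conjPair,
    polyB_conjPair]
  rw [Complex.conj_ofNat, show (2 : ℂ[X]) = C 2 from rfl]
  conv_lhs => rw [← signB_mul_star_polyB hx]
  ring

/-- The flow equation is solvable for each `c`. -/
theorem exists_integrability (hα : α ≤ 1) (hβ : β ≤ 1) (hx : x ∈ spaceT α β g ρ)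
    (hc : c.natDegree ≤ degC α β g) : ∃ v : Coeffs α β g, Integrability x v c := by
  obtain ⟨h1, h2, h3⟩ := mem_spaceT_iff.1 hx
  -- For `β = 0` the constant `κ` vanishes as well, so the right hand side is divisible by `X`.
  obtain ⟨F, hF, hFd⟩ : ∃ F : ℂ[X], X ^ (1 - β) * F = flowRHS (β * (1 + α)) (polyA x) c ∧
      F.natDegree ≤ (polyA x).natDegree + degB α β g := by
    have hd := natDegree_flowRHS_le (κ := β * (1 + α)) (natDegree_polyA_le (x := x)) hc
    rw [degA_add_degC hα hβ] at hd
    rw [h1.natDegree_A]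
    rcases Nat.eq_zero_or_pos β with h | h
    · have e : flowRHS (β * (1 + α)) (polyA x) c =
          X ^ (1 - β) * (2 * polyA x * derivative c - derivative (polyA x) * c) := by
        rw [flowRHS, show β * (1 + α) = 0 by rw [h, zero_mul], show 1 - β = 1 by omega]; simp
      refine ⟨_, e.symm, ?_⟩
      rw [e] at hd
      by_cases h0 : 2 * polyA x * derivative c - derivative (polyA x) * c = 0
      · rw [h0]; simp
      · rw [natDegree_X_pow_mul _ h0] at hd
        omega
    · refine ⟨_, ?_, hd.trans (by omega)⟩
      rw [show 1 - β = 0 by omega, pow_zero, one_mul]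
  obtain ⟨P, Q, hP, hQ, hPQ⟩ := exists_bezout_natDegree_le h1.A_ne_zero h3 natDegree_polyB_le hFd
  rw [h1.natDegree_A] at hP
  refine ⟨(ofPoly _ P, ofPoly _ Q), ?_⟩
  have e1 : polyA ((ofPoly _ P, ofPoly _ Q) : Coeffs α β g) = P := toPoly_ofPoly hP
  have e2 : polyB ((ofPoly _ P, ofPoly _ Q) : Coeffs α β g) = Q := toPoly_ofPoly hQ
  rw [integrability_iff, e1, e2, hPQ, hF]

theorem coeff_mul_second {p q : ℂ[X]} {m n : ℕ} (hp : p.natDegree ≤ m) (hq : q.natDegree ≤ n)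
    (hm : 1 ≤ m) (hn : 1 ≤ n) : (p * q).coeff (m + n - 1) =
      p.coeff m * q.coeff (n - 1) + p.coeff (m - 1) * q.coeff n := by
  have h := mul_coeff_one (reflect m p) (reflect n q)
  rw [← reflect_mul p q hp hq] at h
  simp only [coeff_reflect] at h
  rw [revAt_le (by omega), revAt_le hn, revAt_le hm, revAt_le (Nat.zero_le _),
    revAt_le (Nat.zero_le _), Nat.sub_zero, Nat.sub_zero] at h
  exact h

/-- An exact form has no residues. Algebraically, `κ = 2 degC - degA - 2` removes the second
coefficient of `c` from the second highest coefficient of the equation. A combination with the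
highest one eliminates the top coefficient of `c`. -/
theorem Integrability.polarInfty_eq_zero (hα : α = 1) (hβ : β ≤ 1) (hg : α ≤ g)
    (h0 : (polyA x).coeff (degA α β g) ≠ 0) (hres : residueInfty x = 0)
    (hc : c.natDegree ≤ degC α β g) (h : Integrability x v c) : polarInfty x v = 0 := by
  have hdA : 1 ≤ degA α β g := by rw [degA]; omega
  have hdB : 1 ≤ degB α β g := by rw [degB]; omega
  have hdC : 1 ≤ degC α β g := by rw [degC]; omega
  rw [integrability_iff] at h
  have hA' := Reality.natDegree_X_mul_derivative_le (natDegree_polyA_le (x := x))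
  have hc' := Reality.natDegree_X_mul_derivative_le hc
  have hdim := degA_add_degC (g := g) hα.le hβ
  have hcast : (2 * degC α β g : ℂ) = degA α β g + (β * (1 + α) : ℕ) + 2 := by
    exact_mod_cast two_mul_degC_eq hα hβ
  have e0 := congrArg (fun p => coeff p (degA α β g + degC α β g)) h
  have e1 := congrArg (fun p => coeff p (degA α β g + degC α β g - 1)) h
  rw [coeff_flowRHS natDegree_polyA_le hc, hdim, add_comm (1 - β), coeff_X_pow_mul, coeff_sub,
    mul_assoc, coeff_ofNat_mul, coeff_mul_add_eq_of_natDegree_le natDegree_polyA_le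
    natDegree_polyB_le, coeff_mul_add_eq_of_natDegree_le natDegree_polyA_le
    natDegree_polyB_le] at e0
  rw [flowRHS_eq, coeff_sub, coeff_sub, coeff_ofNat_mul, coeff_C_mul,
    coeff_mul_second natDegree_polyA_le hc' hdA hdC, coeff_mul_second hA' hc hdA hdC,
    coeff_mul_second natDegree_polyA_le hc hdA hdC, hdim,
    show 1 - β + (degA α β g + degB α β g) - 1 = (degA α β g + degB α β g - 1) + (1 - β) by omega,
    coeff_X_pow_mul, coeff_sub, mul_assoc, coeff_ofNat_mul,
    coeff_mul_second natDegree_polyA_le natDegree_polyB_le hdA hdB,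
    coeff_mul_second natDegree_polyA_le natDegree_polyB_le hdA hdB,
    Reality.coeff_X_mul_derivative, Reality.coeff_X_mul_derivative,
    Reality.coeff_X_mul_derivative, Reality.coeff_X_mul_derivative, Nat.cast_sub hdA,
    Nat.cast_sub hdC, Nat.cast_one] at e1
  have hp : polarInfty x v = 2 * (polyA v).coeff (degA α β g) * (polyB x).coeff (degB α β g - 1) +
      2 * (polyA x).coeff (degA α β g) * (polyB v).coeff (degB α β g - 1) -
      (polyA v).coeff (degA α β g - 1) * (polyB x).coeff (degB α β g) -
      (polyA x).coeff (degA α β g - 1) * (polyB v).coeff (degB α β g) := by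
    simp only [polarInfty, residueInfty, polyA_add, polyB_add, coeff_add]; ring
  rw [residueInfty] at hres
  set κ : ℂ := ((β * (1 + α) : ℕ) : ℂ)
  have hκ : κ = 2 * degC α β g - degA α β g - 2 := by rw [hcast]; ring
  rw [hκ] at e0 e1
  have key : 2 * (polyA x).coeff (degA α β g) * polarInfty x v = 0 := by
    rw [hp]
    linear_combination 2 * (polyA x).coeff (degA α β g) * e1 -
      3 * (polyA x).coeff (degA α β g - 1) * e0 + 3 * (polyA v).coeff (degA α β g) * hres
  exact (mul_eq_zero.1 key).resolve_left (mul_ne_zero two_ne_zero h0)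

/-- The same elimination with the two lowest coefficients: as `κ = 2`, the linear coefficient of `c`
drops out. -/
theorem Integrability.polarZero_eq_zero (hα : α = 1) (hβ : β = 1)
    (h0 : (polyA x).coeff 0 ≠ 0) (hres : residueZero x = 0)
    (h : Integrability x v c) : polarZero x v = 0 := by
  rw [integrability_iff, show 1 - β = 0 by omega, pow_zero, one_mul, flowRHS_eq] at h
  have e0 := congrArg (fun p => coeff p 0) h
  have e1 := congrArg (fun p => coeff p 1) h
  simp only [coeff_sub, mul_assoc, coeff_ofNat_mul, coeff_C_mul, mul_coeff_zero, mul_coeff_one,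
    coeff_X_zero, coeff_X_one, coeff_derivative, coeff_C, if_true, one_ne_zero, if_false] at e0 e1
  have hp : polarZero x v = 2 * (polyA v).coeff 0 * (polyB x).coeff 1 +
      2 * (polyA x).coeff 0 * (polyB v).coeff 1 - (polyA v).coeff 1 * (polyB x).coeff 0 -
      (polyA x).coeff 1 * (polyB v).coeff 0 := by
    simp only [polarZero, residueZero, polyA_add, polyB_add, coeff_add]; ring
  rw [residueZero] at hres
  have hκ : ((β * (1 + α) : ℕ) : ℂ) = 2 := by
    rw [show β * (1 + α) = 2 by rw [hα, hβ]]; norm_num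
  rw [hκ] at e0 e1
  have key : 2 * (polyA x).coeff 0 * polarZero x v = 0 := by
    rw [hp]
    push_cast at e0 e1
    linear_combination 2 * (polyA x).coeff 0 * e1 -
      3 * (polyA x).coeff 1 * e0 + 3 * (polyA v).coeff 0 * hres
  exact (mul_eq_zero.1 key).resolve_left (mul_ne_zero two_ne_zero h0)

/-- The side conditions hold: a root of `a` at `0` requires `β = 0`, hence `κ = 0`; a constant `a`
requires `α = g = 0` and `β = 1`, hence `κ = 1`. -/
theorem flow_injective (hα : α ≤ 1) (hβ : β ≤ 1) (hg : α ≤ g) (hx : x ∈ spaceT α β g ρ)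
    (h : flowRHS (β * (1 + α)) (polyA x) c = 0) : c = 0 := by
  obtain ⟨h1, h2, h3⟩ := mem_spaceT_iff.1 hx
  refine eq_zero_of_flowRHS_eq_zero h1.A_ne_zero h2 (fun h0 => ?_) (fun h0 => ?_) h
  · rcases Nat.eq_zero_or_pos β with hb | hb
    · rw [hb, zero_mul]
    · exact absurd h0 (h1.eval_zero_a (by omega))
  · rw [h1.natDegree_A, degA] at h0
    have hg0 : g = 0 := by omega
    have hα0 : α = 0 := by omega
    have hβ1 : β = 1 := by
      by_contra hb
      rw [hα0, show β = 0 by omega] at h0; omega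
    rw [hα0, hβ1]; decide

theorem Integrability.unique (hα : α ≤ 1) (hβ : β ≤ 1) (hg : α ≤ g) (hx : x ∈ spaceT α β g ρ)
    (h : Integrability x v c) (h' : Integrability x v c') : c = c' := by
  rw [integrability_iff] at *
  refine sub_eq_zero.1 (flow_injective hα hβ hg hx ?_)
  rw [flowRHS_sub, ← h, ← h', sub_self]

/-- Each solution `c` of the flow equation for a real pair is admissible. -/
theorem Integrability.isAdmissible (hα : α ≤ 1) (hβ : β ≤ 1) (hg : α ≤ g)
    (hρ : β = 0 → ρ = .line) (hx : x ∈ spaceT α β g ρ) (hv : v ∈ realPairs α β g ρ)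
    (h : Integrability x v c) : IsAdmissible α β g ρ c := by
  obtain ⟨h1, h2, h3⟩ := mem_spaceT_iff.1 hx
  have hd : c.natDegree ≤ degC α β g := by
    -- Beyond degree `degC` the top coefficient on the right could vanish only if `2 deg c = degA +
    -- κ`, which is at most `2 degC`.
    by_contra hn
    push Not at hn
    have e := coeff_flowRHS (κ := β * (1 + α)) (natDegree_polyA_le (x := x)) (le_refl c.natDegree)
    rw [← integrability_iff.1 h, coeff_eq_zero_of_natDegree_lt] at e
    · have hc0 : c ≠ 0 := fun h => by rw [h, natDegree_zero] at hn; omega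
      have hA : (polyA x).coeff (degA α β g) * c.coeff c.natDegree ≠ 0 :=
        mul_ne_zero (by rw [coeff_polyA_top]; exact h1.normalised.top_ne_zero)
          (leadingCoeff_ne_zero.2 hc0)
      have h3 := (mul_eq_zero.1 e.symm).resolve_right hA
      have h4 : ((2 * c.natDegree : ℕ) : ℂ) = (degA α β g + β * (1 + α) : ℕ) := by
        push_cast; push_cast at h3; linear_combination h3
      have h5 : 2 * c.natDegree = degA α β g + β * (1 + α) := by exact_mod_cast h4
      have := le_two_mul_degC (g := g) hα hβ
      omega
    · have := degA_add_degC (g := g) hα hβ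
      refine (natDegree_mul_le.trans (add_le_add (natDegree_X_pow_le _)
        natDegree_linearised_le)).trans_lt ?_
      omega
  refine ⟨hd, (Reality.fixes_iff hd).2 ?_⟩
  -- Conjugating the equation leaves `v` unchanged, so the conjugate of `c` is another solution and
  -- coincides with `c`.
  have h4 := h.conj hα hβ hρ (even_degB h1) h1.mem_realPairs hd
  rw [conjPair_eq hv] at h4
  exact h4.unique hα hβ hg hx h

/-- A Bezout solution is averaged with its conjugate to make it real, then corrected by the
rescaling, which solves the equation with `c = 0`. For uniqueness, a difference satisfies `2 a ḃ = ȧ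
b`, so `a` divides `ȧ`; thus `ȧ = s a` with `s` real, and the normalisation gives `s = 0`. -/
theorem existsUnique_integrability (hα : α ≤ 1) (hβ : β ≤ 1) (hg : α ≤ g)
    (hρ : β = 0 → ρ = .line) (hx : x ∈ spaceT α β g ρ) (hc : IsAdmissible α β g ρ c) :
    ∃! v, v ∈ tangentSpace ρ x ∧ Integrability x v c := by
  obtain ⟨h1, h2, h3⟩ := mem_spaceT_iff.1 hx
  have he := even_degB h1
  have hxV := h1.mem_realPairs
  have htop : (polyA x).coeff (degA α β g) ≠ 0 := by
    rw [coeff_polyA_top]; exact h1.normalised.top_ne_zero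
  have hzero : β = 1 → (polyA x).coeff 0 ≠ 0 := fun h => by
    rw [coeff_zero_eq_eval_zero]; exact h1.eval_zero_a h
  have hnorm := norm_top hα hβ hg hρ hx
  have hiff := fun v => mem_tangentSpace_iff (v := v) hα hβ hg hρ he hxV
  refine existsUnique_of_exists_of_unique ?_ ?_
  · obtain ⟨v0, hv0⟩ := exists_integrability hα hβ hx hc.1
    have hv0' := hv0.conj hα hβ hρ he hxV hc.1
    rw [(Reality.fixes_iff hc.1).1 hc.2] at hv0'
    have hv1 : Integrability x ((1 / 2 : ℝ) • (v0 + conjPair ρ v0)) c := by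
      have := (hv0.add hv0').smul (1 / 2)
      have e : C (((1 / 2 : ℝ) : ℂ)) * (c + c) = c := by
        rw [← two_mul, ← mul_assoc, show (2 : ℂ[X]) = C 2 from rfl, ← C_mul]; norm_num
      rwa [e] at this
    have hv1V : (1 / 2 : ℝ) • (v0 + conjPair ρ v0) ∈ realPairs α β g ρ :=
      Submodule.smul_mem _ _ (add_conjPair_mem hρ hβ he v0)
    set v1 := (1 / 2 : ℝ) • (v0 + conjPair ρ v0)
    -- The rescaling direction has pairing `2` with the top coefficient of `a`, whence the division
    -- by `2`.
    set t : ℝ := -(((polyA x).coeff (degA α β g)).re * ((polyA v1).coeff (degA α β g)).re +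
        ((polyA x).coeff (degA α β g)).im * ((polyA v1).coeff (degA α β g)).im) / 2 with ht
    have hI : Integrability x (v1 + t • scaling x) c := by
      have := hv1.add ((integrability_scaling (x := x)).smul t)
      rwa [mul_zero, add_zero] at this
    refine ⟨v1 + t • scaling x, (hiff _).2 ⟨Submodule.add_mem _ hv1V
      (Submodule.smul_mem _ _ (scaling_mem hxV)), ?_, fun hα' => ?_⟩, hI⟩
    · rw [polyA_add, polyA_smul t, polyA_scaling, coeff_add, coeff_C_mul, coeff_ofNat_mul]
      simp only [Complex.add_re, Complex.add_im, Complex.re_ofReal_mul, Complex.im_ofReal_mul,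
        Complex.mul_re, Complex.mul_im, Complex.re_ofNat, Complex.im_ofNat, Complex.ofReal_re,
        Complex.ofReal_im]
      linear_combination (2 * t) * hnorm + 2 * ht
    · have hs := congrArg Prod.snd (constraint_eq_zero hα hβ hg hρ hx)
      simp only [constraint, Prod.snd_zero] at hs
      rw [show (α : ℂ) = 1 by exact_mod_cast hα', one_mul,
        (residueRel hα' hρ hβ hg he hxV).sum_eq_zero_iff hρ hβ] at hs
      exact ⟨hI.polarInfty_eq_zero hα' hβ hg htop hs.1 hc.1,
        fun hb => hI.polarZero_eq_zero hα' hb (hzero hb) (hs.2 hb)⟩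
  · rintro v w ⟨hv, hvc⟩ ⟨hw, hwc⟩
    have hd := (hiff _).1 (Submodule.sub_mem _ hv hw)
    have hI := hvc.sub hwc
    rw [sub_self, integrability_iff, flowRHS] at hI
    simp only [derivative_zero, mul_zero, sub_self] at hI
    set d := v - w
    have hI' := (mul_eq_zero.1 hI).resolve_left (pow_ne_zero _ X_ne_zero)
    have hdvd : polyA x ∣ polyA d := h3.dvd_of_dvd_mul_right
      ⟨2 * polyB d, by linear_combination -hI'⟩
    obtain ⟨Q, hQ⟩ := hdvd
    obtain ⟨s, hs⟩ : ∃ s : ℂ, polyA d = C s * polyA x := by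
      by_cases hQ0 : Q = 0
      · exact ⟨0, by rw [hQ, hQ0]; simp⟩
      · have h5 : (polyA d).natDegree ≤ degA α β g := natDegree_polyA_le
        rw [hQ, natDegree_mul h1.A_ne_zero hQ0, h1.natDegree_A] at h5
        refine ⟨Q.coeff 0, ?_⟩
        rw [← eq_C_of_natDegree_eq_zero (show Q.natDegree = 0 by omega), hQ, mul_comm]
    have hsr : (starRingEnd ℂ) s = s := by
      have h5 := star_polyA hd.1
      rw [hs, Reality.star_C_mul, star_polyA hxV] at h5
      have h6 := congrArg (fun p => coeff p (degA α β g)) h5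
      simp only [coeff_C_mul] at h6
      exact mul_right_cancel₀ htop h6
    obtain ⟨s', hs'⟩ := Complex.conj_eq_iff_real.1 hsr
    have h7 := hd.2.1
    rw [hs, coeff_C_mul, hs'] at h7
    simp only [Complex.re_ofReal_mul, Complex.im_ofReal_mul] at h7
    have h8 : s' = 0 := by linear_combination h7 - s' * hnorm
    have hA0 : polyA d = 0 := by rw [hs, hs', h8]; simp
    have hB0 : polyB d = 0 := by
      rw [hA0, zero_mul, sub_zero] at hI'
      exact (mul_eq_zero.1 hI').resolve_left (mul_ne_zero two_ne_zero h1.A_ne_zero)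
    refine sub_eq_zero.1 (coeffs_ext (y := 0) ?_ ?_)
    · rw [hA0]; simp [polyA, toPoly]
    · rw [hB0]; simp [polyB, toPoly]

/-- The vector fields of the isoperiodic flow. -/
noncomputable def flowSpace (ρ : Reality) (x : Coeffs α β g) : Submodule ℝ (Coeffs α β g) where
  carrier := {v | v ∈ tangentSpace ρ x ∧ ∃ c : ℂ[X], Integrability x v c}
  add_mem' := fun ⟨h1, c, hc⟩ ⟨h1', c', hc'⟩ => ⟨Submodule.add_mem _ h1 h1', _, hc.add hc'⟩
  zero_mem' := ⟨Submodule.zero_mem _, 0, by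
    have := (integrability_scaling (x := x)).smul 0
    simpa using this⟩
  smul_mem' := fun t _ ⟨h1, c, hc⟩ => ⟨Submodule.smul_mem _ _ h1, _, hc.smul t⟩

/-- The graph `G` of the correspondence projects injectively to both factors, with images the flow
vectors and the real polynomials `c`; the latter form a space of dimension `degC + 1`. -/
theorem finrank_flowSpace (hα : α ≤ 1) (hβ : β ≤ 1) (hg : α ≤ g)
    (hρ : β = 0 → ρ = .line) (hx : x ∈ spaceT α β g ρ) :
    Module.finrank ℝ (flowSpace ρ x) = g + 2 + α * β := by
  obtain ⟨h1, h2, h3⟩ := mem_spaceT_iff.1 hx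
  have he := even_degB h1
  let G : Submodule ℝ (Coeffs α β g × (Fin (degC α β g + 1) → ℂ)) :=
    { carrier := {p | p.1 ∈ tangentSpace ρ x ∧ Integrability x p.1 (toPoly p.2)}
      add_mem' := fun {p q} hp hq => ⟨Submodule.add_mem _ hp.1 hq.1, by
        have := hp.2.add hq.2
        rwa [← toPoly_add] at this⟩
      zero_mem' := ⟨Submodule.zero_mem _, by
        have := (integrability_scaling (x := x)).smul 0
        simpa [toPoly] using this⟩
      smul_mem' := fun t p hp => ⟨Submodule.smul_mem _ _ hp.1, by
        have := hp.2.smul t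
        rw [← toPoly_smul] at this
        exact this⟩ }
  have e1 : LinearMap.range ((LinearMap.fst ℝ _ _).comp G.subtype) = flowSpace ρ x := by
    ext v
    constructor
    · rintro ⟨p, rfl⟩
      exact ⟨p.2.1, _, p.2.2⟩
    · rintro ⟨hv, c, hc⟩
      have had := hc.isAdmissible hα hβ hg hρ hx hv.1
      refine ⟨⟨(v, ofPoly _ c), hv, ?_⟩, rfl⟩
      simp only [toPoly_ofPoly had.1]; exact hc
  have e2 : LinearMap.range ((LinearMap.snd ℝ _ _).comp G.subtype) =
      realVectors ρ (ρ.signC α) (degC α β g) := by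
    ext c
    constructor
    · rintro ⟨p, rfl⟩
      exact mem_realVectors.2 (p.2.2.isAdmissible hα hβ hg hρ hx p.2.1.1).2
    · intro hc
      obtain ⟨v, ⟨hv, hvc⟩, -⟩ := existsUnique_integrability hα hβ hg hρ hx
        ⟨natDegree_toPoly_le c, mem_realVectors.1 hc⟩
      exact ⟨⟨(v, c), hv, hvc⟩, rfl⟩
  have i1 : Function.Injective ((LinearMap.fst ℝ _ _).comp G.subtype) := by
    rintro ⟨⟨v, c⟩, hp⟩ ⟨⟨w, c'⟩, hq⟩ hvw
    have : v = w := hvw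
    subst this
    have hcc : c = c' := toPoly_injective (hp.2.unique hα hβ hg hx hq.2)
    subst hcc; rfl
  have i2 : Function.Injective ((LinearMap.snd ℝ _ _).comp G.subtype) := by
    rintro ⟨⟨v, c⟩, hp⟩ ⟨⟨w, c'⟩, hq⟩ hcc
    have : c = c' := hcc
    subst this
    have hvw : v = w := (existsUnique_integrability hα hβ hg hρ hx
      (hp.2.isAdmissible hα hβ hg hρ hx hp.1.1)).unique hp hq
    subst hvw; rfl
  rw [← e1, LinearMap.finrank_range_of_inj i1, ← LinearMap.finrank_range_of_inj i2, e2,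
    finrank_realVectors (Reality.signC_mul_conj α) (even_degC hβ hρ he), degC]
  ring

end Flow

end Whitham

namespace Whitham

open MeasureTheory

/-! ### Smooth dependence of integrals of powers. -/

section PowerIntegral

variable {E : Type*} [NormedAddCommGroup E] [NormedSpace ℝ E] [FiniteDimensional ℝ E]

/-- The integral of a power of a family of linear functions, as a function of their argument. -/
noncomputable def powInt (l : ℝ → E →L[ℝ] ℂ) (w : ℝ → ℂ) (c : ℂ) (y : E) : ℂ :=
  ∫ t in (0 : ℝ)..1, w t * (l t y) ^ c

/-- The points at which the members of a family of linear functions have positive real part. -/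
def positiveSet (l : ℝ → E →L[ℝ] ℂ) : Set E := {y | ∀ t ∈ Set.Icc (0 : ℝ) 1, 0 < (l t y).re}

variable {l : ℝ → E →L[ℝ] ℂ} {w : ℝ → ℂ} {c : ℂ}

theorem isOpen_positiveSet (hl : ContinuousOn l (Set.Icc 0 1)) : IsOpen (positiveSet l) := by
  rw [isOpen_iff_mem_nhds]
  intro y hy
  have hc : ContinuousOn (fun p : E × ℝ => (l p.2 p.1).re) (Set.univ ×ˢ Set.Icc 0 1) :=
    Complex.continuous_re.comp_continuousOn
      ((hl.comp continuousOn_snd fun p hp => hp.2).clm_apply continuousOn_fst)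
  obtain ⟨u, hu, hu'⟩ := continuousOn_iff'.1 hc _ (isOpen_Ioi (a := (0 : ℝ)))
  have := (isCompact_Icc (a := (0 : ℝ)) (b := 1)).eventually_forall_of_forall_eventually
    (x₀ := y) (P := fun y t => t ∈ Set.Icc (0 : ℝ) 1 → 0 < (l t y).re) (fun t ht => by
      have hmem : (y, t) ∈ u := by
        have : (y, t) ∈ (fun p : E × ℝ => (l p.2 p.1).re) ⁻¹' Set.Ioi 0 ∩
            (Set.univ ×ˢ Set.Icc 0 1) := ⟨hy t ht, trivial, ht⟩
        rw [hu'] at this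
        exact this.1
      filter_upwards [hu.mem_nhds hmem] with p hp hp2
      have : p ∈ u ∩ (Set.univ ×ˢ Set.Icc 0 1) := ⟨hp, trivial, hp2⟩
      rw [← hu'] at this
      exact this.1)
  exact this.mono fun z hz t ht => hz t ht ht

theorem continuousOn_pow_apply (hl : ContinuousOn l (Set.Icc 0 1)) (c : ℂ) :
    ContinuousOn (fun p : E × ℝ => (l p.2 p.1) ^ c) (positiveSet l ×ˢ Set.Icc 0 1) :=
  ((hl.comp continuousOn_snd fun p hp => hp.2).clm_apply continuousOn_fst).cpow_const
    fun p hp => Or.inl (hp.1 p.2 hp.2)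

theorem continuousOn_pow_apply_snd (hl : ContinuousOn l (Set.Icc 0 1)) (c : ℂ) {y : E}
    (hy : y ∈ positiveSet l) : ContinuousOn (fun t => (l t y) ^ c) (Set.Icc 0 1) :=
  (continuousOn_pow_apply hl c).comp (f := fun t : ℝ => (y, t)) (by fun_prop) fun t ht => ⟨hy, ht⟩

/-- Differentiation under the integral returns an integral of the same kind, with a new weight and
the exponent lowered by one. The induction for smoothness rests on this closure. -/
theorem hasFDerivAt_powInt (hl : ContinuousOn l (Set.Icc 0 1))
    (hw : IntervalIntegrable w volume 0 1) (c : ℂ) {y : E} (hy : y ∈ positiveSet l) :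
    ∃ L : E →L[ℝ] ℂ, HasFDerivAt (powInt l w c) L y ∧
      ∀ v, L v = powInt l (fun t => w t * (c * l t v)) (c - 1) y := by
  haveI : ProperSpace E := FiniteDimensional.proper_real E
  have hsub : Set.uIoc (0 : ℝ) 1 ⊆ Set.Icc 0 1 := by
    rw [Set.uIoc_of_le zero_le_one]; exact Set.Ioc_subset_Icc_self
  have hO := isOpen_positiveSet hl
  obtain ⟨ε, hε, hball⟩ := Metric.nhds_basis_closedBall.mem_iff.1 (hO.mem_nhds hy)
  let G : E → ℝ → E →L[ℝ] ℂ := fun y t => (c * (l t y) ^ (c - 1)) • l t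
  have hG : ContinuousOn (fun p : E × ℝ => G p.1 p.2) (positiveSet l ×ˢ Set.Icc 0 1) :=
    (continuousOn_const.mul (continuousOn_pow_apply hl (c - 1))).smul
      (hl.comp continuousOn_snd fun p hp => hp.2)
  obtain ⟨C, hC⟩ := ((isCompact_closedBall y ε).prod
    (isCompact_Icc (a := (0 : ℝ)) (b := 1))).exists_bound_of_continuousOn
    (hG.mono (Set.prod_mono hball le_rfl))
  have hwm : AEStronglyMeasurable w (volume.restrict (Set.uIoc 0 1)) :=
    hw.aestronglyMeasurable_restrict_uIoc
  have hGy : ContinuousOn (fun t => G y t) (Set.Icc 0 1) :=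
    hG.comp (f := fun t : ℝ => (y, t)) (by fun_prop) fun t ht => ⟨hy, ht⟩
  have hint : IntervalIntegrable (fun t => w t • G y t) volume 0 1 := by
    refine hw.smul_continuousOn ?_
    rwa [Set.uIcc_of_le zero_le_one]
  have key := intervalIntegral.hasFDerivAt_integral_of_dominated_of_fderiv_le (𝕜 := ℝ)
    (μ := volume) (a := 0) (b := 1) (s := Metric.closedBall y ε)
    (F := fun y t => w t * (l t y) ^ c) (F' := fun y t => w t • G y t) (x₀ := y)
    (bound := fun t => ‖w t‖ * C) (Metric.closedBall_mem_nhds y hε) ?_ ?_ ?_ ?_ ?_ ?_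
  · refine ⟨_, key, fun v => ?_⟩
    rw [ContinuousLinearMap.intervalIntegral_apply hint]
    refine intervalIntegral.integral_congr fun t _ => ?_
    simp only [G, ContinuousLinearMap.smul_apply, smul_eq_mul]
    ring
  · filter_upwards [hO.mem_nhds hy] with z hz
    exact hwm.mul (((continuousOn_pow_apply_snd hl c hz).mono hsub).aestronglyMeasurable
      measurableSet_uIoc)
  · refine hw.mul_continuousOn ?_
    rw [Set.uIcc_of_le zero_le_one]
    exact continuousOn_pow_apply_snd hl c hy
  · exact hint.aestronglyMeasurable_restrict_uIoc
  · refine Filter.Eventually.of_forall fun t ht z hz => ?_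
    rw [norm_smul]
    exact mul_le_mul_of_nonneg_left (hC (z, t) ⟨hz, hsub ht⟩) (norm_nonneg _)
  · exact hw.norm.mul_const C
  · refine Filter.Eventually.of_forall fun t ht z hz => ?_
    have h1 : HasDerivAt (fun u : ℂ => u ^ c) (c * (l t z) ^ (c - 1)) (l t z) :=
      (hasDerivAt_id (l t z)).cpow_const (Or.inl (hball hz t (hsub ht))) |>.congr_deriv (by simp)
    have h2 := (h1.hasFDerivAt.restrictScalars ℝ).comp z (l t).hasFDerivAt
    have h3 := h2.const_mul (w t)
    refine h3.congr_fderiv ?_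
    ext v
    simp [G]
    left; ring

theorem contDiffOn_powInt (hl : ContinuousOn l (Set.Icc 0 1)) {w : ℝ → ℂ}
    (hw : IntervalIntegrable w volume 0 1) (c : ℂ) : ContDiffOn ℝ ∞ (powInt l w c) (positiveSet l) := by
  rw [contDiffOn_infty]
  intro n
  induction n generalizing w c with
  | zero =>
    rw [Nat.cast_zero, contDiffOn_zero]
    intro y hy
    obtain ⟨L, hL, -⟩ := hasFDerivAt_powInt hl hw c hy
    exact hL.continuousAt.continuousWithinAt
  | succ n ih =>
    rw [Nat.cast_succ, contDiffOn_succ_iff_fderiv_of_isOpen (isOpen_positiveSet hl)]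
    refine ⟨fun y hy => ?_, by simp, ?_⟩
    · obtain ⟨L, hL, -⟩ := hasFDerivAt_powInt hl hw c hy
      exact hL.differentiableAt.differentiableWithinAt
    · rw [contDiffOn_clm_apply]
      intro v
      have hw' : IntervalIntegrable (fun t => w t * (c * l t v)) volume 0 1 := by
        refine hw.mul_continuousOn ?_
        rw [Set.uIcc_of_le zero_le_one]
        exact continuousOn_const.mul (hl.clm_apply continuousOn_const)
      refine (ih hw' (c - 1)).congr fun y hy => ?_
      obtain ⟨L, hL, hL'⟩ := hasFDerivAt_powInt hl hw c hy
      rw [hL.fderiv, hL']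

end PowerIntegral

end Whitham

namespace Whitham

open MeasureTheory

/-! ### Periods as smooth functions and their derivatives. -/

section PeriodDerivative

variable {α β g : ℕ} {ρ : Reality} {x y v : Coeffs α β g} {γ ν : ℝ → ℂ}

/-- The value of `a` at a point as a function of the pair. -/
noncomputable def evalA (z : ℂ) : Coeffs α β g →L[ℝ] ℂ :=
  ∑ i ∈ Finset.range (degA α β g + 1), (z ^ i) • coeffA i

theorem evalA_apply (z : ℂ) (y : Coeffs α β g) : evalA z y = (polyA y).eval z := by
  rw [evalA, ContinuousLinearMap.sum_apply,
    eval_eq_sum_range' (Nat.lt_succ_of_le (natDegree_polyA_le (x := y)))]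
  refine Finset.sum_congr rfl fun i _ => ?_
  rw [ContinuousLinearMap.smul_apply, coeffA_apply, smul_eq_mul, mul_comm]

theorem continuous_evalA : Continuous (evalA : ℂ → Coeffs α β g →L[ℝ] ℂ) := by
  unfold evalA
  fun_prop

/-- The quotient `ã / a` along a path as a function of `ã`. -/
noncomputable def ratio (x : Coeffs α β g) (γ : ℝ → ℂ) (t : ℝ) : Coeffs α β g →L[ℝ] ℂ :=
  ((polyA x).eval (γ t))⁻¹ • evalA (γ t)

theorem ratio_apply (t : ℝ) :
    ratio x γ t y = (polyA y).eval (γ t) / (polyA x).eval (γ t) := by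
  rw [ratio, ContinuousLinearMap.smul_apply, evalA_apply, smul_eq_mul, div_eq_inv_mul]

/-- The pointwise algebra of the product rule for `b / √a`, with `s` in the place of the root of `A'
/ A`. -/
theorem sum_weight_eq {A A' s : ℂ} (hA : A ≠ 0) (hA' : A' ≠ 0) (hs : s ≠ 0) (Av D G : ℂ)
    (b b' p : ℕ → ℂ) (S : Finset ℕ) :
    ∑ i ∈ S, (b i * (p i / D * G * (-(1 / 2) * (Av / A)) * (s⁻¹ / (A' / A))) +
      p i / D * G * s⁻¹ * b' i) =
    (2 * A' * (∑ i ∈ S, b' i * p i) - Av * ∑ i ∈ S, b i * p i) / (2 * A' * s * D) * G := by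
  rw [Finset.mul_sum, Finset.mul_sum, ← Finset.sum_sub_distrib, Finset.sum_div, Finset.sum_mul]
  refine Finset.sum_congr rfl fun i _ => ?_
  rw [div_eq_mul_inv _ D, div_eq_mul_inv _ (_ * D), mul_inv _ D]
  field_simp
  ring

namespace IsCycle

theorem continuousOn_ratio (h : IsCycle x γ ν) : ContinuousOn (ratio x γ) (Set.Icc 0 1) := by
  refine ContinuousOn.smul (ContinuousOn.inv₀ ?_ h.not_root)
    (continuous_evalA.comp_continuousOn h.continuousOn_fst)
  exact (polyA x).continuous.comp_continuousOn h.continuousOn_fst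

theorem mem_positiveSet_self (h : IsCycle x γ ν) : x ∈ positiveSet (ratio x γ) := fun t ht => by
  rw [ratio_apply, div_self (h.not_root t ht)]; simp

theorem curve_ne_zero (h : IsCycle x γ ν) (hβ : β ≤ 1) {t : ℝ} (ht : t ∈ Set.Icc (0 : ℝ) 1) :
    curveRHS x (γ t) ≠ 0 := by
  refine mul_ne_zero ?_ (h.not_root t ht)
  rcases Nat.eq_zero_or_pos β with hb | hb
  · rw [show (1 - α) * β = 0 by rw [hb, mul_zero], pow_zero]; exact one_ne_zero
  · exact pow_ne_zero _ (h.ne_zero (by omega) t ht)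

theorem snd_ne_zero (h : IsCycle x γ ν) (hβ : β ≤ 1) {t : ℝ} (ht : t ∈ Set.Icc (0 : ℝ) 1) :
    ν t ≠ 0 := fun h0 => by
  have := h.on_curve t ht
  rw [h0, zero_pow two_ne_zero] at this
  exact h.curve_ne_zero hβ ht this.symm

theorem pow_ne_zero' (h : IsCycle x γ ν) (hβ : β ≤ 1) {t : ℝ} (ht : t ∈ Set.Icc (0 : ℝ) 1) (n : ℕ) :
    γ t ^ (n * β) ≠ 0 := by
  rcases Nat.eq_zero_or_pos β with hb | hb
  · rw [hb, mul_zero, pow_zero]; exact one_ne_zero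
  · exact pow_ne_zero _ (h.ne_zero (by omega) t ht)

theorem continuedLift (h : IsCycle x γ ν) (hy : y ∈ positiveSet (ratio x γ)) :
    IsCycle y γ (continuedLift x y γ ν) where
  continuousOn_fst := h.continuousOn_fst
  continuousOn_snd := by
    refine h.continuousOn_snd.mul ((continuousOn_pow_apply_snd h.continuousOn_ratio
      (1 / 2) hy).congr fun t ht => ?_)
    simp only [ratio_apply]
  closed_fst := h.closed_fst
  closed_snd := by rw [Whitham.continuedLift, Whitham.continuedLift, h.closed_fst, h.closed_snd]
  piecewise := h.piecewise
  ne_zero := h.ne_zero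
  not_root := fun t ht h0 => by
    have := hy t ht
    rw [ratio_apply, h0, zero_div] at this
    simp at this
  on_curve := continuedLift_sq x y γ ν h

/-- The coefficients of the period in its expansion by the coefficients of `b`. -/
theorem intervalIntegrable_weight (h : IsCycle x γ ν) (hβ : β ≤ 1) (i : ℕ) :
    IntervalIntegrable (fun t => γ t ^ i / (γ t ^ (β + α * β) * ν t) * deriv γ t) volume 0 1 := by
  refine intervalIntegrable_mul_deriv ?_ h.piecewise
  refine (h.continuousOn_fst.pow i).div ((h.continuousOn_fst.pow _).mul h.continuousOn_snd)
    fun t ht => mul_ne_zero ?_ (h.snd_ne_zero hβ ht)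
  have := h.pow_ne_zero' hβ ht (1 + α)
  rwa [add_mul, one_mul] at this

/-- The path and the lift `ν` stay fixed; the data enter linearly through `b` and through the power
`-1 / 2` of the function `ã / a`, which is linear in `ã`. -/
theorem period_eq_sum (h : IsCycle x γ ν) (hβ : β ≤ 1) (hy : y ∈ positiveSet (ratio x γ)) :
    period x γ ν y = ∑ i ∈ Finset.range (degB α β g + 1), coeffB i y *
      powInt (ratio x γ) (fun t => γ t ^ i / (γ t ^ (β + α * β) * ν t) * deriv γ t) (-(1 / 2)) y := by
  simp only [powInt, ← intervalIntegral.integral_const_mul]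
  rw [← intervalIntegral.integral_finset_sum]
  · rw [period, integral]
    refine intervalIntegral.integral_congr fun t _ => ?_
    simp only [omega, Whitham.continuedLift, ratio_apply, Complex.cpow_neg]
    rw [eval_eq_sum_range' (Nat.lt_succ_of_le (natDegree_polyB_le (x := y))), Finset.sum_div,
      Finset.sum_mul]
    refine Finset.sum_congr rfl fun i _ => ?_
    rw [coeffB_apply, ← mul_assoc (γ t ^ _), div_eq_mul_inv, div_eq_mul_inv, mul_inv (_ * _)]
    ring
  · intro i _
    refine ((h.intervalIntegrable_weight hβ i).mul_continuousOn ?_).const_mul _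
    rw [Set.uIcc_of_le zero_le_one]
    exact continuousOn_pow_apply_snd h.continuousOn_ratio _ hy

theorem contDiffOn_period (h : IsCycle x γ ν) (hβ : β ≤ 1) :
    ContDiffOn ℝ ∞ (period x γ ν) (positiveSet (ratio x γ)) := by
  refine ContDiffOn.congr (ContDiffOn.sum fun i _ => ?_) fun y hy => h.period_eq_sum hβ hy
  exact (coeffB i).contDiff.contDiffOn.mul (contDiffOn_powInt h.continuousOn_ratio
    (h.intervalIntegrable_weight hβ i) _)

theorem hasFDerivAt_period (h : IsCycle x γ ν) (hβ : β ≤ 1) (hy : y ∈ positiveSet (ratio x γ)) :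
    ∃ L : Coeffs α β g →L[ℝ] ℂ, HasFDerivAt (period x γ ν) L y ∧ ∀ v, L v =
      ∫ t in (0 : ℝ)..1, (2 * polyA y * polyB v - polyA v * polyB y).eval (γ t) /
        (2 * (polyA y).eval (γ t) * γ t ^ (β + α * β) * Whitham.continuedLift x y γ ν t) *
          deriv γ t := by
  choose L hL hLv using fun i => hasFDerivAt_powInt h.continuousOn_ratio
    (h.intervalIntegrable_weight hβ i) (-(1 / 2)) hy
  have h1 := HasFDerivAt.fun_sum (u := Finset.range (degB α β g + 1)) fun i _ =>
    ((coeffB (α := α) (β := β) (g := g) i).hasFDerivAt (x := y)).mul (hL i)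
  have hO := (isOpen_positiveSet h.continuousOn_ratio).mem_nhds hy
  refine ⟨_, h1.congr_of_eventuallyEq (Filter.mem_of_superset hO fun z hz =>
    h.period_eq_sum hβ hz), fun v => ?_⟩
  rw [ContinuousLinearMap.sum_apply]
  simp only [ContinuousLinearMap.add_apply, ContinuousLinearMap.smul_apply, hLv, smul_eq_mul]
  simp only [powInt, ← intervalIntegral.integral_const_mul]
  have hc : ∀ c : ℂ, ContinuousOn (fun t => (ratio x γ t y) ^ c) (Set.uIcc 0 1) := fun c => by
    rw [Set.uIcc_of_le zero_le_one]
    exact continuousOn_pow_apply_snd h.continuousOn_ratio c hy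
  have hv : ContinuousOn (fun t => ratio x γ t v) (Set.uIcc 0 1) := by
    rw [Set.uIcc_of_le zero_le_one]
    exact h.continuousOn_ratio.clm_apply continuousOn_const
  have i1 : ∀ i : ℕ, IntervalIntegrable (fun t => coeffB i y *
      (γ t ^ i / (γ t ^ (β + α * β) * ν t) * deriv γ t * (-(1 / 2) * ratio x γ t v) *
        ratio x γ t y ^ (-(1 / 2) - 1 : ℂ))) volume 0 1 := fun i =>
    ((((h.intervalIntegrable_weight hβ i).mul_continuousOn
      (continuousOn_const.mul hv)).mul_continuousOn (hc _))).const_mul _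
  have i2 : ∀ i : ℕ, IntervalIntegrable (fun t =>
      γ t ^ i / (γ t ^ (β + α * β) * ν t) * deriv γ t * ratio x γ t y ^ (-(1 / 2) : ℂ) *
        coeffB i v) volume 0 1 := fun i =>
    (((h.intervalIntegrable_weight hβ i).mul_continuousOn (hc _))).mul_const _
  have e : ∀ i ∈ Finset.range (degB α β g + 1),
      (∫ t in (0 : ℝ)..1, coeffB i y *
      (γ t ^ i / (γ t ^ (β + α * β) * ν t) * deriv γ t * (-(1 / 2) * ratio x γ t v) *
        ratio x γ t y ^ (-(1 / 2) - 1 : ℂ))) +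
      (∫ t in (0 : ℝ)..1, γ t ^ i / (γ t ^ (β + α * β) * ν t) * deriv γ t *
        ratio x γ t y ^ (-(1 / 2) : ℂ)) * coeffB i v =
      ∫ t in (0 : ℝ)..1, (coeffB i y *
      (γ t ^ i / (γ t ^ (β + α * β) * ν t) * deriv γ t * (-(1 / 2) * ratio x γ t v) *
        ratio x γ t y ^ (-(1 / 2) - 1 : ℂ)) +
      γ t ^ i / (γ t ^ (β + α * β) * ν t) * deriv γ t * ratio x γ t y ^ (-(1 / 2) : ℂ) *
        coeffB i v) := fun i _ => by
    rw [intervalIntegral.integral_add (i1 i) (i2 i), intervalIntegral.integral_mul_const]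
  rw [Finset.sum_congr rfl e, ← intervalIntegral.integral_finset_sum
    fun i _ => (i1 i).add (i2 i)]
  refine intervalIntegral.integral_congr fun t ht => ?_
  rw [Set.uIcc_of_le zero_le_one] at ht
  have hA := h.not_root t ht
  have hA' := (h.continuedLift hy).not_root t ht
  have hs0 : ratio x γ t y ^ (1 / 2 : ℂ) ≠ 0 := by
    rw [Ne, Complex.cpow_eq_zero_iff, ratio_apply]
    exact fun h => div_ne_zero hA' hA h.1
  have hq0 : ratio x γ t y ≠ 0 := by rw [ratio_apply]; exact div_ne_zero hA' hA
  simp only [Complex.cpow_sub _ _ hq0, Complex.cpow_neg, Complex.cpow_one, Whitham.continuedLift,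
    ← ratio_apply]
  set s := ratio x γ t y ^ (1 / 2 : ℂ)
  rw [ratio_apply, ratio_apply, eval_sub, eval_mul, eval_mul, eval_mul, eval_ofNat,
    eval_eq_sum_range' (Nat.lt_succ_of_le (natDegree_polyB_le (x := y))),
    eval_eq_sum_range' (Nat.lt_succ_of_le (natDegree_polyB_le (x := v)))]
  simp only [coeffB_apply]
  have e2 : 2 * (polyA y).eval (γ t) * γ t ^ (β + α * β) * (ν t * s) =
      2 * (polyA y).eval (γ t) * s * (γ t ^ (β + α * β) * ν t) := by ring
  rw [e2]
  exact sum_weight_eq hA hA' hs0 _ _ _ _ _ _ _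

end IsCycle

/-- Lifts of paths are only known to be continuous. Their difference quotient is that of the square
divided by `μ s + μ t`, which has a nonzero limit. -/
theorem hasDerivAt_of_sq_real {u μ : ℝ → ℂ} {u' : ℂ} {t : ℝ} (hu : HasDerivAt u u' t)
    (hμ : ContinuousAt μ t) (h : ∀ᶠ s in 𝓝 t, μ s ^ 2 = u s) (h0 : μ t ≠ 0) :
    HasDerivAt μ (u' / (2 * μ t)) t := by
  rw [hasDerivAt_iff_tendsto_slope] at hu ⊢
  have h0' : μ t + μ t ≠ 0 := by rw [← two_mul]; exact mul_ne_zero two_ne_zero h0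
  have h1 : Filter.Tendsto (fun s => (μ s + μ t)⁻¹) (𝓝[≠] t) (𝓝 (2 * μ t)⁻¹) := by
    rw [two_mul]
    exact ((hμ.add continuousAt_const).inv₀ h0').tendsto.mono_left nhdsWithin_le_nhds
  have h2 : ∀ᶠ s in 𝓝 t, μ s + μ t ≠ 0 :=
    (hμ.add continuousAt_const).eventually_ne h0'
  rw [div_eq_mul_inv]
  refine (hu.mul h1).congr' ?_
  filter_upwards [nhdsWithin_le_nhds h, nhdsWithin_le_nhds h2] with s hs hs2
  rw [slope_def_module, slope_def_module, ← hs, ← h.self_of_nhds]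
  simp only [Complex.real_smul]
  field_simp
  ring

/-- The integral of an exact form over a cycle vanishes. -/
theorem IsCycle.integral_eq_zero (h : IsCycle y γ ν) (hα : α ≤ 1) (hβ : β ≤ 1) {c : ℂ[X]}
    (hI : Integrability y v c) :
    (∫ t in (0 : ℝ)..1, (2 * polyA y * polyB v - polyA v * polyB y).eval (γ t) /
        (2 * (polyA y).eval (γ t) * γ t ^ (β + α * β) * ν t) * deriv γ t) = 0 := by
  have hj : ∀ t ∈ Set.Icc (0 : ℝ) 1, γ t ^ (α * β) ≠ 0 := fun t ht => h.pow_ne_zero' hβ ht α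
  have hk : ∀ t ∈ Set.Icc (0 : ℝ) 1, γ t ^ (β + α * β) ≠ 0 := fun t ht => by
    have := h.pow_ne_zero' hβ ht (1 + α)
    rwa [add_mul, one_mul] at this
  have hint : IntervalIntegrable (fun t => (2 * polyA y * polyB v - polyA v * polyB y).eval (γ t) /
        (2 * (polyA y).eval (γ t) * γ t ^ (β + α * β) * ν t) * deriv γ t) volume 0 1 := by
    refine intervalIntegrable_mul_deriv ?_ h.piecewise
    refine ContinuousOn.div (Polynomial.continuous _ |>.comp_continuousOn h.continuousOn_fst)
      (((continuousOn_const.mul ((polyA y).continuous.comp_continuousOn h.continuousOn_fst)).mul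
        (h.continuousOn_fst.pow _)).mul h.continuousOn_snd) fun t ht => ?_
    exact mul_ne_zero (mul_ne_zero (mul_ne_zero two_ne_zero (h.not_root t ht)) (hk t ht))
      (h.snd_ne_zero hβ ht)
  obtain ⟨s, K, hs⟩ := h.piecewise
  -- The primitive `c / (λ ^ (α β) ν)` is continuous along the whole path and differentiable off the
  -- finitely many corners, so its increment over the cycle is zero.
  have hftc := MeasureTheory.integral_eq_of_hasDerivAt_off_countable_of_le
    (fun t => c.eval (γ t) / (γ t ^ (α * β) * ν t)) _ zero_le_one (s := (s : Set ℝ))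
    s.countable_toSet
    ((c.continuous.comp_continuousOn h.continuousOn_fst).div
      ((h.continuousOn_fst.pow _).mul h.continuousOn_snd)
      fun t ht => mul_ne_zero (hj t ht) (h.snd_ne_zero hβ ht)) (fun t ht => ?_) hint
  · rw [hftc, h.closed_fst, h.closed_snd, sub_self]
  have ht' : t ∈ Set.Icc (0 : ℝ) 1 := Set.Ioo_subset_Icc_self ht.1
  have hγ : HasDerivAt γ (deriv γ t) t :=
    ((hs t ht' ht.2).1.differentiableAt one_ne_zero).hasDerivAt
  have hA := h.not_root t ht'
  have hν0 := h.snd_ne_zero hβ ht'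
  have hnhds := Icc_mem_nhds ht.1.1 ht.1.2
  set R : ℂ[X] := X ^ ((1 - α) * β) * polyA y with hR
  have hν : HasDerivAt ν ((deriv γ t • (derivative R).eval (γ t)) / (2 * ν t)) t := by
    refine hasDerivAt_of_sq_real ((R.hasDerivAt (γ t)).scomp t hγ)
      (h.continuousOn_snd.continuousAt hnhds) (Filter.mem_of_superset hnhds fun s hs => ?_) hν0
    show ν s ^ 2 = R.eval (γ s)
    rw [h.on_curve s hs, curveRHS, hR]; simp
  have hc : HasDerivAt (fun t => c.eval (γ t)) (deriv γ t • (derivative c).eval (γ t)) t :=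
    (c.hasDerivAt (γ t)).scomp t hγ
  have hd := hc.div ((hγ.pow (α * β)).mul hν) (mul_ne_zero (hj t ht') hν0)
  refine hd.congr_deriv ?_
  have hcurve : ν t ^ 2 = γ t ^ ((1 - α) * β) * (polyA y).eval (γ t) := h.on_curve t ht'
  have hz : β = 1 → γ t ≠ 0 := fun hb => h.ne_zero hb t ht'
  set F := 2 * polyA y * polyB v - polyA v * polyB y
  -- The point `0` is unmarked, a marked branch point, or marked with two points above it. In these
  -- cases `κ` is `0`, `1` or `2`.
  have hcases : ((1 - α) * β = 0 ∧ α * β = 0 ∧ β + α * β = 0 ∧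
      F = 2 * polyA y * derivative c - derivative (polyA y) * c) ∨
    ((1 - α) * β = 1 ∧ α * β = 0 ∧ β + α * β = 1 ∧ γ t ≠ 0 ∧
      F = X * (2 * polyA y * derivative c - derivative (polyA y) * c) - polyA y * c) ∨
    ((1 - α) * β = 0 ∧ α * β = 1 ∧ β + α * β = 2 ∧ γ t ≠ 0 ∧
      F = X * (2 * polyA y * derivative c - derivative (polyA y) * c) - 2 * polyA y * c) := by
    have hI' : X ^ (1 - β) * F = X * (2 * polyA y * derivative c - derivative (polyA y) * c)
      - C ((β * (1 + α) : ℕ) : ℂ) * polyA y * c := hI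
    rcases Nat.eq_zero_or_pos β with hb | hb
    · left
      rw [show 1 - β = 1 by omega, show β * (1 + α) = 0 by rw [hb, zero_mul], Nat.cast_zero, C_0,
        zero_mul, zero_mul, sub_zero, pow_one] at hI'
      exact ⟨by rw [hb, mul_zero], by rw [hb, mul_zero], by rw [hb, mul_zero, zero_add],
        mul_left_cancel₀ X_ne_zero hI'⟩
    · have hb' : β = 1 := by omega
      right
      rw [show 1 - β = 0 by omega, pow_zero, one_mul] at hI'
      rcases Nat.eq_zero_or_pos α with ha | ha
      · left
        rw [show β * (1 + α) = 1 by rw [hb', ha], Nat.cast_one, C_1, one_mul] at hI'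
        exact ⟨by rw [hb', ha], by rw [ha, zero_mul], by rw [hb', ha], hz hb', hI'⟩
      · have ha' : α = 1 := by omega
        right
        rw [show β * (1 + α) = 2 by rw [hb', ha'], Nat.cast_ofNat] at hI'
        exact ⟨by rw [hb', ha'], by rw [hb', ha'], by rw [hb', ha'], hz hb', hI'⟩
  simp only [smul_eq_mul]
  rw [hR]
  rcases hcases with ⟨h1, h2, h3, h4⟩ | ⟨h1, h2, h3, hz0, h4⟩ | ⟨h1, h2, h3, hz0, h4⟩ <;>
  · rw [h1] at hcurve
    rw [h3, h1, h2, h4]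
    simp only [pow_zero, one_mul, pow_one, eval_sub, eval_mul, eval_X, eval_ofNat, derivative_mul,
      derivative_X, eval_add, Pi.mul_apply, Pi.pow_apply, Pi.one_apply, Nat.cast_zero, Nat.cast_one, zero_mul,
      mul_one, zero_add, Nat.sub_self] at hcurve ⊢
    have hA2 : ν t ^ 3 = ν t * ν t ^ 2 := by ring
    have hA4 : ν t ^ 4 = ν t ^ 2 * ν t ^ 2 := by ring
    field_simp
    simp only [hA4, hA2, hcurve]
    ring

end PeriodDerivative

end Whitham

namespace Whitham

/-! ### The kernel of the periods and the isoperiodic set. -/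

open MeasureTheory

/-- At nearby points `T` is described by other submersions. This compares the tangent vectors there
with the one fixed `f`. -/
theorem IsLocalSubmersion.eventually_fderiv_eq_zero {E F : Type*} [NormedAddCommGroup E]
    [NormedSpace ℝ E] [FiniteDimensional ℝ E] [NormedAddCommGroup F] [NormedSpace ℝ F]
    [FiniteDimensional ℝ F] {M : Set E} {x : E} {f : E → F} {U : Set E}
    (h : IsLocalSubmersion M x f U) :
    ∀ᶠ y in 𝓝 x, ∀ v ∈ tangentVectors M y, fderiv ℝ f y v = 0 := by
  filter_upwards [h.isOpen.mem_nhds h.mem, eventually_eventually_nhds.2 h.eventually_iff]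
    with y hyU hy
  rintro v ⟨γ, h0, -, hγ, hM⟩
  have hd : HasFDerivAt f (fderiv ℝ f y) (γ 0) := by
    rw [h0]
    exact ((h.contDiffOn.contDiffAt (h.isOpen.mem_nhds hyU)).differentiableAt (by simp)).hasFDerivAt
  have h1 := hd.comp_hasDerivAt 0 hγ
  have h2 : (f ∘ γ) =ᶠ[𝓝 0] fun _ => 0 := by
    have := hγ.continuousAt.tendsto
    rw [h0] at this
    filter_upwards [hM, this.eventually hy] with t ht1 ht2
    exact ht2.1 ht1
  exact h1.unique ((hasDerivAt_const (0 : ℝ) (0 : F)).congr_of_eventuallyEq h2)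

section Neighbourhood

variable {α β g : ℕ} {ρ : Reality} {x y v : Coeffs α β g} {γ ν : ℝ → ℂ} {r : ℝ}

theorem isClosed_outside : IsClosed (outside x r) := by
  have : outside x r = ⋂ w, ⋂ (_ : (polyA x).IsRoot w), (Metric.ball w r)ᶜ := by
    ext z; simp [outside]
  rw [this]
  exact isClosed_iInter fun w => isClosed_iInter fun _ => Metric.isOpen_ball.isClosed_compl

theorem eval_ne_zero_of_mem_outside (hr : 0 < r) {z : ℂ} (hz : z ∈ outside x r) :
    (polyA x).eval z ≠ 0 := fun h => hz z h (Metric.mem_ball_self hr)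

theorem mem_neighbourhood_self (hr : 0 < r) (h0 : x.1 (Fin.last _) ≠ 0) :
    x ∈ neighbourhood x r := by
  refine ⟨by rw [div_self h0]; simp, fun z hz => ?_⟩
  rw [div_self (eval_ne_zero_of_mem_outside hr hz)]; simp

/-- The condition ranges over a non-compact set. Near infinity it is controlled in the coordinate `1
/ z` by the top coefficients, and on the compact rest positivity is stable. -/
theorem isOpen_neighbourhood (hr : 0 < r) (h0 : x.1 (Fin.last _) ≠ 0) :
    IsOpen (neighbourhood x r) := by
  rw [isOpen_iff_mem_nhds]
  rintro y ⟨hy1, hy2⟩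
  let F : Coeffs α β g × ℂ → ℝ := fun p => ((polyA p.1).eval p.2 / (polyA x).eval p.2).re
  let G : Coeffs α β g × ℂ → ℝ := fun p =>
    ((reflect (degA α β g) (polyA p.1)).eval p.2 / (reflect (degA α β g) (polyA x)).eval p.2).re
  have c0 : ∀ (n : ℕ) (p : ℂ[X]), (reflect n p).eval 0 = p.coeff n := fun n p => by
    rw [← coeff_zero_eq_eval_zero, coeff_reflect, revAt_le (Nat.zero_le n), Nat.sub_zero]
  have hF : ∀ z ∈ outside x r, ContinuousAt F (y, z) := fun z hz => by
    refine Complex.continuous_re.continuousAt.comp (ContinuousAt.div ?_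
      ((polyA x).continuous.continuousAt.comp continuousAt_snd)
      (eval_ne_zero_of_mem_outside hr hz))
    have : Continuous fun p : Coeffs α β g × ℂ => evalA p.2 p.1 :=
      (continuous_evalA.comp continuous_snd).clm_apply continuous_fst
    simp only [evalA_apply] at this
    exact this.continuousAt
  have hG : ContinuousAt G (y, 0) := by
    refine Complex.continuous_re.continuousAt.comp (ContinuousAt.div ?_
      ((reflect (degA α β g) (polyA x)).continuous.continuousAt.comp continuousAt_snd) ?_)
    · have : Continuous fun p : Coeffs α β g × ℂ =>
          ∑ i ∈ Finset.range (degA α β g + 1), coeffA (revAt (degA α β g) i) p.1 * p.2 ^ i := by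
        fun_prop
      have e : (fun p : Coeffs α β g × ℂ => (reflect (degA α β g) (polyA p.1)).eval p.2) =
          fun p => ∑ i ∈ Finset.range (degA α β g + 1),
            coeffA (revAt (degA α β g) i) p.1 * p.2 ^ i := by
        ext p
        rw [eval_eq_sum_range' (Nat.lt_succ_of_le (natDegree_reflect_le.trans
          (max_le le_rfl natDegree_polyA_le)))]
        simp only [coeff_reflect, coeffA_apply]
      rw [e]
      exact this.continuousAt
    · show (reflect (degA α β g) (polyA x)).eval 0 ≠ 0
      rwa [c0, coeff_polyA_top]
  have hG0 : 0 < G (y, 0) := by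
    show 0 < ((reflect (degA α β g) (polyA y)).eval 0 /
      (reflect (degA α β g) (polyA x)).eval 0).re
    rwa [c0, c0, coeff_polyA_top, coeff_polyA_top]
  have hGe := hG.tendsto.eventually_const_lt hG0
  rw [nhds_prod_eq, Filter.eventually_prod_iff] at hGe
  obtain ⟨p1, hp1, p2, hp2, hp⟩ := hGe
  obtain ⟨δ, hδ, hball⟩ := Metric.eventually_nhds_iff_ball.1 hp2
  have hK : IsCompact (outside x r ∩ Metric.closedBall 0 (2 / δ)) :=
    (isCompact_closedBall (0 : ℂ) (2 / δ)).inter_left isClosed_outside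
  have hFe := hK.eventually_forall_of_forall_eventually (x₀ := y) (P := fun y z => 0 < F (y, z))
    fun z hz => (hF z hz.1).tendsto.eventually_const_lt (hy2 z hz.1)
  have htop : ∀ᶠ y' : Coeffs α β g in 𝓝 y, 0 < (y'.1 (Fin.last _) / x.1 (Fin.last _)).re := by
    have : Continuous fun y' : Coeffs α β g => (y'.1 (Fin.last _) / x.1 (Fin.last _)).re := by
      fun_prop
    exact this.continuousAt.tendsto.eventually_const_lt hy1
  filter_upwards [hp1, hFe, htop] with y' h1 h2 h3
  refine ⟨h3, fun z hz => ?_⟩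
  by_cases hzn : ‖z‖ ≤ 2 / δ
  · exact h2 z ⟨hz, mem_closedBall_zero_iff.2 hzn⟩
  · push Not at hzn
    have hz0 : z ≠ 0 := by
      rintro rfl
      rw [norm_zero] at hzn
      exact absurd hzn (not_lt.2 (by positivity))
    have hmem : z⁻¹ ∈ Metric.ball (0 : ℂ) δ := by
      rw [mem_ball_zero_iff, norm_inv]
      refine inv_lt_of_inv_lt₀ hδ (lt_trans ?_ hzn)
      rw [inv_eq_one_div]
      exact div_lt_div_of_pos_right one_lt_two hδ
    have h4 : 0 < G (y', z⁻¹) := hp h1 (hball _ hmem)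
    have e : (polyA y').eval z / (polyA x).eval z = (reflect (degA α β g) (polyA y')).eval z⁻¹ /
        (reflect (degA α β g) (polyA x)).eval z⁻¹ := by
      rw [eval_eq_pow_mul_reflect natDegree_polyA_le hz0,
        eval_eq_pow_mul_reflect (natDegree_polyA_le (x := x)) hz0,
        mul_div_mul_left _ _ (pow_ne_zero _ hz0)]
    rw [e]; exact h4

theorem neighbourhood_subset_positiveSet (h : ∀ t ∈ Set.Icc (0 : ℝ) 1, γ t ∈ outside x r) :
    neighbourhood x r ⊆ positiveSet (ratio x γ) := fun y hy t ht => by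
  rw [ratio_apply]; exact hy.2 _ (h t ht)

theorem exists_isAdmissibleRadius (hA : polyA x ≠ 0) (h0 : β = 1 → (polyA x).eval 0 ≠ 0) :
    ∃ r, IsAdmissibleRadius x r := by
  classical
  set Z := (polyA x).roots.toFinset
  have hZ : ∀ z, z ∈ Z ↔ (polyA x).IsRoot z := fun z => by
    rw [Multiset.mem_toFinset, mem_roots hA]
  have h1 : ∀ᶠ r : ℝ in 𝓝[>] 0, ∀ w ∈ Z, ∀ w' ∈ Z, w ≠ w' →
      Disjoint (Metric.closedBall w r) (Metric.closedBall w' r) := by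
    refine (Filter.eventually_all_finset Z).2 fun w _ =>
      (Filter.eventually_all_finset Z).2 fun w' _ => ?_
    by_cases hne : w = w'
    · exact Filter.Eventually.of_forall fun r h => absurd hne h
    · have : (0 : ℝ) < dist w w' / 2 := by have := dist_pos.2 hne; positivity
      filter_upwards [Ioo_mem_nhdsGT this] with r hr _
      exact Metric.closedBall_disjoint_closedBall (by linarith [hr.2])
  have h2 : ∀ᶠ r : ℝ in 𝓝[>] 0, ∀ w ∈ Z, β = 1 → (0 : ℂ) ∉ Metric.closedBall w r := by
    refine (Filter.eventually_all_finset Z).2 fun w hw => ?_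
    by_cases hβ : β = 1
    · have hw0 : w ≠ 0 := by
        rintro rfl
        exact h0 hβ ((hZ 0).1 hw)
      filter_upwards [Ioo_mem_nhdsGT (norm_pos_iff.2 hw0)] with r hr _ hm
      rw [Metric.mem_closedBall, dist_zero_left] at hm
      exact absurd hr.2 (not_lt.2 hm)
    · exact Filter.Eventually.of_forall fun r h => absurd h hβ
  obtain ⟨r, hr1, hr2, hr3⟩ := (h1.and (h2.and self_mem_nhdsWithin)).exists
  exact ⟨r, hr3, fun z w hz hw => hr1 z ((hZ z).2 hz) w ((hZ w).2 hw),
    fun hβ z hz => hr2 z ((hZ z).2 hz) hβ⟩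

/-- A variation of the spectral data which preserves all periods is given by the flow of
some `c`. -/
theorem exists_integrability_of_periods (hα : α ≤ 1) (hβ : β ≤ 1) (hg : α ≤ g)
    (hx : x ∈ spaceT α β g ρ) (hr : IsAdmissibleRadius x r) (hy : y ∈ spaceT α β g ρ)
    (hyx : y ∈ neighbourhood x r)
    (h : ∀ γ ν : ℝ → ℂ, IsCycle x γ ν → (∀ t ∈ Set.Icc (0 : ℝ) 1, γ t ∈ outside x r) →
      fderiv ℝ (period x γ ν) y v = 0) : ∃ c : ℂ[X], Integrability y v c := by
  classical
  obtain ⟨hx1, hx2, hx3⟩ := mem_spaceT_iff.1 hx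
  obtain ⟨hy1, hy2, hy3⟩ := mem_spaceT_iff.1 hy
  obtain ⟨hr0, hr1, hr2⟩ := hr
  set Z := (polyA x).roots.toFinset with hZdef
  have hZ : ∀ z, z ∈ Z ↔ (polyA x).IsRoot z := fun z => by
    rw [Multiset.mem_toFinset, mem_roots hx1.A_ne_zero]
  have hcard : Z.card = degA α β g := by
    rw [hZdef, Multiset.toFinset_card_of_nodup (nodup_roots hx2), ← hx1.natDegree_A]
    exact (splits_iff_card_roots.1 (IsAlgClosed.splits _))
  have hd : ∀ w ∈ Z, ∀ w' ∈ Z, w ≠ w' →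
      Disjoint (Metric.closedBall w r) (Metric.closedBall w' r) := fun w hw w' hw' =>
    hr1 w w' ((hZ w).1 hw) ((hZ w').1 hw')
  -- There are as many disjoint discs as the degree of `polyA y`, so one root in each of them gives
  -- the complete factorisation.
  have hroot : ∀ w, ∃ ε : ℂ, w ∈ Z → ε ∈ Metric.ball w r ∧ (polyA y).eval ε = 0 := by
    intro w
    by_cases hw : w ∈ Z
    · obtain ⟨ε, h1, h2⟩ := exists_root_of_re_pos (A := polyA x) (B := polyA y) hr0 ((hZ w).1 hw)
        fun z hz => hyx.2 z fun w' hw' hzw' => by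
          rcases eq_or_ne w w' with rfl | hne
          · exact absurd (Metric.mem_sphere.1 hz) (Metric.mem_ball.1 hzw').ne
          · exact Set.disjoint_left.1 (hd w hw w' ((hZ w').2 hw') hne)
              (Metric.sphere_subset_closedBall hz) (Metric.ball_subset_closedBall hzw')
      exact ⟨ε, fun _ => ⟨h1, h2⟩⟩
    · exact ⟨0, fun h => absurd h hw⟩
  choose ε hε using hroot
  have hinj : Set.InjOn ε Z := fun w hw w' hw' he => by
    by_contra hne
    refine Set.disjoint_left.1 (hd w hw w' hw' hne)
      (Metric.ball_subset_closedBall (hε w hw).1) ?_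
    rw [he]
    exact Metric.ball_subset_closedBall (hε w' hw').1
  obtain ⟨l, hl, ha⟩ := eq_C_mul_prod hy1.A_ne_zero hinj (fun w hw => (hε w hw).2)
    (by rw [hcard, hy1.natDegree_A])
  -- The exponents `e = (1 - α) β` in the curve and `j = α β` in `c / (λ ^ j ν)` have sum `β`, so `e
  -- + j = 1` says that `0` is marked.
  have hej : (1 - α) * β + α * β = β := by rw [← add_mul, Nat.sub_add_cancel hα, one_mul]
  have hZ' : Z.Nonempty ∨ (1 - α) * β = 1 := by
    by_cases hda : degA α β g = 0
    · right
      rw [degA] at hda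
      have hg0 : g = 0 := by omega
      have hα0 : α = 0 := by omega
      have hβ1 : β = 1 := by
        by_contra hb
        rw [hα0, show β = 0 by omega] at hda; omega
      rw [hα0, hβ1]
    · left
      rw [← Finset.card_pos, hcard]; omega
  have hk : β + α * β = (1 - α) * β + 2 * (α * β) := by rw [two_mul, ← add_assoc, hej]
  obtain ⟨c, hc⟩ := exists_polynomial_of_periods (R := curveRHS y)
    (h := fun z => (2 * polyA y * polyB v - polyA v * polyB y).eval z /
      (2 * z ^ (2 * (α * β)) * curveRHS y z)) (e := (1 - α) * β) (j := α * β)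
    hr0 hd (fun w hw => (hε w hw).1) hl ha (by omega)
    (fun hb w hw => hr2 (by omega) w ((hZ w).1 hw)) hZ' (fun z => rfl) (fun z => rfl) (by
      rintro q J ⟨γ, μ, hp, h0, h1, hJ⟩
      have hout : ∀ t ∈ Set.Icc (0 : ℝ) 1, γ t ∈ outside x r := fun t ht w hw hm =>
        absurd ((hp.mem t ht).1 w ((hZ w).2 hw)) (not_lt.2 (Metric.mem_ball.1 hm).le)
      have hpos := neighbourhood_subset_positiveSet hout hyx
      have hAx : ∀ t ∈ Set.Icc (0 : ℝ) 1, (polyA x).eval (γ t) ≠ 0 := fun t ht =>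
        eval_ne_zero_of_mem_outside hr0 (hout t ht)
      have hAy : ∀ t ∈ Set.Icc (0 : ℝ) 1, (polyA y).eval (γ t) ≠ 0 := fun t ht h0 => by
        have := hpos t ht
        rw [ratio_apply, h0, zero_div] at this
        simp at this
      have hcyc : IsCycle y γ μ :=
        { continuousOn_fst := hp.continuousOn_fst
          continuousOn_snd := hp.continuousOn_snd
          closed_fst := congrArg Prod.fst (h0.trans h1.symm)
          closed_snd := congrArg Prod.snd (h0.trans h1.symm)
          piecewise := hp.piecewise
          ne_zero := fun hb t ht => (hp.mem t ht).2 (by omega)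
          not_root := hAy
          on_curve := hp.on_curve }
      have hpos' : x ∈ positiveSet (ratio y γ) := fun t ht => by
        have := hpos t ht
        rw [ratio_apply] at this ⊢
        rw [← inv_div, Complex.inv_re]
        refine div_pos this (Complex.normSq_pos.2 fun h0 => ?_)
        rw [h0] at this; simp at this
      have hcyc' := hcyc.continuedLift hpos'
      -- A closed path on the curve of `y` is carried to the curve of `x` and back. Positive real
      -- part makes the principal roots of a quotient and of its inverse reciprocal, so each loop of
      -- `y` comes from a cycle of `x`, to which the hypothesis applies.
      have hback : ∀ t ∈ Set.Icc (0 : ℝ) 1,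
          continuedLift x y γ (continuedLift y x γ μ) t = μ t := fun t ht => by
        have h2 := hpos t ht
        rw [ratio_apply] at h2
        have h3 : ((polyA x).eval (γ t) / (polyA y).eval (γ t)) ^ (1 / 2 : ℂ) =
            (((polyA y).eval (γ t) / (polyA x).eval (γ t)) ^ (1 / 2 : ℂ))⁻¹ := by
          rw [← inv_div, Complex.inv_cpow]
          exact fun harg => by
            rw [Complex.arg_eq_pi_iff] at harg
            linarith [harg.1]
        have h4 : ((polyA y).eval (γ t) / (polyA x).eval (γ t)) ^ (1 / 2 : ℂ) ≠ 0 := by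
          rw [Ne, Complex.cpow_eq_zero_iff]
          exact fun h => div_ne_zero (hAy t ht) (hAx t ht) h.1
        rw [continuedLift, continuedLift, h3, inv_mul_cancel_right₀ h4]
      obtain ⟨L, hL, hLv⟩ := hcyc'.hasFDerivAt_period hβ hpos
      have h5 := h γ _ hcyc' hout
      rw [hL.fderiv, hLv] at h5
      rw [← hJ, ← h5]
      refine intervalIntegral.integral_congr fun t ht => ?_
      rw [Set.uIcc_of_le zero_le_one] at ht
      simp only
      rw [hback t ht, div_div, curveRHS, hk, pow_add]
      congr 2
      ring)
  refine ⟨c, ?_⟩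
  rw [integrability_iff, flowRHS]
  have e1 : 2 * (α * β) + (1 - α) * β = β * (1 + α) := by rw [mul_add, mul_one, mul_comm β α]; omega
  have e2 : 1 - (1 - α) * β - α * β = 1 - β := by omega
  rw [e1, e2] at hc
  exact hc.symm

theorem fderiv_period_eq_zero (hα : α ≤ 1) (hβ : β ≤ 1) (hcyc : IsCycle x γ ν)
    (hy : y ∈ positiveSet (ratio x γ)) {c : ℂ[X]} (hI : Integrability y v c) :
    ∃ L : Coeffs α β g →L[ℝ] ℂ, HasFDerivAt (period x γ ν) L y ∧ L v = 0 := by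
  obtain ⟨L, hL, hLv⟩ := hcyc.hasFDerivAt_period hβ hy
  exact ⟨L, hL, by rw [hLv, (hcyc.continuedLift hy).integral_eq_zero hα hβ hI]⟩

theorem mem_periodKernel_iff (hα : α ≤ 1) (hβ : β ≤ 1) (hg : α ≤ g)
    (hx : x ∈ spaceT α β g ρ) : v ∈ periodKernel x ↔ ∃ c : ℂ[X], Integrability x v c := by
  obtain ⟨hx1, hx2, hx3⟩ := mem_spaceT_iff.1 hx
  constructor
  · intro hv
    obtain ⟨r, hr⟩ := exists_isAdmissibleRadius hx1.A_ne_zero hx1.eval_zero_a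
    refine exists_integrability_of_periods hα hβ hg hx hr hx
      (mem_neighbourhood_self hr.1 hx1.normalised.top_ne_zero) fun γ ν hc _ => ?_
    obtain ⟨L, hL, hLv⟩ := hv γ ν hc
    rw [hL.fderiv, hLv]
  · rintro ⟨c, hc⟩ γ ν hcyc
    exact fderiv_period_eq_zero hα hβ hcyc hcyc.mem_positiveSet_self hc

/-- The level set theorem is applied at an arbitrary point `y` of the set, to the real and imaginary
parts of all periods. The flow spaces have constant dimension along `T`, and at `y` they exhaust the
common kernel, because the exactness statement holds at every point of the neighbourhood that lies
in `T`. -/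
theorem isSmoothSubmanifold_isoperiodicSet (hα : α ≤ 1) (hβ : β ≤ 1) (hg : α ≤ g)
    (hρ : β = 0 → ρ = .line) (hx : x ∈ spaceT α β g ρ) (hr : IsAdmissibleRadius x r) :
    IsSmoothSubmanifold (g + 2 + α * β) (isoperiodicSet ρ x r ∩ spaceT α β g ρ) := by
  rintro y ⟨⟨-, hyx, hyp⟩, hy⟩
  have htop := (mem_spaceT_iff.1 hx).1.normalised.top_ne_zero
  obtain ⟨V, S, f, hf, -, hker⟩ := exists_isLocalSubmersion_spaceT hα hβ hg hρ hy
  let T : Bool → ℂ →L[ℝ] ℝ := fun b => if b then Complex.reCLM else Complex.imCLM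
  have hT : ∀ w w' : ℂ, w = w' ↔ ∀ b, T b w = T b w' := fun w w' => by
    rw [Complex.ext_iff, Bool.forall_bool]
    simp [T, and_comm]
  let P : {p : (ℝ → ℂ) × (ℝ → ℂ) // IsCycle x p.1 p.2 ∧
      ∀ t ∈ Set.Icc (0 : ℝ) 1, p.1 t ∈ outside x r} × Bool → Coeffs α β g → ℝ :=
    fun i z => T i.2 (period x i.1.1.1 i.1.1.2 z)
  have hOo := isOpen_neighbourhood hr.1 htop
  have hP : ∀ i, ContDiffOn ℝ ∞ (P i) (neighbourhood x r) := fun i =>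
    (T i.2).contDiff.comp_contDiffOn ((i.1.2.1.contDiffOn_period hβ).mono
      (neighbourhood_subset_positiveSet i.1.2.2))
  have hfd : ∀ i, ∀ z ∈ neighbourhood x r, ∀ v, fderiv ℝ (P i) z v =
      T i.2 (fderiv ℝ (period x i.1.1.1 i.1.1.2) z v) := fun i z hz v => by
    obtain ⟨L, hL, -⟩ := i.1.2.1.hasFDerivAt_period hβ
      (neighbourhood_subset_positiveSet i.1.2.2 hz)
    have h1 : HasFDerivAt (P i) ((T i.2).comp L) z := (T i.2).hasFDerivAt.comp z hL
    rw [h1.fderiv, hL.fderiv]; rfl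
  have hflow : ∀ z ∈ neighbourhood x r, ∀ v ∈ flowSpace ρ z, ∀ i, fderiv ℝ (P i) z v = 0 := by
    rintro z hz v ⟨-, c, hc⟩ i
    obtain ⟨L, hL, hLv⟩ := fderiv_period_eq_zero hα hβ i.1.2.1
      (neighbourhood_subset_positiveSet i.1.2.2 hz) hc
    rw [hfd i z hz, hL.fderiv, hLv, map_zero]
  have key := exists_isLocalSubmersion_levelSet (d := g + 2 + α * β)
    (N := isoperiodicSet ρ x r ∩ spaceT α β g ρ) hf hOo hyx hP ?_ ?_ ?_
  · obtain ⟨m, f', hf', hdim⟩ := key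
    exact hf'.exists_submersion hdim
  · filter_upwards [hOo.mem_nhds hyx] with z hz
    constructor
    · rintro ⟨⟨-, -, hzp⟩, hzT⟩
      refine ⟨hzT, fun i => ?_⟩
      simp only [P]
      rw [hzp _ _ i.1.2.1 i.1.2.2, hyp _ _ i.1.2.1 i.1.2.2]
    · rintro ⟨hzT, hzP⟩
      refine ⟨⟨hzT.1, hz, fun γ ν hc ho => ?_⟩, hzT⟩
      rw [← hyp γ ν hc ho, hT]
      exact fun b => hzP (⟨(γ, ν), hc, ho⟩, b)
  · filter_upwards [hOo.mem_nhds hyx, hf.eventually_fderiv_eq_zero] with z hz hzf hzT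
    refine ⟨flowSpace ρ z, finrank_flowSpace hα hβ hg hρ hzT, fun v hv => ⟨hzf v ?_, hflow z hz v hv⟩⟩
    rw [tangentVectors_spaceT hα hβ hg hρ hzT]
    exact hv.1
  · refine ⟨flowSpace ρ y, finrank_flowSpace hα hβ hg hρ hy, fun v => ⟨fun hv =>
      ⟨(hker v).2 hv.1, hflow y hyx v hv⟩, fun hv => ⟨(hker v).1 hv.1, ?_⟩⟩⟩
    refine exists_integrability_of_periods hα hβ hg hx hr hy hyx fun γ ν hc ho => ?_
    rw [hT]
    intro b
    have := hv.2 (⟨(γ, ν), hc, ho⟩, b)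
    rw [hfd _ y hyx] at this
    rw [map_zero]; exact this

end Neighbourhood

end Whitham

theorem mainTheorem3 (α β g : ℕ) (hα : α ≤ 1) (hβ : β ≤ 1) (hg : α ≤ g)
    (ρ : Whitham.Reality) (hρ : β = 0 → ρ = Whitham.Reality.line) :
    -- the space `T` is a manifold
    Whitham.IsSmoothSubmanifold (3 * g + 2 + α * β - 2 * α) (Whitham.spaceT α β g ρ) ∧
    ∀ x ∈ Whitham.spaceT α β g ρ,
      -- each admissible `c` determines a unique tangent vector
      (∀ c : Polynomial ℂ, Whitham.IsAdmissible α β g ρ c →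
        ∃! v : Whitham.Coeffs α β g,
          v ∈ Whitham.tangentVectors (Whitham.spaceT α β g ρ) x ∧
            Whitham.Integrability x v c) ∧
      -- these tangent vectors are the common kernel of the derivatives of the periods
      (∀ v ∈ Whitham.tangentVectors (Whitham.spaceT α β g ρ) x,
        v ∈ Whitham.periodKernel x ↔
          ∃ c : Polynomial ℂ, Whitham.IsAdmissible α β g ρ c ∧ Whitham.Integrability x v c) ∧
      -- the isoperiodic set is a submanifold
      (∀ r : ℝ, Whitham.IsAdmissibleRadius x r →
        Whitham.IsSmoothSubmanifold (g + 2 + α * β)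
          (Whitham.isoperiodicSet ρ x r ∩ Whitham.spaceT α β g ρ)) := by
  refine ⟨Whitham.isSmoothSubmanifold_spaceT hα hβ hg hρ, fun x hx => ⟨fun c hc => ?_,
    fun v hv => ?_, fun r hr =>
      Whitham.isSmoothSubmanifold_isoperiodicSet hα hβ hg hρ hx hr⟩⟩
  · rw [Whitham.tangentVectors_spaceT hα hβ hg hρ hx]
    exact Whitham.existsUnique_integrability hα hβ hg hρ hx hc
  · rw [Whitham.tangentVectors_spaceT hα hβ hg hρ hx] at hv
    rw [Whitham.mem_periodKernel_iff hα hβ hg hx]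
    exact ⟨fun ⟨c, hc⟩ => ⟨c, hc.isAdmissible hα hβ hg hρ hx hv.1, hc⟩,
      fun ⟨c, _, hc⟩ => ⟨c, hc⟩⟩
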